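/- Let $\mathbb K\in\{\mathbb R,\mathbb C\}$, let $G$ be a Hausdorff locally convex space over $\mathbb K$ with topological dual $G'$, let $M$ be a finite-dimensional smooth (Hausdorff, second countable) manifold, possibly with boundary, and let $U\subseteq M$ be open. Write $\mathcal A(U)=C^\infty(U,\mathbb R)$, and let $\mathcal A(U,G)$ be the $\mathcal A(U)$-module of maps $U\to G$ that are smooth in the sense of Bastiani in every chart ($h$ is $C^k$ if it is continuous and, for $k\ge1$, its directional derivatives exist at interior points and extend to a $C^{k-1}$ map in (point, direction); smooth means $C^k$ for all $k$). Let $\mathrm{Alt}^k(U,M)$ be the module of alternating $\mathcal A(U)$-multilinear maps $\Gamma(U,TM)^k\to\mathcal A(U)$, and put $$\mathrm{Alt}^k(U,M;G)=\mathcal A(U,G)\otimes_{\mathcal A(U)}\mathrm{Alt}^k(U,M),\qquad \mathrm{Alt}^\bullet=\bigoplus_{k\ge0}\mathrm{Alt}^k .$$ For $\omega\in\mathrm{Alt}^k(U,M)$ put $\omega\wedge(f\otimes\zeta)=f\otimes(\omega\wedge\zeta)$; for a continuous $\mathbb R$-linear $\chi:G\to\mathbb R$ put $\chi_\times(f\otimes\zeta)=(\chi\circ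 f)\otimes\zeta$; for a smooth map $F:U\to U'$ put $F^\times(f\otimes\zeta)=(f\circ F)\otimes F^*\zeta$. Identify $\mathrm{Alt}^\bullet(U,M;\mathbb R)$ with $\mathrm{Alt}^\bullet(U,M)$ by $f\otimes\zeta\mapsto f\zeta$. There is exactly one map $d:\mathrm{Alt}^\bullet(U,M;G)\to\mathrm{Alt}^\bullet(U,M;G)$ such that for every chart of $M$ with domain $V\subseteq U$ and coordinates $x_1,\dots,x_n$, if the restriction of $\theta$ to $V$ is $\sum_I f_I\otimes dx_I$ (the sum is over the increasing multi-indices $I$; the $f_I\in\mathcal A(V,G)$ are unique), then the restriction of $d\theta$ to $V$ is $\sum_I\sum_j\partial_jf_I\otimes(dx_j\wedge dx_I)$. It has the following properties. 1. $d$ is $\mathbb R$-linear. 2. $d(\omega\wedge\eta)=d\omega\wedge\eta+(-1)^{k}\,\omega\wedge d\eta$ for all $k\ge0$, $\omega\in\mathrm{Alt}^k(U,M)$ and $\eta\in\mathrm{Alt}^\bullet(U,M;G)$. 3. $d\circ d=0$. 4. For all $\psi\in G'$ and $f\in\mathcal A(U,G)$, the form $(\mathrm{Re}\circ\psi)_\times(df)$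 is a $1$-form, and its value at every vector field $X\in\Gamma(U,TM)$ is $X(\mathrm{Re}\circ\psi\circ f)$, where $\mathrm{Re}$ is the identity if $\mathbb K=\mathbb R$. 5. If $N$ is another such manifold, $U'\subseteq N$ is open and $F:U\to U'$ is smooth, then $d\circ F^\times=F^\times\circ d$ on $\mathrm{Alt}^\bullet(U',N;G)$. -/

import Mathlib

open scoped Manifold ContDiff TensorProduct DirectSum

noncomputable section

namespace GForm

open Set Filter Topology

universe u

section Bastiani

set_option linter.unusedSectionVars false

variable {G : Type*} [AddCommGroup G] [Module ℝ G] [TopologicalSpace G]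

/-- `g` is the directional derivative of `f` at `x` in the direction `v`. -/
def HasDirDeriv {E : Type*} [AddCommGroup E] [Module ℝ E] (f : E → G) (x v : E) (g : G) : Prop :=
  Tendsto (fun t : ℝ => t⁻¹ • (f (x + t • v) - f x)) (𝓝[≠] 0) (𝓝 g)

/-- `f` is of class `C^k` on `s` in the sense of Bastiani (Michal-Bastiani, Keller `C^k_c`), for a
set `s` with dense interior: `f` is continuous on `s` and, for `k ≥ 1`, its directional derivatives
exist at the interior points of `s` and extend to a map `df` of class `C^(k-1)` on `s × E`. -/
def BastianiC : ℕ → ∀ {E : Type u} [NormedAddCommGroup E] [NormedSpace ℝ E],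
    Set E → (E → G) → Prop
  | 0, _, _, _, s, f => ContinuousOn f s
  | k + 1, E, _, _, s, f => ContinuousOn f s ∧ ∃ df : E × E → G,
      (∀ x ∈ interior s, ∀ v, HasDirDeriv f x v (df (x, v))) ∧
      BastianiC k (s ×ˢ (univ : Set E)) df

variable {E : Type u} [NormedAddCommGroup E] [NormedSpace ℝ E]

theorem BastianiC.continuousOn {k : ℕ} {s : Set E} {f : E → G} (h : BastianiC k s f) :
    ContinuousOn f s := by
  cases k with
  | zero => exact h
  | succ k => exact h.1

theorem BastianiC.of_succ {k : ℕ} {s : Set E} {f : E → G} (h : BastianiC (k + 1) s f) :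
    BastianiC k s f := by
  induction k generalizing E with
  | zero => exact h.1
  | succ k ih =>
    obtain ⟨hc, df, hd, hk⟩ := h
    exact ⟨hc, df, hd, ih hk⟩

theorem HasDirDeriv.congr {f g : E → G} {x v : E} {a : G} (h : HasDirDeriv f x v a)
    (hfg : f =ᶠ[𝓝 x] g) : HasDirDeriv g x v a := by
  refine Tendsto.congr' ?_ h
  have h1 : Tendsto (fun t : ℝ => x + t • v) (𝓝[≠] 0) (𝓝 x) := by
    have : Continuous (fun t : ℝ => x + t • v) := by fun_prop
    have := this.tendsto 0
    simp only [zero_smul, add_zero] at this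
    exact this.mono_left nhdsWithin_le_nhds
  filter_upwards [h1.eventually hfg] with t ht
  rw [ht, hfg.self_of_nhds]

theorem BastianiC.mono {k : ℕ} {s t : Set E} {f g : E → G} (h : BastianiC k s f)
    (hts : t ⊆ s) (hfg : EqOn f g t) : BastianiC k t g := by
  induction k generalizing E with
  | zero => exact (ContinuousOn.mono h hts).congr hfg.symm
  | succ k ih =>
    obtain ⟨hc, df, hd, hk⟩ := h
    refine ⟨(hc.mono hts).congr hfg.symm, df, fun x hx v => ?_, ?_⟩
    · refine (hd x (interior_mono hts hx) v).congr ?_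
      filter_upwards [isOpen_interior.mem_nhds hx] with y hy using hfg (interior_subset hy)
    · exact ih hk (prod_mono hts subset_rfl) fun _ _ => rfl

/-- Relatively open subsets of convex sets with nonempty interior, such as the images of charts of
manifolds with boundary or corners. -/
def GoodSet (s : Set E) : Prop :=
  ∃ u C : Set E, IsOpen u ∧ Convex ℝ C ∧ (interior C).Nonempty ∧ s = u ∩ C

theorem GoodSet.inter {s u : Set E} (hs : GoodSet s) (hu : IsOpen u) : GoodSet (s ∩ u) := by
  obtain ⟨w, C, hw, hC, hi, rfl⟩ := hs
  exact ⟨w ∩ u, C, hw.inter hu, hC, hi, by rw [inter_right_comm]⟩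

theorem GoodSet.prod {s : Set E} (hs : GoodSet s) : GoodSet (s ×ˢ (univ : Set E)) := by
  obtain ⟨w, C, hw, hC, hi, rfl⟩ := hs
  refine ⟨w ×ˢ univ, C ×ˢ univ, hw.prod isOpen_univ, hC.prod convex_univ, ?_, ?_⟩
  · rw [interior_prod_eq]; simpa using hi
  · rw [prod_inter_prod, inter_univ]

theorem GoodSet.subset_closure {s : Set E} (hs : GoodSet s) : s ⊆ closure (interior s) := by
  obtain ⟨w, C, hw, hC, hi, rfl⟩ := hs
  rw [interior_inter, hw.interior_eq]
  rintro x ⟨hx, hx'⟩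
  refine hw.inter_closure ⟨hx, ?_⟩
  rw [hC.closure_interior_eq_closure_of_nonempty_interior hi]
  exact _root_.subset_closure hx'

theorem GoodSet.uniqueDiffOn {s : Set E} (hs : GoodSet s) : UniqueDiffOn ℝ s := by
  obtain ⟨w, C, hw, hC, hi, rfl⟩ := hs
  rw [inter_comm]
  exact (uniqueDiffOn_convex hC hi).inter hw

variable [T2Space G]

theorem dir_unique {s : Set E} (hs : GoodSet s) {f : E → G} {df df' : E × E → G}
    (h : ∀ x ∈ interior s, ∀ v, HasDirDeriv f x v (df (x, v)))
    (h' : ∀ x ∈ interior s, ∀ v, HasDirDeriv f x v (df' (x, v)))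
    (hc : ContinuousOn df (s ×ˢ (univ : Set E)))
    (hc' : ContinuousOn df' (s ×ˢ (univ : Set E))) : EqOn df df' (s ×ˢ (univ : Set E)) := by
  have h0 : EqOn df df' (interior s ×ˢ (univ : Set E)) := fun p hp =>
    tendsto_nhds_unique (h p.1 hp.1 p.2) (h' p.1 hp.1 p.2)
  refine h0.of_subset_closure hc hc' (prod_mono interior_subset subset_rfl) ?_
  have := hs.prod.subset_closure
  rwa [interior_prod_eq, interior_univ] at this

theorem BastianiC.of_local {k : ℕ} {s : Set E} (hs : GoodSet s) {f : E → G}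
    (h : ∀ x ∈ s, ∃ u, IsOpen u ∧ x ∈ u ∧ BastianiC k (s ∩ u) f) : BastianiC k s f := by
  induction k generalizing E with
  | zero =>
    intro x hx
    obtain ⟨u, hu, hxu, h⟩ := h x hx
    exact (h x ⟨hx, hxu⟩).mono_of_mem_nhdsWithin (inter_mem_nhdsWithin s (hu.mem_nhds hxu))
  | succ k ih =>
    choose! u hu hxu hc d hd hk using h
    let df : E × E → G := fun p => d p.1 p
    have key : ∀ x ∈ s, EqOn (d x) df ((s ∩ u x) ×ˢ univ) := by
      rintro x hx ⟨y, v⟩ ⟨⟨hys, hyu⟩, -⟩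
      have hg : GoodSet ((s ∩ u x) ∩ u y) := (hs.inter (hu x hx)).inter (hu y hys)
      have h1 : (s ∩ u x) ∩ u y ⊆ s ∩ u x := inter_subset_left
      have h2 : (s ∩ u x) ∩ u y ⊆ s ∩ u y := fun z hz => ⟨hz.1.1, hz.2⟩
      exact dir_unique hg (fun z hz => hd x hx z (interior_mono h1 hz))
        (fun z hz => hd y hys z (interior_mono h2 hz))
        ((hk x hx).continuousOn.mono (prod_mono h1 subset_rfl))
        ((hk y hys).continuousOn.mono (prod_mono h2 subset_rfl))
        (show (y, v) ∈ _ from ⟨⟨⟨hys, hyu⟩, hxu y hys⟩, mem_univ _⟩)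
    refine ⟨?_, df, fun x hx v => ?_, ih hs.prod ?_⟩
    · intro x hx
      exact (hc x hx x ⟨hx, hxu x hx⟩).mono_of_mem_nhdsWithin
        (inter_mem_nhdsWithin s ((hu x hx).mem_nhds (hxu x hx)))
    · have hxs := interior_subset hx
      refine hd x hxs x ?_ v
      rw [interior_inter, (hu x hxs).interior_eq]
      exact ⟨hx, hxu x hxs⟩
    · rintro ⟨x, v⟩ ⟨hx, -⟩
      refine ⟨u x ×ˢ univ, (hu x hx).prod isOpen_univ, ⟨hxu x hx, mem_univ _⟩, ?_⟩
      refine (hk x hx).mono ?_ ?_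
      · rintro ⟨y, w⟩ ⟨⟨h1, -⟩, h2, -⟩
        exact ⟨⟨h1, h2⟩, mem_univ _⟩
      · rintro ⟨y, w⟩ ⟨⟨h1, -⟩, h2, -⟩
        exact key x hx ⟨⟨h1, h2⟩, mem_univ _⟩


theorem BastianiC.const {k : ℕ} {s : Set E} (c : G) : BastianiC k s (fun _ : E => c) := by
  induction k generalizing E c with
  | zero => exact continuousOn_const
  | succ k ih =>
    refine ⟨continuousOn_const, fun _ => 0, fun x _ v => ?_, ih 0⟩
    simp only [HasDirDeriv, sub_self, smul_zero]
    exact tendsto_const_nhds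

variable [IsTopologicalAddGroup G] [ContinuousSMul ℝ G]

theorem HasDirDeriv.add {f g : E → G} {x v : E} {a b : G} (hf : HasDirDeriv f x v a)
    (hg : HasDirDeriv g x v b) : HasDirDeriv (f + g) x v (a + b) := by
  refine (Tendsto.add hf hg).congr fun t => ?_
  simp only [Pi.add_apply, ← smul_add]
  congr 1
  abel

theorem HasDirDeriv.const_smul {f : E → G} {x v : E} {a : G} (hf : HasDirDeriv f x v a) (c : ℝ) :
    HasDirDeriv (c • f) x v (c • a) := by
  refine (Tendsto.const_smul hf c).congr fun t => ?_
  simp only [Pi.smul_apply, ← smul_sub]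
  rw [smul_comm]

theorem HasDirDeriv.smul_dir {f : E → G} {x v : E} {a : G} (hf : HasDirDeriv f x v a) (c : ℝ) :
    HasDirDeriv f x (c • v) (c • a) := by
  rcases eq_or_ne c 0 with rfl | hc
  · simp only [HasDirDeriv, smul_zero, add_zero, sub_self, zero_smul]
    exact tendsto_const_nhds
  · have h1 : Tendsto (fun t : ℝ => t * c) (𝓝[≠] 0) (𝓝[≠] 0) := by
      refine tendsto_nhdsWithin_iff.2 ⟨?_, ?_⟩
      · have : Continuous fun t : ℝ => t * c := by fun_prop
        have := this.tendsto 0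
        rw [zero_mul] at this
        exact this.mono_left nhdsWithin_le_nhds
      · filter_upwards [self_mem_nhdsWithin] with t ht using mul_ne_zero ht hc
    refine ((hf.comp h1).const_smul c).congr' ?_
    filter_upwards [self_mem_nhdsWithin] with t ht
    have ht : t ≠ 0 := ht
    simp only [Function.comp_apply, smul_smul]
    congr 1
    field_simp

theorem BastianiC.add {k : ℕ} {s : Set E} {f g : E → G} (hf : BastianiC k s f)
    (hg : BastianiC k s g) : BastianiC k s (f + g) := by
  induction k generalizing E with
  | zero => exact ContinuousOn.add hf hg
  | succ k ih =>
    obtain ⟨hc, df, hd, hk⟩ := hf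
    obtain ⟨hc', df', hd', hk'⟩ := hg
    exact ⟨hc.add hc', df + df', fun x hx v => (hd x hx v).add (hd' x hx v), ih hk hk'⟩

variable [LocallyConvexSpace ℝ G]

theorem mvt_mem {f : E → G} {x v : E} {df : ℝ → G} {K : Set G} (hK : Convex ℝ K)
    (hKc : IsClosed K) (hc : ContinuousOn (fun t : ℝ => f (x + t • v)) (Icc 0 1))
    (hd : ∀ t ∈ Ioo (0 : ℝ) 1, HasDirDeriv f (x + t • v) v (df t))
    (hm : ∀ t ∈ Ioo (0 : ℝ) 1, df t ∈ K) : f (x + v) - f x ∈ K := by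
  by_contra hn
  obtain ⟨ψ, a, h1, h2⟩ := geometric_hahn_banach_closed_point hK hKc hn
  have hder : ∀ t ∈ Ioo (0 : ℝ) 1,
      HasDerivAt (fun t : ℝ => ψ (f (x + t • v))) (ψ (df t)) t := by
    intro t ht
    rw [hasDerivAt_iff_tendsto_slope_zero]
    refine ((ψ.continuous.tendsto _).comp (hd t ht)).congr fun h => ?_
    simp only [Function.comp_apply, map_smul, map_sub, smul_eq_mul]
    rw [add_smul, add_assoc]
  obtain ⟨t, ht, he⟩ := exists_hasDerivAt_eq_slope (fun t : ℝ => ψ (f (x + t • v)))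
    (fun t => ψ (df t)) one_pos (ψ.continuous.comp_continuousOn hc) hder
  have := h1 _ (hm t ht)
  simp at he
  simp [he] at this h2
  linarith

theorem strict_mem {s : Set E} (hs : GoodSet s) {f : E → G} {df : E × E → G}
    (hf : ContinuousOn f s) (hd : ∀ x ∈ interior s, ∀ v, HasDirDeriv f x v (df (x, v)))
    (hc : ContinuousOn df (s ×ˢ (univ : Set E))) {x w : E} (hx : x ∈ s) {K : Set G}
    (hK : Convex ℝ K) (hKc : IsClosed K) (hKn : K ∈ 𝓝 (df (x, w))) :
    ∃ B ∈ 𝓝 x, ∃ N ∈ 𝓝 w, ∀ t : ℝ, t ≠ 0 → ∀ y ∈ B ∩ s, ∀ z ∈ B ∩ s,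
      t⁻¹ • (y - z) ∈ N → t⁻¹ • (f y - f z) ∈ K := by
  obtain ⟨u, C, hu, hC, hi, rfl⟩ := hs
  have h1 : df ⁻¹' K ∈ 𝓝[(u ∩ C) ×ˢ univ] (x, w) := (hc (x, w) ⟨hx, mem_univ _⟩) hKn
  rw [nhdsWithin_prod_eq, nhdsWithin_univ, mem_prod_iff] at h1
  obtain ⟨A, hA, N, hN, hAN⟩ := h1
  obtain ⟨A', hA', hAs⟩ := mem_nhdsWithin_iff_exists_mem_nhds_inter.1 hA
  obtain ⟨r, hr, hrA⟩ := Metric.mem_nhds_iff.1 (inter_mem hA' (hu.mem_nhds hx.1))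
  have hint : Metric.ball x r ∩ interior C ⊆ interior (u ∩ C) := by
    rw [interior_inter, hu.interior_eq]
    exact inter_subset_inter_left _ fun y hy => (hrA hy).2
  have hconv : Convex ℝ (Metric.ball x r ∩ interior C) := (convex_ball x r).inter hC.interior
  refine ⟨Metric.ball x r, Metric.ball_mem_nhds x hr, interior N, interior_mem_nhds.2 hN, ?_⟩
  intro t ht y hy z hz hyz
  have step : ∀ y ∈ Metric.ball x r ∩ interior C, ∀ z ∈ Metric.ball x r ∩ interior C,
      t⁻¹ • (y - z) ∈ N → t⁻¹ • (f y - f z) ∈ K := by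
    intro y hy z hz hyz
    have hseg : ∀ τ ∈ Icc (0 : ℝ) 1, z + τ • (y - z) ∈ Metric.ball x r ∩ interior C :=
      fun τ hτ => hconv.add_smul_sub_mem hz hy hτ
    have := mvt_mem (f := t⁻¹ • f) (x := z) (v := y - z) (K := K)
      (df := fun τ => df (z + τ • (y - z), t⁻¹ • (y - z))) hK hKc ?_ ?_ ?_
    · simpa [smul_sub] using this
    · refine ContinuousOn.const_smul (c := t⁻¹) (hf.comp (by fun_prop) fun τ hτ => ?_)
      exact interior_subset (hint (hseg τ hτ))
    · intro τ hτ
      have h3 := (hd _ (hint (hseg τ (Ioo_subset_Icc_self hτ))) (t⁻¹ • (y - z))).smul_dir t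
      rw [smul_inv_smul₀ ht] at h3
      have := h3.const_smul t⁻¹
      rwa [inv_smul_smul₀ ht] at this
    · intro τ hτ
      have h4 := hseg τ (Ioo_subset_Icc_self hτ)
      exact hAN ⟨hAs ⟨(hrA h4.1).1, interior_subset (hint h4)⟩, hyz⟩
  have hcl : ∀ y ∈ Metric.ball x r ∩ (u ∩ C), y ∈ closure (Metric.ball x r ∩ interior C) := by
    intro y hy
    refine Metric.isOpen_ball.inter_closure ⟨hy.1, ?_⟩
    rw [hC.closure_interior_eq_closure_of_nonempty_interior hi]
    exact subset_closure hy.2.2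
  have hp : (y, z) ∈ closure ((Metric.ball x r ∩ interior C) ×ˢ (Metric.ball x r ∩ interior C)) := by
    rw [closure_prod_eq]; exact ⟨hcl y hy, hcl z hz⟩
  have hne := mem_closure_iff_nhdsWithin_neBot.1 hp
  have hsub : (Metric.ball x r ∩ interior C) ⊆ u ∩ C := fun a ha => interior_subset (hint ha)
  have hcont : Tendsto (fun p : E × E => t⁻¹ • (f p.1 - f p.2))
      (𝓝[(Metric.ball x r ∩ interior C) ×ˢ (Metric.ball x r ∩ interior C)] (y, z))
      (𝓝 (t⁻¹ • (f y - f z))) := by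
    rw [nhdsWithin_prod_eq]
    refine Tendsto.const_smul (Tendsto.sub ?_ ?_) _
    · exact ((hf y hy.2).mono hsub).tendsto.comp tendsto_fst
    · exact ((hf z hz.2).mono hsub).tendsto.comp tendsto_snd
  refine hKc.mem_of_tendsto hcont ?_
  have h5 : Tendsto (fun p : E × E => t⁻¹ • (p.1 - p.2)) (𝓝 (y, z)) (𝓝 (t⁻¹ • (y - z))) :=
    Continuous.tendsto (by fun_prop) (y, z)
  filter_upwards [self_mem_nhdsWithin,
    nhdsWithin_le_nhds (h5.eventually (isOpen_interior.mem_nhds hyz))] with p hp hp'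
  exact step p.1 hp.1 p.2 hp.2 (interior_subset hp')

variable {E' : Type u} [NormedAddCommGroup E'] [NormedSpace ℝ E']

theorem HasDirDeriv.comp {s : Set E} (hs : GoodSet s) {f : E → G} {df : E × E → G}
    (hf : ContinuousOn f s) (hd : ∀ x ∈ interior s, ∀ v, HasDirDeriv f x v (df (x, v)))
    (hc : ContinuousOn df (s ×ˢ (univ : Set E))) {F : E' → E} {s' : Set E'} (hF : MapsTo F s' s)
    {x v : E'} {w : E} (hx : x ∈ interior s') (hFd : HasDirDeriv F x v w)
    (hFc : ContinuousAt F x) : HasDirDeriv (f ∘ F) x v (df (F x, w)) := by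
  have hlc := (LocallyConvexSpace.convex_basis (𝕜 := ℝ) (df (F x, w)))
  rw [HasDirDeriv]
  have hbase := LocallyConvexSpace.convex_basis_zero ℝ G
  intro U hU
  obtain ⟨K, ⟨hK0, hKc, hKx⟩, hKU⟩ : ∃ K, (K ∈ 𝓝 (df (F x, w)) ∧ IsClosed K ∧ Convex ℝ K) ∧ K ⊆ U := by
    obtain ⟨U', hU', hU'c, hUU⟩ := exists_mem_nhds_isClosed_subset hU
    obtain ⟨V, ⟨hV, hVc⟩, hVU⟩ := hlc.mem_iff.1 hU'
    exact ⟨closure V, ⟨mem_of_superset hV subset_closure, isClosed_closure, hVc.closure⟩,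
      (closure_minimal hVU hU'c).trans hUU⟩
  obtain ⟨B, hB, N, hN, hBN⟩ := strict_mem hs hf hd hc (hF (interior_subset hx)) hKx hKc hK0
  have h1 : Tendsto (fun t : ℝ => x + t • v) (𝓝[≠] 0) (𝓝 x) := by
    have : Continuous (fun t : ℝ => x + t • v) := by fun_prop
    have := this.tendsto 0
    simp only [zero_smul, add_zero] at this
    exact this.mono_left nhdsWithin_le_nhds
  change ∀ᶠ t in 𝓝[≠] (0 : ℝ), t⁻¹ • ((f ∘ F) (x + t • v) - (f ∘ F) x) ∈ U
  filter_upwards [self_mem_nhdsWithin, h1.eventually (isOpen_interior.mem_nhds hx),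
    (hFc.tendsto.comp h1).eventually hB, hFd.eventually hN] with t ht h2 h3 h4
  exact hKU (hBN t ht _ ⟨h3, hF (interior_subset h2)⟩ _
    ⟨mem_of_mem_nhds hB, hF (interior_subset hx)⟩ h4)

theorem BastianiC.comp {k : ℕ} {s : Set E} (hs : GoodSet s) {f : E → G} (hf : BastianiC k s f)
    {F : E' → E} {s' : Set E'} (hs' : GoodSet s') (hF : ContDiffOn ℝ ∞ F s')
    (hm : MapsTo F s' s) : BastianiC k s' (f ∘ F) := by
  induction k generalizing E E' with
  | zero => exact ContinuousOn.comp hf hF.continuousOn hm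
  | succ k ih =>
    obtain ⟨hc, df, hd, hk⟩ := hf
    refine ⟨hc.comp hF.continuousOn hm,
      df ∘ (fun p : E' × E' => (F p.1, fderivWithin ℝ F s' p.1 p.2)), fun x hx v => ?_,
      ih hs.prod hk hs'.prod ?_ ?_⟩
    · have hnx : s' ∈ 𝓝 x := mem_interior_iff_mem_nhds.1 hx
      have hFd : DifferentiableAt ℝ F x :=
        (hF.differentiableOn (by simp)).differentiableAt hnx
      refine HasDirDeriv.comp hs hc hd hk.continuousOn hm hx ?_ hFd.continuousAt
      rw [fderivWithin_of_mem_nhds hnx]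
      have := hFd.hasFDerivAt.hasLineDerivAt v
      rw [HasLineDerivAt, hasDerivAt_iff_tendsto_slope_zero] at this
      simpa [HasDirDeriv] using this
    · refine ContDiffOn.prodMk ?_ ?_
      · exact hF.comp contDiffOn_fst fun p hp => hp.1
      · exact contDiffOn_fderivWithin_apply hF hs'.uniqueDiffOn (by simp)
    · exact fun p hp => ⟨hm hp.1, mem_univ _⟩

theorem BastianiC.smul {k : ℕ} {s : Set E} (hs : GoodSet s) {f : E → G} (hf : BastianiC k s f)
    {g : E → ℝ} (hg : ContDiffOn ℝ ∞ g s) : BastianiC k s (fun x => g x • f x) := by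
  induction k generalizing E with
  | zero => exact ContinuousOn.smul hg.continuousOn hf
  | succ k ih =>
    have hlow := hf.of_succ
    obtain ⟨hc, df, hd, hk⟩ := hf
    refine ⟨hg.continuousOn.smul hc, (fun p : E × E => fderivWithin ℝ g s p.1 p.2 • f p.1) +
      fun p => g p.1 • df p, fun x hx v => ?_, BastianiC.add (ih hs.prod ?_ ?_) (ih hs.prod hk ?_)⟩
    · have hnx : s ∈ 𝓝 x := mem_interior_iff_mem_nhds.1 hx
      have hgd : DifferentiableAt ℝ g x :=
        (hg.differentiableOn (by simp)).differentiableAt hnx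
      have h1 : HasDirDeriv g x v (fderivWithin ℝ g s x v) := by
        rw [fderivWithin_of_mem_nhds hnx]
        have := hgd.hasFDerivAt.hasLineDerivAt v
        rw [HasLineDerivAt, hasDerivAt_iff_tendsto_slope_zero] at this
        simpa [HasDirDeriv] using this
      have h2 : Tendsto (fun t : ℝ => g (x + t • v)) (𝓝[≠] 0) (𝓝 (g x)) := by
        have : Tendsto (fun t : ℝ => x + t • v) (𝓝[≠] 0) (𝓝 x) := by
          have : Continuous (fun t : ℝ => x + t • v) := by fun_prop
          have := this.tendsto 0
          simp only [zero_smul, add_zero] at this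
          exact this.mono_left nhdsWithin_le_nhds
        exact hgd.continuousAt.tendsto.comp this
      refine ((Tendsto.smul h1 (tendsto_const_nhds (x := f x))).add (h2.smul (hd x hx v))).congr
        fun t => ?_
      rw [smul_comm (g (x + t • v)), smul_assoc, ← smul_add, sub_smul, smul_sub]
      congr 1
      abel
    · exact BastianiC.comp hs hlow hs.prod contDiffOn_fst fun p hp => hp.1
    · exact contDiffOn_fderivWithin_apply hg hs.uniqueDiffOn (by simp)
    · exact hg.comp contDiffOn_fst fun p hp => hp.1

theorem dir_smul {s : Set E} (hs : GoodSet s) {f : E → G} {df : E × E → G}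
    (hd : ∀ x ∈ interior s, ∀ v, HasDirDeriv f x v (df (x, v)))
    (hc : ContinuousOn df (s ×ˢ (univ : Set E))) {x : E} (hx : x ∈ s) (c : ℝ) (v : E) :
    df (x, c • v) = c • df (x, v) := by
  have hc' : ∀ v, ContinuousOn (fun y => df (y, v)) s := fun v =>
    hc.comp (by fun_prop) fun y hy => ⟨hy, mem_univ _⟩
  have : EqOn (fun y => df (y, c • v)) (fun y => c • df (y, v)) (interior s) := fun y hy =>
    tendsto_nhds_unique (hd y hy (c • v)) ((hd y hy v).smul_dir c)
  exact this.of_subset_closure (hc' _) ((hc' v).const_smul c) interior_subset hs.subset_closure hx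

theorem dir_add {s : Set E} (hs : GoodSet s) {f : E → G} {df : E × E → G}
    (hf : ContinuousOn f s) (hd : ∀ x ∈ interior s, ∀ v, HasDirDeriv f x v (df (x, v)))
    (hc : ContinuousOn df (s ×ˢ (univ : Set E))) {x : E} (hx : x ∈ s) (v w : E) :
    df (x, v + w) = df (x, v) + df (x, w) := by
  have hc' : ∀ v, ContinuousOn (fun y => df (y, v)) s := fun v =>
    hc.comp (by fun_prop) fun y hy => ⟨hy, mem_univ _⟩
  have : EqOn (fun y => df (y, v + w)) (fun y => df (y, v) + df (y, w)) (interior s) := by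
    intro x hx
    refine tendsto_nhds_unique (hd x hx (v + w)) ?_
    have h1 : Tendsto (fun t : ℝ => t⁻¹ • (f (x + t • (v + w)) - f (x + t • v))) (𝓝[≠] 0)
        (𝓝 (df (x, w))) := by
      intro U hU
      obtain ⟨U', hU', hU'c, hUU⟩ := exists_mem_nhds_isClosed_subset hU
      obtain ⟨V, ⟨hV, hVc⟩, hVU⟩ :=
        (LocallyConvexSpace.convex_basis (𝕜 := ℝ) (df (x, w))).mem_iff.1 hU'
      obtain ⟨B, hB, N, hN, hBN⟩ := strict_mem hs hf hd hc (interior_subset hx) hVc.closure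
        isClosed_closure (mem_of_superset hV subset_closure)
      have h2 : ∀ v : E, Tendsto (fun t : ℝ => x + t • v) (𝓝[≠] 0) (𝓝 x) := by
        intro v
        have : Continuous (fun t : ℝ => x + t • v) := by fun_prop
        have := this.tendsto 0
        simp only [zero_smul, add_zero] at this
        exact this.mono_left nhdsWithin_le_nhds
      change ∀ᶠ t in 𝓝[≠] (0 : ℝ), t⁻¹ • (f (x + t • (v + w)) - f (x + t • v)) ∈ U
      have h3 := inter_mem hB (mem_interior_iff_mem_nhds.1 hx)
      filter_upwards [self_mem_nhdsWithin, (h2 (v + w)).eventually h3, (h2 v).eventually h3]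
        with t ht h4 h5
      have ht : t ≠ 0 := ht
      refine hUU (closure_minimal hVU hU'c (hBN t ht _ h4 _ h5 ?_))
      have : t⁻¹ • (x + t • (v + w) - (x + t • v)) = w := by
        rw [add_sub_add_left_eq_sub, ← smul_sub, add_sub_cancel_left, inv_smul_smul₀ ht]
      rw [this]
      exact mem_of_mem_nhds hN
    refine (Tendsto.add (hd x hx v) h1).congr fun t => ?_
    rw [← smul_add]
    congr 1
    abel
  exact this.of_subset_closure (hc' _) ((hc' v).add (hc' w)) interior_subset hs.subset_closure hx

open Classical in
theorem BastianiC.contDiffOn [FiniteDimensional ℝ E] {k : ℕ} {s : Set E} (hs : GoodSet s)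
    {f : E → ℝ} (hf : BastianiC k s f) : ContDiffOn ℝ k f s := by
  induction k generalizing E with
  | zero => exact contDiffOn_zero.2 hf
  | succ k ih =>
    obtain ⟨hc, df, hd, hk⟩ := hf
    have hcd := hk.continuousOn
    let L : E → E →L[ℝ] ℝ := fun x => if hx : x ∈ s then LinearMap.toContinuousLinearMap
      { toFun := fun v => df (x, v)
        map_add' := dir_add hs hc hd hcd hx
        map_smul' := dir_smul hs hd hcd hx } else 0
    have hL : ∀ x ∈ s, ∀ v, L x v = df (x, v) := fun x hx v => by simp [L, hx]
    have hder : ∀ x ∈ s, HasFDerivWithinAt f (L x) s x := by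
      intro x hx
      rw [hasFDerivWithinAt_iff_isLittleO, Asymptotics.isLittleO_iff]
      intro ε hε
      have hcx : Continuous fun v => df (x, v) := by
        have : (fun v => df (x, v)) = fun v => L x v := funext fun v => (hL x hx v).symm
        rw [this]; exact (L x).continuous
      have key : ∀ u ∈ Metric.sphere (0 : E) 1, ∃ N ∈ 𝓝 u, ∀ᶠ y in 𝓝[s] x, ∀ t : ℝ, t ≠ 0 →
          t⁻¹ • (y - x) ∈ N → |t⁻¹ • (f y - f x) - df (x, t⁻¹ • (y - x))| ≤ ε := by
        intro u _
        obtain ⟨B, hB, N, hN, hBN⟩ := strict_mem hs hc hd hcd hx (w := u)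
          (convex_closedBall (df (x, u)) (ε / 2)) Metric.isClosed_closedBall
          (Metric.closedBall_mem_nhds _ (half_pos hε))
        refine ⟨N ∩ (fun v => df (x, v)) ⁻¹' Metric.ball (df (x, u)) (ε / 2),
          inter_mem hN (hcx.continuousAt (Metric.ball_mem_nhds _ (half_pos hε))), ?_⟩
        filter_upwards [self_mem_nhdsWithin, mem_nhdsWithin_of_mem_nhds hB] with y hy hyB t ht hyN
        have h1 := hBN t ht y ⟨hyB, hy⟩ x ⟨mem_of_mem_nhds hB, hx⟩ hyN.1
        have h2 := hyN.2
        rw [Metric.mem_closedBall, Real.dist_eq] at h1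
        rw [mem_preimage, Metric.mem_ball, Real.dist_eq] at h2
        rw [abs_le] at *
        rw [abs_lt] at h2
        constructor <;> linarith [h1.1, h1.2, h2.1, h2.2]
      choose! N hN hev using key
      obtain ⟨T, hTs, hT⟩ := (isCompact_sphere (0 : E) 1).elim_nhds_subcover N hN
      have hall := (Filter.eventually_all_finset T).2 fun u hu => hev u (hTs u hu)
      filter_upwards [hall, self_mem_nhdsWithin] with y hy hys
      rcases eq_or_ne y x with rfl | hyx
      · simp
      have hn : ‖y - x‖ ≠ 0 := norm_ne_zero_iff.2 (sub_ne_zero.2 hyx)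
      have hsph : ‖y - x‖⁻¹ • (y - x) ∈ Metric.sphere (0 : E) 1 := by
        simp [norm_smul, hn]
      obtain ⟨u, hu, huN⟩ := mem_iUnion₂.1 (hT hsph)
      have h3 := hy u hu _ hn huN
      rw [← hL x hx, map_smul, smul_eq_mul, smul_eq_mul, ← mul_sub, abs_mul, abs_inv, abs_norm,
        inv_mul_le_iff₀ (lt_of_le_of_ne (norm_nonneg _) hn.symm)] at h3
      rw [Real.norm_eq_abs, mul_comm]
      exact h3
    rw [show ((k + 1 : ℕ) : WithTop ℕ∞) = (k : WithTop ℕ∞) + 1 by norm_cast,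
      contDiffOn_succ_iff_fderivWithin hs.uniqueDiffOn]
    refine ⟨fun x hx => (hder x hx).differentiableWithinAt, by simp, ?_⟩
    rw [contDiffOn_clm_apply]
    intro v
    have h4 := ih hs.prod hk
    have h5 : ContDiffOn ℝ k (fun x => df (x, v)) s :=
      h4.comp (contDiffOn_id.prodMk contDiffOn_const) fun x hx => ⟨hx, mem_univ _⟩
    refine h5.congr fun x hx => ?_
    rw [(hder x hx).fderivWithin (hs.uniqueDiffOn x hx), hL x hx]

/-- Smooth maps in the sense of Bastiani. -/
def BastianiSmooth (s : Set E) (f : E → G) : Prop :=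
  ∀ k, BastianiC k s f

theorem BastianiSmooth.exists_dir {s : Set E} (hs : GoodSet s) {f : E → G}
    (hf : BastianiSmooth s f) : ∃ df : E × E → G,
      (∀ x ∈ interior s, ∀ v, HasDirDeriv f x v (df (x, v))) ∧
      BastianiSmooth (s ×ˢ (univ : Set E)) df := by
  obtain ⟨hc, df, hd, hk⟩ := hf 1
  refine ⟨df, hd, fun k => ?_⟩
  obtain ⟨hc', df', hd', hk'⟩ := hf (k + 1)
  exact hk'.mono subset_rfl (dir_unique hs hd' hd hk'.continuousOn hk)

end Bastiani

theorem BastianiC.clm {G G' : Type*} [AddCommGroup G] [Module ℝ G] [TopologicalSpace G]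
    [AddCommGroup G'] [Module ℝ G'] [TopologicalSpace G']
    {E : Type u} [NormedAddCommGroup E] [NormedSpace ℝ E] (χ : G →L[ℝ] G') {k : ℕ} {s : Set E}
    {f : E → G} (hf : BastianiC k s f) : BastianiC k s (fun x => χ (f x)) := by
  induction k generalizing E with
  | zero => exact χ.continuous.comp_continuousOn hf
  | succ k ih =>
    obtain ⟨hc, df, hd, hk⟩ := hf
    refine ⟨χ.continuous.comp_continuousOn hc, fun p => χ (df p), fun x hx v => ?_, ih hk⟩
    refine ((χ.continuous.tendsto _).comp (hd x hx v)).congr fun t => ?_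
    simp

section Functions
set_option linter.unusedSectionVars false
set_option linter.unusedVariables false

variable {E : Type u} [NormedAddCommGroup E] [NormedSpace ℝ E] {H : Type*} [TopologicalSpace H]
  (I : ModelWithCorners ℝ E H) (X : Type*) [TopologicalSpace X] [ChartedSpace H X]
  {E' : Type u} [NormedAddCommGroup E'] [NormedSpace ℝ E'] {H' : Type*} [TopologicalSpace H']
  (J : ModelWithCorners ℝ E' H') (Y : Type*) [TopologicalSpace Y] [ChartedSpace H' Y]
  (G : Type*) [AddCommGroup G] [Module ℝ G] [TopologicalSpace G] [T2Space G]
  [IsTopologicalAddGroup G] [ContinuousSMul ℝ G] [LocallyConvexSpace ℝ G]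
  (G' : Type*) [AddCommGroup G'] [Module ℝ G'] [TopologicalSpace G'] [T2Space G']
  [IsTopologicalAddGroup G'] [ContinuousSMul ℝ G'] [LocallyConvexSpace ℝ G']

variable {X} in
theorem goodSet_target (e : OpenPartialHomeomorph X H) : GoodSet (e.extend I).target :=
  ⟨I.symm ⁻¹' e.target, range I, e.open_target.preimage I.continuous_symm, I.convex_range,
    I.nonempty_interior, e.extend_target⟩

/-- The smooth maps on the manifold `X` with values in the locally convex space `G`: the maps whose
representative in every chart of the maximal smooth atlas is smooth in the sense of Bastiani. -/
def SmoothFun : Submodule ℝ (X → G) where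
  carrier := {f | ∀ e ∈ IsManifold.maximalAtlas I ∞ X,
    BastianiSmooth (e.extend I).target (f ∘ (e.extend I).symm)}
  add_mem' hf hg e he k := (hf e he k).add (hg e he k)
  zero_mem' _ _ _ := BastianiC.const 0
  smul_mem' c f hf e he k := (hf e he k).smul (goodSet_target I e) (contDiffOn_const (c := c))

variable {I X J Y G G'}

theorem contDiffOn_chart {g : X → ℝ} (hg : ContMDiff I 𝓘(ℝ, ℝ) ∞ g)
    {e : OpenPartialHomeomorph X H} (he : e ∈ IsManifold.maximalAtlas I ∞ X) :
    ContDiffOn ℝ ∞ (g ∘ (e.extend I).symm) (e.extend I).target := by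
  rw [← contMDiffOn_iff_contDiffOn, e.extend_target']
  exact hg.comp_contMDiffOn (contMDiffOn_extend_symm he)

namespace SmoothFun

instance : CoeFun (SmoothFun I X G) (fun _ => X → G) := ⟨Subtype.val⟩

instance : SMul C^∞⟮I, X; ℝ⟯ (SmoothFun I X G) where
  smul a f := ⟨fun x => a x • f x, fun e he k =>
    (f.2 e he k).smul (goodSet_target I e) (contDiffOn_chart a.contMDiff he)⟩

theorem smul_apply (a : C^∞⟮I, X; ℝ⟯) (f : SmoothFun I X G) (x : X) : (a • f) x = a x • f x := rfl

instance : Module C^∞⟮I, X; ℝ⟯ (SmoothFun I X G) where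
  one_smul f := Subtype.ext <| funext fun x => one_smul ℝ (f x)
  mul_smul a b f := Subtype.ext <| funext fun x => mul_smul (a x) (b x) (f x)
  smul_zero a := Subtype.ext <| funext fun x => smul_zero (a x)
  smul_add a f g := Subtype.ext <| funext fun x => smul_add (a x) (f x) (g x)
  add_smul a b f := Subtype.ext <| funext fun x => add_smul (a x) (b x) (f x)
  zero_smul f := Subtype.ext <| funext fun x => zero_smul ℝ (f x)

instance : IsScalarTower ℝ C^∞⟮I, X; ℝ⟯ (SmoothFun I X G) where
  smul_assoc c a f := Subtype.ext <| funext fun x => smul_assoc c (a x) (f x)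

instance : SMulCommClass C^∞⟮I, X; ℝ⟯ ℝ (SmoothFun I X G) where
  smul_comm a c f := Subtype.ext <| funext fun x => smul_comm (a x) c (f x)

variable (I X) in
/-- Constant maps. -/
def const (c : G) : SmoothFun I X G := ⟨fun _ => c, fun _ _ _ => BastianiC.const c⟩

/-- Composition with a continuous linear map `χ : G → G'`. -/
def push (χ : G →L[ℝ] G') : SmoothFun I X G →ₗ[C^∞⟮I, X; ℝ⟯] SmoothFun I X G' where
  toFun f := ⟨fun x => χ (f x), fun e he k => (f.2 e he k).clm χ⟩
  map_add' f g := Subtype.ext <| funext fun x => map_add χ (f x) (g x)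
  map_smul' a f := Subtype.ext <| funext fun x => map_smul χ (a x) (f x)

theorem pull_mem [IsManifold J ∞ Y] (F : C^∞⟮I, X; J, Y⟯) (f : SmoothFun J Y G) :
    (fun x => f (F x)) ∈ SmoothFun I X G := by
  intro e he k
  refine BastianiC.of_local (goodSet_target I e) fun x hx => ?_
  set y := F ((e.extend I).symm x)
  let e' := chartAt H' y
  have he' : e' ∈ IsManifold.maximalAtlas J ∞ Y := IsManifold.chart_mem_maximalAtlas y
  have hcs : ContMDiffOn 𝓘(ℝ, E) J ∞ (F ∘ (e.extend I).symm) (e.extend I).target := by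
    rw [e.extend_target']
    exact F.contMDiff.comp_contMDiffOn (contMDiffOn_extend_symm he)
  obtain ⟨u, hu, hus⟩ := (continuousOn_iff'.1 hcs.continuousOn) e'.source e'.open_source
  have hmaps : ∀ z ∈ (e.extend I).target ∩ u, F ((e.extend I).symm z) ∈ e'.source := by
    rintro z ⟨hz, hzu⟩
    have : z ∈ (F ∘ (e.extend I).symm) ⁻¹' e'.source ∩ (e.extend I).target :=
      hus.symm ▸ ⟨hzu, hz⟩
    exact this.1
  have hxu : x ∈ u := by
    have : x ∈ (F ∘ (e.extend I).symm) ⁻¹' e'.source ∩ (e.extend I).target :=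
      ⟨mem_chart_source H' y, hx⟩
    rw [hus] at this
    exact this.1
  refine ⟨u, hu, hxu, ?_⟩
  have hcd : ContDiffOn ℝ ∞ (e'.extend J ∘ (F ∘ (e.extend I).symm)) ((e.extend I).target ∩ u) := by
    rw [← contMDiffOn_iff_contDiffOn]
    exact (OpenPartialHomeomorph.contMDiffOn_extend he').comp (hcs.mono inter_subset_left) hmaps
  have := BastianiC.comp (goodSet_target J e') (f.2 e' he' k) ((goodSet_target I e).inter hu) hcd
    (fun z hz => (e'.extend J).map_source (by rw [e'.extend_source]; exact hmaps z hz))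
  refine this.mono subset_rfl fun z hz => ?_
  simp only [Function.comp_apply]
  rw [e'.extend_left_inv (hmaps z hz)]

/-- Composition with a smooth map of manifolds, `f ↦ f ∘ F`. -/
def pull [IsManifold J ∞ Y] (F : C^∞⟮I, X; J, Y⟯) : SmoothFun J Y G →ₗ[ℝ] SmoothFun I X G where
  toFun f := ⟨fun x => f (F x), pull_mem F f⟩
  map_add' _ _ := rfl
  map_smul' _ _ := rfl

theorem toReal_contMDiff [FiniteDimensional ℝ E] [IsManifold I ∞ X] (f : SmoothFun I X ℝ) :
    ContMDiff I 𝓘(ℝ, ℝ) ∞ f := by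
  intro x
  have he := IsManifold.chart_mem_maximalAtlas (I := I) (n := ∞) x
  have h1 : ContDiffOn ℝ ∞ ((f : X → ℝ) ∘ ((chartAt H x).extend I).symm)
      ((chartAt H x).extend I).target :=
    contDiffOn_infty.2 fun k => BastianiC.contDiffOn (goodSet_target I _) (f.2 _ he k)
  have h2 : ContMDiffOn I 𝓘(ℝ, ℝ) ∞ f (chartAt H x).source := by
    have h3 := (contMDiffOn_iff_contDiffOn.2 h1).comp (OpenPartialHomeomorph.contMDiffOn_extend he)
      (fun z hz => ((chartAt H x).extend I).map_source (by rwa [(chartAt H x).extend_source]))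
    refine h3.congr fun z hz => ?_
    simp only [Function.comp_apply]
    rw [(chartAt H x).extend_left_inv hz]
  exact h2.contMDiffAt ((chartAt H x).open_source.mem_nhds (mem_chart_source H x))

/-- A real-valued map which is smooth in the sense of Bastiani is smooth in the usual sense. -/
def toReal [FiniteDimensional ℝ E] [IsManifold I ∞ X] :
    SmoothFun I X ℝ →ₗ[C^∞⟮I, X; ℝ⟯] C^∞⟮I, X; ℝ⟯ where
  toFun f := ⟨f, toReal_contMDiff f⟩
  map_add' _ _ := rfl
  map_smul' _ _ := rfl

end SmoothFun

variable (I X) in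
/-- A chart of `X` (in the maximal smooth atlas) whose domain is all of `X`. A chart of a manifold
with domain `V` is a global chart of the manifold `V`. -/
structure GlobalChart where
  chart : OpenPartialHomeomorph X H
  mem : chart ∈ IsManifold.maximalAtlas I ∞ X
  source_eq : chart.source = univ

namespace GlobalChart

variable (c : GlobalChart I X)

theorem good : GoodSet (c.chart.extend I).target := goodSet_target I c.chart

theorem map_mem (x : X) : c.chart.extend I x ∈ (c.chart.extend I).target :=
  (c.chart.extend I).map_source (by rw [c.chart.extend_source, c.source_eq]; exact mem_univ x)

/-- The derivative `(x, v) ↦ df(x; v)` of the coordinate representative of `f`. -/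
def dirDeriv (f : SmoothFun I X G) : E × E → G :=
  (BastianiSmooth.exists_dir c.good (f.2 c.chart c.mem)).choose

theorem dirDeriv_spec (f : SmoothFun I X G) :
    (∀ x ∈ interior (c.chart.extend I).target, ∀ v,
      HasDirDeriv (f ∘ (c.chart.extend I).symm) x v (c.dirDeriv f (x, v))) ∧
    BastianiSmooth ((c.chart.extend I).target ×ˢ (univ : Set E)) (c.dirDeriv f) :=
  (BastianiSmooth.exists_dir c.good (f.2 c.chart c.mem)).choose_spec

theorem partial_mem (v : E) (f : SmoothFun I X G) :
    (fun x => c.dirDeriv f (c.chart.extend I x, v)) ∈ SmoothFun I X G := by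
  intro e he k
  have hcd : ContDiffOn ℝ ∞ (c.chart.extend I ∘ (e.extend I).symm) (e.extend I).target := by
    rw [← contMDiffOn_iff_contDiffOn]
    refine (OpenPartialHomeomorph.contMDiffOn_extend c.mem).comp (t := c.chart.source) ?_ fun z _ => ?_
    · rw [e.extend_target']
      exact contMDiffOn_extend_symm he
    · rw [c.source_eq]; exact mem_univ _
  exact BastianiC.comp c.good.prod ((c.dirDeriv_spec f).2 k) (goodSet_target I e)
    (hcd.prodMk contDiffOn_const) fun z _ => ⟨c.map_mem _, mem_univ _⟩

/-- The derivative of `f` in the direction `v` in the coordinates given by the chart. -/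
def partialDeriv (v : E) (f : SmoothFun I X G) : SmoothFun I X G :=
  ⟨fun x => c.dirDeriv f (c.chart.extend I x, v), c.partial_mem v f⟩

end GlobalChart

end Functions

section Forms

set_option linter.unusedSectionVars false
set_option linter.unusedVariables false

variable {E : Type u} [NormedAddCommGroup E] [NormedSpace ℝ E] {H : Type*} [TopologicalSpace H]
  (I : ModelWithCorners ℝ E H) (X : Type*) [TopologicalSpace X] [ChartedSpace H X]
  [IsManifold I ∞ X]
  {E' : Type u} [NormedAddCommGroup E'] [NormedSpace ℝ E'] {H' : Type*} [TopologicalSpace H']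
  (J : ModelWithCorners ℝ E' H') (Y : Type*) [TopologicalSpace Y] [ChartedSpace H' Y]
  [IsManifold J ∞ Y]

/-- The smooth vector fields on `X`. -/
abbrev VField := Cₛ^∞⟮I; E, fun x : X => TangentSpace I x⟯

variable {I X J Y}

namespace VField

instance : SMul C^∞⟮I, X; ℝ⟯ (VField I X) where
  smul a V := ⟨fun x => a x • V x, a.contMDiff.smul_section V.contMDiff⟩

theorem smul_apply (a : C^∞⟮I, X; ℝ⟯) (V : VField I X) (x : X) : (a • V) x = a x • V x := rfl

instance : Module C^∞⟮I, X; ℝ⟯ (VField I X) where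
  one_smul V := ContMDiffSection.ext fun x => one_smul ℝ (V x)
  mul_smul a b V := ContMDiffSection.ext fun x => mul_smul (a x) (b x) (V x)
  smul_zero a := ContMDiffSection.ext fun x => smul_zero (a x)
  smul_add a V W := ContMDiffSection.ext fun x => smul_add (a x) (V x) (W x)
  add_smul a b V := ContMDiffSection.ext fun x => add_smul (a x) (b x) (V x)
  zero_smul V := ContMDiffSection.ext fun x => zero_smul ℝ (V x)

instance : IsScalarTower ℝ C^∞⟮I, X; ℝ⟯ (VField I X) where
  smul_assoc c a V := ContMDiffSection.ext fun x => smul_assoc c (a x) (V x)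

end VField

/-- The differential of a real function `g`, as the map `V ↦ V(g)` on vector fields. -/
def diff (g : C^∞⟮I, X; ℝ⟯) : VField I X →ₗ[C^∞⟮I, X; ℝ⟯] C^∞⟮I, X; ℝ⟯ where
  toFun V := ⟨fun x => mfderiv I 𝓘(ℝ, ℝ) g x (V x), by
    have h1 : ContMDiff I.tangent 𝓘(ℝ, ℝ).tangent ∞ (tangentMap I 𝓘(ℝ, ℝ) g) :=
      g.contMDiff.contMDiff_tangentMap (by simp)
    exact (contMDiff_snd_tangentBundle_modelSpace ℝ 𝓘(ℝ, ℝ)).comp (h1.comp V.contMDiff)⟩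
  map_add' V W := by
    ext x
    exact map_add (mfderiv I 𝓘(ℝ, ℝ) g x) (V x) (W x)
  map_smul' a V := by
    ext x
    exact map_smul (mfderiv I 𝓘(ℝ, ℝ) g x) (a x) (V x)

variable (I X) in
/-- Smooth scalar `k`-forms: alternating `C^∞(X)`-multilinear maps from vector fields to `C^∞(X)`. -/
abbrev Form (k : ℕ) := (VField I X) [⋀^Fin k]→ₗ[C^∞⟮I, X; ℝ⟯] C^∞⟮I, X; ℝ⟯

/-- Wedge product of scalar forms, `(α ∧ β)(V₁, …)` being the sum over the `(k, l)`-shuffles `σ` of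
`sign σ • α(V_σ(1), …, V_σ(k)) * β(V_σ(k+1), …)`. -/
def Form.wedge (k l : ℕ) : Form I X k →ₗ[C^∞⟮I, X; ℝ⟯] Form I X l →ₗ[C^∞⟮I, X; ℝ⟯] Form I X (k + l) :=
  TensorProduct.curry
    ((AlternatingMap.domDomCongrₗ C^∞⟮I, X; ℝ⟯ finSumFinEquiv).toLinearMap ∘ₗ
      (LinearMap.compAlternatingMapₗ (S := C^∞⟮I, X; ℝ⟯) (LinearMap.mul' C^∞⟮I, X; ℝ⟯ C^∞⟮I, X; ℝ⟯)) ∘ₗ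
      AlternatingMap.domCoprod')


section Extension

variable [FiniteDimensional ℝ E'] [T2Space Y]

variable (J) in
/-- A bump function at `q`, with support in the domain of the preferred chart at `q`. -/
def bumpF (q : Y) : SmoothBumpFunction J q := Classical.arbitrary _

variable (J) in
/-- The bump function as a smooth function. -/
def bump (q : Y) : C^∞⟮J, Y; ℝ⟯ :=
  ⟨(bumpF J q), (bumpF J q).contMDiff⟩

theorem bump_self (q : Y) : bump J q q = 1 := (bumpF J q).eq_one

theorem bump_near (q : Y) : ∀ᶠ y in 𝓝 q, bump J q y = 1 :=
  (bumpF J q).eventuallyEq_one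

theorem bump_zero (q : Y) {y : Y} (hy : y ∉ (chartAt H' q).source) : bump J q y = 0 :=
  image_eq_zero_of_notMem_tsupport fun h =>
    hy ((bumpF J q).tsupport_subset_chartAt_source h)

variable (J) in
/-- The preferred trivialization of the tangent bundle at `q`. -/
abbrev triv (q : Y) := trivializationAt E' (TangentSpace J : Y → Type _) q

theorem triv_base (q : Y) : (triv J q).baseSet = (chartAt H' q).source := rfl

variable (J) in
/-- The vector field which is constant equal to `w` in the trivialization at `q`, cut off. -/
def frameField (q : Y) (w : E') : VField J Y where
  toFun := fun y => bump J q y • (triv J q).symm y w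
  contMDiff_toFun := by
    have h : ContMDiffOn J (J.prod 𝓘(ℝ, E')) ∞
        (fun y => Bundle.TotalSpace.mk' E' y ((triv J q).symm y w)) (triv J q).baseSet := by
      rw [(triv J q).contMDiffOn_section_baseSet_iff]
      refine (contMDiffOn_const (c := w)).congr fun y hy => ?_
      rw [Bundle.Trivialization.apply_mk_symm _ hy]
    exact ContMDiffOn.smul_section_of_tsupport (bump J q).contMDiff.contMDiffOn
      (triv J q).open_baseSet
      ((bumpF J q).tsupport_subset_chartAt_source) h

theorem frameField_apply (q : Y) (w : E') (y : Y) :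
    frameField J q w y = bump J q y • (triv J q).symm y w := rfl

variable (J) in
/-- The component along `ℓ` of a vector field in the trivialization at `q`, cut off. -/
def coordFun (q : Y) (ℓ : E' →L[ℝ] ℝ) (Z : VField J Y) : C^∞⟮J, Y; ℝ⟯ :=
  ⟨fun y => bump J q y • ℓ (triv J q ⟨y, Z y⟩).2, by
    refine contMDiff_of_tsupport fun y hy => ?_
    have hy' : y ∈ (triv J q).baseSet :=
      (bumpF J q).tsupport_subset_chartAt_source
        (closure_mono (fun z hz => left_ne_zero_of_smul hz) hy)
    have h := ((triv J q).contMDiffAt_section_iff hy').1 (Z.contMDiff y)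
    exact (bump J q).contMDiff.contMDiffAt.smul (ℓ.contMDiff.contMDiffAt.comp y h)⟩

theorem frame_expand (q : Y) (Z : VField J Y) :
    (bump J q * bump J q) • Z = ∑ j, coordFun J q
      ((Module.finBasis ℝ E').coord j).toContinuousLinearMap Z •
        frameField J q (Module.finBasis ℝ E' j) := by
  refine ContMDiffSection.ext fun y => ?_
  have hs : ∀ (s : Finset (Fin (Module.finrank ℝ E'))) (W : Fin (Module.finrank ℝ E') → VField J Y),
      (∑ j ∈ s, W j) y = ∑ j ∈ s, W j y := fun s W =>
    map_sum (⟨⟨fun V : VField J Y => V y, rfl⟩, fun _ _ => rfl⟩ : VField J Y →+ TangentSpace J y) W s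
  rw [hs]
  simp only [VField.smul_apply, frameField_apply]
  by_cases hy : y ∈ (triv J q).baseSet
  · set b := Module.finBasis ℝ E'
    have h1 : (triv J q).symm y (triv J q ⟨y, Z y⟩).2 = Z y :=
      (triv J q).symm_apply_apply_mk hy (Z y)
    have h2 : ∀ j, (coordFun J q (b.coord j).toContinuousLinearMap Z) y =
      bump J q y • b.repr (triv J q ⟨y, Z y⟩).2 j := fun j => rfl
    simp only [h2]
    have h4 : ∀ w, (triv J q).symm y w = (triv J q).symmₗ ℝ y w := fun w => by
      rw [Bundle.Trivialization.coe_symmₗ _ hy]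
    have h3 : (triv J q).symmₗ ℝ y (triv J q ⟨y, Z y⟩).2 = Z y := by rw [← h4]; exact h1
    simp only [h4]
    conv_lhs => rw [← h3, ← b.sum_repr (triv J q ⟨y, Z y⟩).2]
    rw [map_sum, Finset.smul_sum]
    refine Finset.sum_congr rfl fun j _ => ?_
    rw [map_smul, smul_smul, smul_smul]
    congr 1
    change bump J q y * bump J q y * _ = bump J q y * _ * bump J q y
    ring
  · have h0 : bump J q y = 0 := bump_zero q hy
    simp [h0]

theorem triv_zero {q y : Y} (hy : y ∈ (triv J q).baseSet) :
    (triv J q ⟨y, (0 : TangentSpace J y)⟩).2 = 0 := by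
  have := (triv J q).coe_linearMapAt_of_mem (R := ℝ) hy
  rw [← congrFun this (0 : TangentSpace J y)]
  exact map_zero _

theorem mem_triv (q : Y) : q ∈ (triv J q).baseSet := mem_chart_source H' q

theorem sum_fun_apply {ι : Type*} (s : Finset ι) (g : ι → C^∞⟮J, Y; ℝ⟯) (y : Y) :
    (∑ j ∈ s, g j) y = ∑ j ∈ s, g j y :=
  map_sum (⟨⟨fun V : C^∞⟮J, Y; ℝ⟯ => V y, rfl⟩, fun _ _ => rfl⟩ : C^∞⟮J, Y; ℝ⟯ →+ ℝ) g s

theorem Form.vanish {k : ℕ} (α : Form J Y k) (W : Fin k → VField J Y) (i : Fin k)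
    (Z : VField J Y) {q : Y} (hZ : Z q = 0) : α (Function.update W i Z) q = 0 := by
  have h1 : α (Function.update W i ((bump J q * bump J q) • Z)) q
      = α (Function.update W i Z) q := by
    rw [α.map_update_smul]
    change (bump J q q * bump J q q) * _ = _
    rw [bump_self, one_mul, one_mul]
  rw [← h1, frame_expand, α.map_update_sum, sum_fun_apply]
  refine Finset.sum_eq_zero fun j _ => ?_
  rw [α.map_update_smul]
  have h2 : coordFun J q ((Module.finBasis ℝ E').coord j).toContinuousLinearMap Z q = 0 := by
    change bump J q q • ((Module.finBasis ℝ E').coord j).toContinuousLinearMap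
      (triv J q ⟨q, Z q⟩).2 = 0
    rw [hZ, triv_zero (mem_triv q), map_zero, smul_zero]
  change coordFun J q ((Module.finBasis ℝ E').coord j).toContinuousLinearMap Z q * _ = 0
  rw [h2, zero_mul]

theorem Form.pointwise {k : ℕ} (α : Form J Y k) (W W' : Fin k → VField J Y) {q : Y}
    (h : ∀ i, W i q = W' i q) : α W q = α W' q := by
  classical
  have key : ∀ s : Finset (Fin k), α (s.piecewise W W') q = α W' q := by
    intro s
    induction s using Finset.induction with
    | empty => simp
    | insert i s hi ih =>
      rw [← ih, Finset.piecewise_insert]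
      have h3 : s.piecewise W W' = Function.update (s.piecewise W W') i (W' i) := by
        rw [eq_comm, Function.update_eq_self_iff, Finset.piecewise_eq_of_notMem _ _ _ hi]
      have h4 : α (Function.update (s.piecewise W W') i (W i)) -
          α (Function.update (s.piecewise W W') i (W' i)) =
          α (Function.update (s.piecewise W W') i (W i - W' i)) := by
        rw [← α.map_update_sub]
      have h5 := Form.vanish α (s.piecewise W W') i (W i - W' i) (q := q)
        (by change W i q - W' i q = 0; rw [h i, sub_self])
      rw [← h4] at h5
      rw [← h3] at h5
      exact sub_eq_zero.1 h5
  simpa using key Finset.univ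

variable (J) in
/-- A linear extension of tangent vectors at `q` to vector fields. -/
def extendVec (q : Y) : TangentSpace J q →ₗ[ℝ] VField J Y where
  toFun v := frameField J q ((triv J q).linearMapAt ℝ q v)
  map_add' v w := by
    refine ContMDiffSection.ext fun y => ?_
    change bump J q y • (triv J q).symm y _ =
      bump J q y • (triv J q).symm y _ + bump J q y • (triv J q).symm y _
    by_cases hy : y ∈ (triv J q).baseSet
    · simp only [← (triv J q).coe_symmₗ (R := ℝ) hy, map_add, smul_add]
    · simp [bump_zero q hy]
  map_smul' a v := by
    refine ContMDiffSection.ext fun y => ?_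
    change bump J q y • (triv J q).symm y _ = a • bump J q y • (triv J q).symm y _
    by_cases hy : y ∈ (triv J q).baseSet
    · simp only [← (triv J q).coe_symmₗ (R := ℝ) hy, map_smul, smul_comm a]
    · simp [bump_zero q hy]

theorem extendVec_self (q : Y) (v : TangentSpace J q) : extendVec J q v q = v := by
  change bump J q q • (triv J q).symm q ((triv J q).linearMapAt ℝ q v) = v
  rw [bump_self, one_smul, (triv J q).coe_linearMapAt_of_mem (R := ℝ) (mem_triv q)]
  exact (triv J q).symm_apply_apply_mk (mem_triv q) v

/-- The value of a form at a point, an alternating form on the tangent space: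
`α.atPt q (fun i => W i q) = α W q`. -/
def Form.atPt {k : ℕ} (α : Form J Y k) (q : Y) : (TangentSpace J q) [⋀^Fin k]→ₗ[ℝ] ℝ where
  toMultilinearMap :=
    ((⟨⟨fun g : C^∞⟮J, Y; ℝ⟯ => g q, fun _ _ => rfl⟩, fun _ _ => rfl⟩ :
      C^∞⟮J, Y; ℝ⟯ →ₗ[ℝ] ℝ).compMultilinearMap (α.toMultilinearMap.restrictScalars ℝ)).compLinearMap
      fun _ => extendVec J q
  map_eq_zero_of_eq' v i j hij hne := by
    change α (fun i => extendVec J q (v i)) q = 0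
    rw [α.map_eq_zero_of_eq (fun i => extendVec J q (v i)) (congrArg (extendVec J q) hij) hne]
    rfl

theorem Form.atPt_apply {k : ℕ} (α : Form J Y k) (W : Fin k → VField J Y) (q : Y) :
    α.atPt q (fun i => W i q) = α W q :=
  Form.pointwise α _ _ fun _ => extendVec_self q _

theorem Form.atPt_eq {k : ℕ} (α : Form J Y k) (q : Y) (v : Fin k → TangentSpace J q) :
    α.atPt q v = α (fun i => extendVec J q (v i)) q := rfl

end Extension

end Forms

section Pull

set_option linter.unusedSectionVars false
set_option linter.unusedVariables false

variable {E : Type u} [NormedAddCommGroup E] [NormedSpace ℝ E] {H : Type*} [TopologicalSpace H]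
  {I : ModelWithCorners ℝ E H} {X : Type*} [TopologicalSpace X] [ChartedSpace H X]
  [IsManifold I ∞ X]
  {E' : Type u} [NormedAddCommGroup E'] [NormedSpace ℝ E'] {H' : Type*} [TopologicalSpace H']
  {J : ModelWithCorners ℝ E' H'} {Y : Type*} [TopologicalSpace Y] [ChartedSpace H' Y]
  [IsManifold J ∞ Y] [FiniteDimensional ℝ E'] [T2Space Y]

theorem Form.pull_contMDiff (F : C^∞⟮I, X; J, Y⟯) {k : ℕ} (α : Form J Y k)
    (Z : Fin k → VField I X) :
    ContMDiff I 𝓘(ℝ, ℝ) ∞ fun p => α.atPt (F p) fun i => mfderiv I J F p (Z i p) := by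
  classical
  intro p₀
  set q := F p₀
  set b := Module.finBasis ℝ E'
  let co : Fin k → Fin (Module.finrank ℝ E') → X → ℝ := fun i j p =>
    (b.coord j).toContinuousLinearMap (triv J q (tangentMap I J F ⟨p, Z i p⟩)).2
  have hco : ∀ i j, ContMDiffAt I 𝓘(ℝ, ℝ) ∞ (co i j) p₀ := by
    intro i j
    have h1 : ContMDiff I J.tangent ∞ (fun p => tangentMap I J F ⟨p, Z i p⟩) :=
      (F.contMDiff.contMDiff_tangentMap (by simp)).comp (Z i).contMDiff
    have h2 := (((triv J q).contMDiffAt_iff (IB := J) (n := ∞)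
      ((triv J q).mem_source.2 (mem_triv q))).1 (h1 p₀)).2
    exact (b.coord j).toContinuousLinearMap.contMDiff.contMDiffAt.comp p₀ h2
  have hs : ContMDiffAt I 𝓘(ℝ, ℝ) ∞ (fun p => ∑ r : Fin k → Fin (Module.finrank ℝ E'),
      (∏ i, co i (r i) p) * α (fun i => frameField J q (b (r i))) (F p)) p₀ := by
    refine contMDiffAt_finsetSum fun r _ => ?_
    refine ContMDiffAt.mul (contMDiffAt_finsetProd fun i _ => hco i (r i)) ?_
    exact ((α (fun i => frameField J q (b (r i)))).contMDiff.comp F.contMDiff) p₀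
  refine hs.congr_of_eventuallyEq ?_
  have hb : ∀ᶠ p in 𝓝 p₀, bump J q (F p) = 1 :=
    F.contMDiff.continuous.continuousAt.eventually (bump_near q)
  filter_upwards [hb] with p hp
  have hy : F p ∈ (triv J q).baseSet := by
    by_contra h
    rw [bump_zero q h] at hp
    exact zero_ne_one hp
  have hw : (fun i => mfderiv I J F p (Z i p)) =
      fun i => ∑ j, co i j p • frameField J q (b j) (F p) := by
    funext i
    simp only [frameField_apply, hp, one_smul]
    have h1 := (triv J q).symm_apply_apply_mk hy (mfderiv I J F p (Z i p))
    rw [← (triv J q).symmₗ_apply (R := ℝ) hy, ← b.sum_repr (triv J q ⟨F p, _⟩).2, map_sum] at h1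
    rw [← h1]
    refine Finset.sum_congr rfl fun j _ => ?_
    rw [map_smul, (triv J q).symmₗ_apply (R := ℝ) hy]
    rfl
  rw [hw]
  have h2 := (α.atPt (F p)).toMultilinearMap.map_sum
    (fun i j => co i j p • frameField J q (b j) (F p))
  refine h2.trans (Finset.sum_congr rfl fun r _ => ?_)
  refine ((α.atPt (F p)).toMultilinearMap.map_smul_univ (fun i => co i (r i) p)
    (fun i => frameField J q (b (r i)) (F p))).trans ?_
  rw [smul_eq_mul]
  congr 1
  exact Form.atPt_apply α _ _

/-- The pullback of a scalar form along a smooth map,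
`(F^* α)(Z₁, …, Z_k)(p) = α_{F p}(dF_p (Z₁ p), …, dF_p (Z_k p))`. -/
def Form.pullFun (F : C^∞⟮I, X; J, Y⟯) {k : ℕ} (α : Form J Y k) : Form I X k where
  toFun Z := ⟨fun p => α.atPt (F p) fun i => mfderiv I J F p (Z i p), Form.pull_contMDiff F α Z⟩
  map_update_add' Z i V W := by
    ext p
    have hu : ∀ V : VField I X, (fun j => mfderiv I J F p (Function.update Z i V j p)) =
        Function.update (fun j => mfderiv I J F p (Z j p)) i (mfderiv I J F p (V p)) := by
      intro V
      funext j
      by_cases h : j = i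
      · subst h; simp
      · simp [Function.update_of_ne h]
    change α.atPt (F p) _ = α.atPt (F p) _ + α.atPt (F p) _
    rw [hu, hu, hu, ← AlternatingMap.map_update_add, ← map_add]
    rfl
  map_update_smul' Z i a V := by
    ext p
    have hu : ∀ V : VField I X, (fun j => mfderiv I J F p (Function.update Z i V j p)) =
        Function.update (fun j => mfderiv I J F p (Z j p)) i (mfderiv I J F p (V p)) := by
      intro V
      funext j
      by_cases h : j = i
      · subst h; simp
      · simp [Function.update_of_ne h]
    change α.atPt (F p) _ = a p • α.atPt (F p) _
    rw [hu, hu, ← AlternatingMap.map_update_smul, ← map_smul]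
    rfl
  map_eq_zero_of_eq' Z i j hij hne := by
    ext p
    exact (α.atPt (F p)).map_eq_zero_of_eq _ (by rw [hij]) hne

theorem Form.pullFun_apply (F : C^∞⟮I, X; J, Y⟯) {k : ℕ} (α : Form J Y k)
    (Z : Fin k → VField I X) (p : X) :
    Form.pullFun F α Z p = α.atPt (F p) fun i => mfderiv I J F p (Z i p) := rfl

/-- The pullback of scalar forms as an additive map. -/
def Form.pull (F : C^∞⟮I, X; J, Y⟯) (k : ℕ) : Form J Y k →+ Form I X k where
  toFun := Form.pullFun F
  map_zero' := by
    ext Z p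
    rfl
  map_add' α β := by
    ext Z p
    rfl

theorem Form.pull_smul (F : C^∞⟮I, X; J, Y⟯) {k : ℕ} (a : C^∞⟮J, Y; ℝ⟯) (α : Form J Y k) :
    Form.pull F k (a • α) = (a.comp F) • Form.pull F k α := by
  ext Z p
  rfl

end Pull

section Tensor

set_option linter.unusedSectionVars false
set_option linter.unusedVariables false

variable {E : Type u} [NormedAddCommGroup E] [NormedSpace ℝ E] {H : Type*} [TopologicalSpace H]
  (I : ModelWithCorners ℝ E H) (X : Type*) [TopologicalSpace X] [ChartedSpace H X]
  [IsManifold I ∞ X]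
  {E' : Type u} [NormedAddCommGroup E'] [NormedSpace ℝ E'] {H' : Type*} [TopologicalSpace H']
  (J : ModelWithCorners ℝ E' H') (Y : Type*) [TopologicalSpace Y] [ChartedSpace H' Y]
  [IsManifold J ∞ Y]
  (G : Type*) [AddCommGroup G] [Module ℝ G] [TopologicalSpace G] [T2Space G]
  [IsTopologicalAddGroup G] [ContinuousSMul ℝ G] [LocallyConvexSpace ℝ G]
  (G' : Type*) [AddCommGroup G'] [Module ℝ G'] [TopologicalSpace G'] [T2Space G']
  [IsTopologicalAddGroup G'] [ContinuousSMul ℝ G'] [LocallyConvexSpace ℝ G']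

/-- Scalar forms of all degrees. -/
abbrev Forms := ⨁ k : ℕ, Form I X k

/-- `G`-valued smooth `k`-forms: the tensor product over `C^∞(X)` of the smooth `G`-valued maps and
the scalar `k`-forms. -/
abbrev TForm (k : ℕ) := SmoothFun I X G ⊗[C^∞⟮I, X; ℝ⟯] Form I X k

/-- `G`-valued smooth forms of all degrees. -/
abbrev GForms := ⨁ k : ℕ, TForm I X G k

variable {I X J Y G G'}

/-- The pullback `f ⊗ α ↦ (f ∘ F) ⊗ F^* α`. -/
def TForm.pull [FiniteDimensional ℝ E'] [T2Space Y] (F : C^∞⟮I, X; J, Y⟯) (k : ℕ) :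
    TForm J Y G k →+ TForm I X G k :=
  TensorProduct.liftAddHom
    { toFun := fun f =>
        { toFun := fun α => SmoothFun.pull F f ⊗ₜ Form.pull F k α
          map_zero' := by rw [map_zero, TensorProduct.tmul_zero]
          map_add' := fun α β => by rw [map_add, TensorProduct.tmul_add] }
      map_zero' := by
        ext α
        change SmoothFun.pull F (0 : SmoothFun J Y G) ⊗ₜ Form.pull F k α = 0
        rw [map_zero, TensorProduct.zero_tmul]
      map_add' := fun f g => by
        ext α
        change SmoothFun.pull F (f + g) ⊗ₜ Form.pull F k α =
          SmoothFun.pull F f ⊗ₜ Form.pull F k α + SmoothFun.pull F g ⊗ₜ Form.pull F k α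
        rw [map_add, TensorProduct.add_tmul] }
    fun a f α => by
      change SmoothFun.pull F (a • f) ⊗ₜ Form.pull F k α =
        SmoothFun.pull F f ⊗ₜ Form.pull F k (a • α)
      rw [Form.pull_smul, ← TensorProduct.smul_tmul]
      rfl

/-- The push-forward `f ⊗ α ↦ (χ ∘ f) ⊗ α`. -/
def TForm.push (χ : G →L[ℝ] G') (k : ℕ) :
    TForm I X G k →ₗ[C^∞⟮I, X; ℝ⟯] TForm I X G' k :=
  LinearMap.rTensor _ (SmoothFun.push χ)

/-- The identification `f ⊗ α ↦ f α` of `ℝ`-valued forms with scalar forms. -/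
def TForm.toScalar [FiniteDimensional ℝ E] (k : ℕ) :
    TForm I X ℝ k →ₗ[C^∞⟮I, X; ℝ⟯] Form I X k :=
  TensorProduct.lift ((LinearMap.lsmul C^∞⟮I, X; ℝ⟯ (Form I X k)) ∘ₗ SmoothFun.toReal)

/-- The inverse identification `α ↦ 1 ⊗ α`. -/
def TForm.ofScalar (k : ℕ) : Form I X k →ₗ[C^∞⟮I, X; ℝ⟯] TForm I X ℝ k :=
  TensorProduct.mk _ _ _ (SmoothFun.const I X (1 : ℝ))

/-- The product `α ∧ (f ⊗ β) = f ⊗ (α ∧ β)`. -/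
def TForm.wedge (k l : ℕ) :
    Form I X k →ₗ[C^∞⟮I, X; ℝ⟯] TForm I X G l →ₗ[C^∞⟮I, X; ℝ⟯] TForm I X G (k + l) :=
  (LinearMap.lTensorHom (SmoothFun I X G)) ∘ₗ Form.wedge k l

namespace GForms

/-- The pullback on forms of all degrees. -/
def pull [FiniteDimensional ℝ E'] [T2Space Y] (F : C^∞⟮I, X; J, Y⟯) :
    GForms J Y G →+ GForms I X G :=
  DirectSum.map fun k => TForm.pull F k

/-- The push-forward on forms of all degrees. -/
def push (χ : G →L[ℝ] G') : GForms I X G →ₗ[C^∞⟮I, X; ℝ⟯] GForms I X G' :=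
  DirectSum.lmap fun k => TForm.push χ k

/-- The identification of `ℝ`-valued forms with scalar forms. -/
def toScalar [FiniteDimensional ℝ E] : GForms I X ℝ →ₗ[C^∞⟮I, X; ℝ⟯] Forms I X :=
  DirectSum.lmap fun k => TForm.toScalar k

/-- The identification of scalar forms with `ℝ`-valued forms. -/
def ofScalar : Forms I X →ₗ[C^∞⟮I, X; ℝ⟯] GForms I X ℝ :=
  DirectSum.lmap fun k => TForm.ofScalar k

/-- A `G`-valued smooth map as a `G`-valued form of degree `0`. -/
def ofFun (f : SmoothFun I X G) : GForms I X G :=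
  DirectSum.of (TForm I X G) 0
    (f ⊗ₜ AlternatingMap.constOfIsEmpty C^∞⟮I, X; ℝ⟯ (VField I X) (Fin 0) 1)

/-- The product of a scalar form and a `G`-valued form. -/
def wedge : Forms I X →ₗ[C^∞⟮I, X; ℝ⟯] GForms I X G →ₗ[C^∞⟮I, X; ℝ⟯] GForms I X G :=
  DirectSum.toModule _ ℕ _ fun k => LinearMap.flip <| DirectSum.toModule _ ℕ _ fun l =>
    ((TForm.wedge k l).compr₂ (DirectSum.lof _ ℕ (TForm I X G) (k + l))).flip

end GForms

end Tensor

section Deriv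

set_option linter.unusedSectionVars false
set_option linter.unusedVariables false

variable {n : ℕ} {H : Type*} [TopologicalSpace H]
  {I : ModelWithCorners ℝ (EuclideanSpace ℝ (Fin n)) H}
  {X : Type*} [TopologicalSpace X] [ChartedSpace H X] [IsManifold I ∞ X]
  {G : Type*} [AddCommGroup G] [Module ℝ G] [TopologicalSpace G] [T2Space G]
  [IsTopologicalAddGroup G] [ContinuousSMul ℝ G] [LocallyConvexSpace ℝ G]

namespace GlobalChart

variable (c : GlobalChart I X)

/-- The `i`-th coordinate function. -/
def coord (i : Fin n) : C^∞⟮I, X; ℝ⟯ :=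
  ⟨fun x => (c.chart.extend I x) i, by
    have h1 : ContMDiff I 𝓘(ℝ, EuclideanSpace ℝ (Fin n)) ∞ (c.chart.extend I) := by
      rw [← contMDiffOn_univ, ← c.source_eq]
      exact OpenPartialHomeomorph.contMDiffOn_extend c.mem
    exact (EuclideanSpace.proj i : EuclideanSpace ℝ (Fin n) →L[ℝ] ℝ).contMDiff.comp h1⟩

/-- The scalar `1`-form `dx_i`. -/
def dx (i : Fin n) : Form I X 1 :=
  AlternatingMap.ofSubsingleton C^∞⟮I, X; ℝ⟯ (VField I X) C^∞⟮I, X; ℝ⟯ (0 : Fin 1)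
    (diff (c.coord i))

/-- `dx_S = dx_{i_1} ∧ … ∧ dx_{i_k}` for `S = {i_1 < … < i_k}`, the alternating form
`(V₁, …, V_k) ↦ det (dx_{i_a} (V_b))`. -/
def dxs (S : Finset (Fin n)) : Form I X S.card :=
  (Matrix.detRowAlternating (R := C^∞⟮I, X; ℝ⟯) (n := Fin S.card)).compLinearMap
    (LinearMap.pi fun a => diff (c.coord (S.orderEmbOfFin rfl a)))

/-- The form `∑_S f_S ⊗ dx_S`. -/
def form (f : Finset (Fin n) → SmoothFun I X G) : GForms I X G :=
  ∑ S, DirectSum.of (TForm I X G) S.card (f S ⊗ₜ c.dxs S)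

/-- The form `∑_S ∑_j ∂_j f_S ⊗ (dx_j ∧ dx_S)`. -/
def dForm (f : Finset (Fin n) → SmoothFun I X G) : GForms I X G :=
  ∑ S, ∑ j, DirectSum.of (TForm I X G) (1 + S.card)
    (c.partialDeriv (EuclideanSpace.single j 1) (f S) ⊗ₜ Form.wedge 1 S.card (c.dx j) (c.dxs S))

end GlobalChart

variable (I) in
/-- The inclusion of an open subset. -/
def incl (V : TopologicalSpace.Opens X) : C^∞⟮I, V; I, X⟯ := ⟨Subtype.val, contMDiff_subtype_val⟩

variable [T2Space X]

/-- `η` is an exterior derivative of `θ`: on the domain `V` of every chart, if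
`∑_S f_S ⊗ dx_S` is the (unique) decomposition of the restriction of `θ` to `V`, then the
restriction of `η` to `V` is `∑_S ∑_j ∂_j f_S ⊗ (dx_j ∧ dx_S)`. -/
def IsExtDeriv (θ η : GForms I X G) : Prop :=
  ∀ (V : TopologicalSpace.Opens X) (c : GlobalChart I V),
    ∃ f : Finset (Fin n) → SmoothFun I V G,
      GForms.pull (incl I V) θ = c.form f ∧ GForms.pull (incl I V) η = c.dForm f

/-- The exterior derivative of a `G`-valued form. -/
def extD (θ : GForms I X G) : GForms I X G :=
  Classical.epsilon (IsExtDeriv θ)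

/-- The exterior derivative of a scalar form. -/
def scalarD (α : Forms I X) : Forms I X := GForms.toScalar (extD (GForms.ofScalar α))

end Deriv

end GForm

end

/-! The modules of forms are tensor products over the ring of smooth functions, so the local
formulas for `d` cannot simply be glued: a global finite presentation of all forms is needed first.
It comes from a Whitney-type argument. A Hausdorff second countable manifold of dimension `n`,
possibly with boundary, carries `2n + 1` smooth functions whose differentials span every cotangent
space (`exists_immersion`). The gradients `Y_a` of these functions `φ_a`, for the metric `∑ dφ_c²`,
satisfy `∑ dφ_a(Z) Y_a = Z` for every vector field `Z` (`exists_dual_frame`). Multilinear expansion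
then gives `k! θ = ∑_r θ(Y_r) ⊗ dφ_r`, the sum being over all `k`-tuples `r` of indices
(`tensor_expand`). This suggests defining `d` by differentiating the coefficients `θ(Y_r) / k!`
along the `Y_a`.

Independence of the choices is tested on scalar forms. By Hahn-Banach the functionals `ψ` separate
points of `G`, and the coefficients above turn this into separation of `G`-valued forms by the
scalar forms obtained from the `ψ` (`DualFrame.ext_dual`). For scalar forms the decisive fact is
that `∑ g_t dφ_t = 0` implies `∑ dg_t ∧ dφ_t = 0`, where each `dφ_t` is a product of `k`
differentials. Scalar forms are determined by their restrictions to chart domains, and there the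
coordinate frame makes the fact an algebraic consequence of the symmetry of second derivatives
(`frameDeriv_smul_detForm`, `sum_diffForm_congr_zero`).

Consequently, if `ψ` sends `θ` to `g dφ_1 ∧ … ∧ dφ_k`, it sends `dθ` to `dg ∧ dφ_1 ∧ … ∧ dφ_k`,
whatever the functions `φ_i` are (`DualFrame.dual_extDeriv_eq`). From this follow the formula in any
other frame, in particular in coordinates, as well as `d ∘ d = 0` (because `d1 = 0`), naturality,
and the value of `df`. The Leibniz rule is checked on products of differentials, where it reduces to
the product rule for `gf` and the sign of moving a differential past `k` others. Since every form on
a chart domain is `∑ f_S ⊗ dx_S`, the resulting operator satisfies the defining chart condition.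
Since forms with equal restrictions to all chart domains are equal, no other operator does. -/

open scoped Manifold ContDiff TensorProduct DirectSum

noncomputable section

namespace GForm

open Set Filter Topology

universe u

set_option linter.unusedSectionVars false

/-! ### Products of linear functionals as determinants -/

section DetForm

variable {R V : Type*} [CommRing R] [AddCommGroup V] [Module R V]

/-- The alternating form `(v₁, …, v_k) ↦ det (ℓ_j (v_i))`, as an alternating function of the
functionals `ℓ₁, …, ℓ_k`. -/
def detForm (k : ℕ) : (V →ₗ[R] R) [⋀^Fin k]→ₗ[R] (V [⋀^Fin k]→ₗ[R] R) :=
  -- Transposing the matrix makes the functionals its rows, so multilinearity and alternation in `ℓ`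
  -- become those of the determinant in its rows.
  have key : ∀ (ℓ : Fin k → V →ₗ[R] R) (v : Fin k → V),
      Matrix.detRowAlternating.compLinearMap (LinearMap.pi ℓ) v =
        Matrix.detRowAlternating fun j i => ℓ j (v i) := fun ℓ v =>
    (Matrix.det_transpose (Matrix.of fun j i => ℓ j (v i)))
  have hu : ∀ [DecidableEq (Fin k)] (ℓ : Fin k → V →ₗ[R] R) (v : Fin k → V) (i : Fin k)
      (x : V →ₗ[R] R),
      (fun j i' => (Function.update ℓ i x j) (v i')) =
        Function.update (fun j i' => ℓ j (v i')) i fun i' => x (v i') := by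
    intro _ ℓ v i x
    funext j
    by_cases h : j = i
    · subst h; simp
    · simp [Function.update_of_ne h]
  { toFun := fun ℓ => Matrix.detRowAlternating.compLinearMap (LinearMap.pi ℓ)
    map_update_add' := fun ℓ i x y => by
      ext v
      rw [AlternatingMap.add_apply, key, key, key, hu, hu, hu,
        ← AlternatingMap.map_update_add]
      rfl
    map_update_smul' := fun ℓ i c x => by
      ext v
      rw [AlternatingMap.smul_apply, key, key, hu, hu, ← AlternatingMap.map_update_smul]
      rfl
    map_eq_zero_of_eq' := fun ℓ i j hij hne => by
      ext v
      refine (key ℓ v).trans ?_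
      exact AlternatingMap.map_eq_zero_of_eq _ _ (by rw [hij]) hne }

theorem detForm_eq {k : ℕ} (ℓ : Fin k → V →ₗ[R] R) :
    detForm k ℓ = Matrix.detRowAlternating.compLinearMap (LinearMap.pi ℓ) := rfl

theorem detForm_apply {k : ℕ} (ℓ : Fin k → V →ₗ[R] R) (v : Fin k → V) :
    detForm k ℓ v = ∑ σ : Equiv.Perm (Fin k), Equiv.Perm.sign σ • ∏ i, ℓ i (v (σ i)) := by
  rw [detForm_eq]
  exact Matrix.det_apply (Matrix.of fun i j => ℓ j (v i))

theorem detForm_eq_alternatization {k : ℕ} (ℓ : Fin k → V →ₗ[R] R) :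
    detForm k ℓ = MultilinearMap.alternatization
      ((MultilinearMap.mkPiAlgebra R (Fin k) R).compLinearMap ℓ) := by
  ext v
  rw [detForm_apply, MultilinearMap.alternatization_apply]
  rfl

/-- Both factors are alternatizations of pure products of functionals. The shuffle product of two
alternatizations is the alternatization of the product, which is again a determinant, with no
factorial appearing. -/
theorem detForm_append {k l : ℕ} (ℓ : Fin k → V →ₗ[R] R) (ℓ' : Fin l → V →ₗ[R] R) :
    AlternatingMap.domDomCongr finSumFinEquiv ((LinearMap.mul' R R).compAlternatingMap
      ((detForm k ℓ).domCoprod (detForm l ℓ'))) = detForm (k + l) (Fin.append ℓ ℓ') := by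
  ext v
  rw [detForm_eq_alternatization ℓ, detForm_eq_alternatization ℓ',
    ← MultilinearMap.domCoprod_alternization, detForm_apply]
  simp only [AlternatingMap.domDomCongr_apply, LinearMap.compAlternatingMap_apply,
    MultilinearMap.alternatization_apply, map_sum]
  refine Fintype.sum_equiv (finSumFinEquiv.permCongr) _ _ fun σ => ?_
  rw [LinearMap.map_smul_of_tower, Equiv.Perm.sign_permCongr]
  congr 1
  rw [← finSumFinEquiv.prod_comp, Fintype.prod_sum_type]
  simp [MultilinearMap.domCoprod_apply, MultilinearMap.domDomCongr_apply]

variable {ι : Type*} [Fintype ι] {a : ι → V →ₗ[R] R} {b : ι → V}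

/-- Expanding `α` multilinearly in the frame and then permuting the arguments reproduces `α` up to
sign; each permutation in the determinant therefore contributes one copy of `α`. Summing over all
tuples instead of increasing ones costs the factor `k!` but needs neither an order on `ι` nor
independence of the `a i`. -/
theorem detForm_expand (h : ∀ z, ∑ i, a i z • b i = z) {k : ℕ} (α : V [⋀^Fin k]→ₗ[R] R) :
    (k.factorial : R) • α = ∑ r : Fin k → ι, α (b ∘ r) • detForm k (a ∘ r) := by
  classical
  have key : ∀ z : Fin k → V, α z = ∑ r : Fin k → ι, (∏ i, a (r i) (z i)) * α (b ∘ r) := by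
    intro z
    have h1 := α.toMultilinearMap.map_sum (fun i j => a j (z i) • b j)
    simp only [h] at h1
    refine h1.trans (Finset.sum_congr rfl fun r _ => ?_)
    exact α.toMultilinearMap.map_smul_univ (fun i => a (r i) (z i)) (fun i => b (r i))
  ext z
  rw [show ∀ F : (Fin k → ι) → V [⋀^Fin k]→ₗ[R] R, (∑ r, F r) z = ∑ r, F r z from fun F =>
    map_sum (⟨⟨fun α => α z, rfl⟩, fun _ _ => rfl⟩ : (V [⋀^Fin k]→ₗ[R] R) →+ R) F _]
  simp only [AlternatingMap.smul_apply, detForm_apply, Finset.smul_sum]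
  rw [Finset.sum_comm]
  have h2 : ∀ σ : Equiv.Perm (Fin k), ∑ r : Fin k → ι, α (b ∘ r) •
      (Equiv.Perm.sign σ • ∏ i, (a ∘ r) i (z (σ i))) = α z := by
    intro σ
    have h3 := key (z ∘ σ)
    rw [α.map_perm] at h3
    calc _ = Equiv.Perm.sign σ • ∑ r : Fin k → ι, (∏ i, a (r i) ((z ∘ σ) i)) * α (b ∘ r) := by
          rw [Finset.smul_sum]
          refine Finset.sum_congr rfl fun r _ => ?_
          rw [smul_comm, smul_eq_mul, mul_comm]
          rfl
      _ = α z := by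
          rw [← h3, smul_smul, Int.units_mul_self, one_smul]
  simp only [h2, Finset.sum_const, Finset.card_univ, Fintype.card_perm, Fintype.card_fin]
  simp

variable {P : Type*} [AddCommGroup P] [Module R P]

/-- The value of a form with coefficients in `P`, `(f ⊗ α)(z) = α(z) f`. -/
def tensorEval {k : ℕ} (z : Fin k → V) : P ⊗[R] (V [⋀^Fin k]→ₗ[R] R) →ₗ[R] P :=
  TensorProduct.lift ((LinearMap.lsmul R P).flip.compl₂
    (⟨⟨fun α => α z, fun _ _ => rfl⟩, fun _ _ => rfl⟩ : (V [⋀^Fin k]→ₗ[R] R) →ₗ[R] R))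

@[simp]
theorem tensorEval_tmul {k : ℕ} (z : Fin k → V) (f : P) (α : V [⋀^Fin k]→ₗ[R] R) :
    tensorEval z (f ⊗ₜ[R] α) = α z • f := rfl

/-- This reduces forms with coefficients in `P` to finitely many coefficients that are linear in the
form; through it, equalities of tensors become equalities in `P`. -/
theorem tensor_expand (h : ∀ z, ∑ i, a i z • b i = z) {k : ℕ}
    (θ : P ⊗[R] (V [⋀^Fin k]→ₗ[R] R)) :
    (k.factorial : R) • θ = ∑ r : Fin k → ι, tensorEval (b ∘ r) θ ⊗ₜ[R] detForm k (a ∘ r) := by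
  induction θ with
  | zero => simp
  | add x y hx hy => simp only [smul_add, hx, hy, map_add, TensorProduct.add_tmul,
      Finset.sum_add_distrib]
  | tmul f α =>
    rw [← TensorProduct.tmul_smul, detForm_expand h, TensorProduct.tmul_sum]
    refine Finset.sum_congr rfl fun r _ => ?_
    rw [tensorEval_tmul, TensorProduct.smul_tmul]

/-- Degrees such as `1 + (k + l)` and `1 + k + l` are only propositionally equal, so forms in them
are compared inside the direct sum. -/
theorem of_detForm_cast {k k' : ℕ} (h : k = k') (f : P) (ℓ : Fin k' → V →ₗ[R] R) :
    DirectSum.of (fun k => P ⊗[R] (V [⋀^Fin k]→ₗ[R] R)) k (f ⊗ₜ detForm k (ℓ ∘ Fin.cast h)) =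
      DirectSum.of (fun k => P ⊗[R] (V [⋀^Fin k]→ₗ[R] R)) k' (f ⊗ₜ detForm k' ℓ) := by
  subst h
  rfl

theorem detForm_append_comp {k l : ℕ} (σ : Equiv.Perm (Fin k)) (ℓ : Fin k → V →ₗ[R] R)
    (ℓ' : Fin l → V →ₗ[R] R) :
    detForm (k + l) (Fin.append (ℓ ∘ σ) ℓ') =
      Equiv.Perm.sign σ • detForm (k + l) (Fin.append ℓ ℓ') := by
  have h : Fin.append (ℓ ∘ σ) ℓ' =
      Fin.append ℓ ℓ' ∘ finSumFinEquiv.permCongr (Equiv.Perm.sumCongr σ (1 : Equiv.Perm (Fin l))) := by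
    funext i
    obtain ⟨i | i, rfl⟩ := finSumFinEquiv.surjective i <;>
      simp [Equiv.permCongr_apply]
  rw [h, AlternatingMap.map_perm, Equiv.Perm.sign_permCongr, Equiv.Perm.sign_sumCongr]
  simp

theorem of_detForm_append_assoc {k l : ℕ} (f : P) (x : Fin 1 → V →ₗ[R] R)
    (ℓ : Fin k → V →ₗ[R] R) (ℓ' : Fin l → V →ₗ[R] R) :
    DirectSum.of (fun k => P ⊗[R] (V [⋀^Fin k]→ₗ[R] R)) (1 + (k + l))
        (f ⊗ₜ detForm _ (Fin.append x (Fin.append ℓ ℓ'))) =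
      DirectSum.of (fun k => P ⊗[R] (V [⋀^Fin k]→ₗ[R] R)) (1 + k + l)
        (f ⊗ₜ detForm _ (Fin.append (Fin.append x ℓ) ℓ')) := by
  rw [Fin.append_assoc, of_detForm_cast]

/-- Moving `x` to the front past `k` functionals is a cycle of length `k + 1`, whose sign is `(-1) ^
k`. -/
theorem of_detForm_append_comm {k l : ℕ} (f : P) (x : Fin 1 → V →ₗ[R] R)
    (ℓ : Fin k → V →ₗ[R] R) (ℓ' : Fin l → V →ₗ[R] R) :
    DirectSum.of (fun k => P ⊗[R] (V [⋀^Fin k]→ₗ[R] R)) (k + (1 + l))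
        (f ⊗ₜ detForm _ (Fin.append ℓ (Fin.append x ℓ'))) =
      DirectSum.of (fun k => P ⊗[R] (V [⋀^Fin k]→ₗ[R] R)) (1 + (k + l))
        (((-1 : R) ^ k • f) ⊗ₜ detForm _ (Fin.append x (Fin.append ℓ ℓ'))) := by
  -- After reassociation the first block is `ℓ` followed by `x`, which is the rotation of `x`
  -- followed by `ℓ`.
  have h1 : Fin.append ℓ (Fin.append x ℓ') =
      Fin.append ((Fin.cons (x 0) ℓ : Fin (k + 1) → V →ₗ[R] R) ∘ finRotate (k + 1)) ℓ' ∘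
        Fin.cast (Nat.add_assoc k 1 l).symm := by
    have h2 := Fin.append_assoc ℓ x ℓ'
    rw [Fin.append_right_eq_snoc ℓ x, Fin.snoc_eq_cons_rotate] at h2
    funext i
    exact (congrFun h2 (Fin.cast (Nat.add_assoc k 1 l).symm i)).symm
  have h3 : ∀ (ε : ℤˣ) (α : V [⋀^Fin (k + 1 + l)]→ₗ[R] R),
      f ⊗ₜ[R] (ε • α) = (((ε : ℤ) : R) • f) ⊗ₜ[R] α := by
    intro ε α
    rw [Units.smul_def, ← Int.cast_smul_eq_zsmul R, TensorProduct.smul_tmul]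
  rw [h1, of_detForm_cast, detForm_append_comp, sign_finRotate, of_detForm_append_assoc,
    Fin.append_left_eq_cons, Fin.append_cast_left, of_detForm_cast, h3]
  simp

end DetForm

/-! ### Wedge products with a single functional -/

section AltWedge

variable {R V : Type*} [CommRing R] [AddCommGroup V] [Module R V]

/-- The wedge product of alternating forms. -/
def altWedge (k l : ℕ) : (V [⋀^Fin k]→ₗ[R] R) →ₗ[R] (V [⋀^Fin l]→ₗ[R] R) →ₗ[R]
    (V [⋀^Fin (k + l)]→ₗ[R] R) :=
  TensorProduct.curry
    ((AlternatingMap.domDomCongrₗ R finSumFinEquiv).toLinearMap ∘ₗ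
      (LinearMap.compAlternatingMapₗ (S := R) (LinearMap.mul' R R)) ∘ₗ
      AlternatingMap.domCoprod')

theorem altWedge_detForm {k l : ℕ} (ℓ : Fin k → V →ₗ[R] R) (ℓ' : Fin l → V →ₗ[R] R) :
    altWedge k l (detForm k ℓ) (detForm l ℓ') = detForm (k + l) (Fin.append ℓ ℓ') :=
  detForm_append ℓ ℓ'

/-- The linear map `x ↦ x ∧ α` from functionals, for a form `α`. -/
def consForm (k : ℕ) : (V →ₗ[R] R) →ₗ[R] (V [⋀^Fin k]→ₗ[R] R) →ₗ[R]
    (V [⋀^Fin (1 + k)]→ₗ[R] R) :=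
  -- The first `0` is a base tuple and the second is its only slot, so the base tuple is overwritten
  -- completely.
  altWedge 1 k ∘ₗ (detForm 1).toMultilinearMap.toLinearMap 0 0

theorem consForm_detForm {k : ℕ} (x : V →ₗ[R] R) (ℓ : Fin k → V →ₗ[R] R) :
    consForm k x (detForm k ℓ) = detForm (1 + k) (Fin.append (fun _ => x) ℓ) := by
  rw [← altWedge_detForm]
  change altWedge 1 k (detForm 1 (Function.update 0 0 x)) _ = _
  congr 3

theorem consForm_update_self {k : ℕ} (x : V →ₗ[R] R) (ℓ : Fin k → V →ₗ[R] R) (i : Fin k) :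
    consForm k x (detForm k (Function.update ℓ i x)) = 0 := by
  rw [consForm_detForm]
  refine AlternatingMap.map_eq_zero_of_eq _ _ (i := Fin.castAdd k 0) (j := Fin.natAdd 1 i) ?_ ?_
  · rw [Fin.append_left, Fin.append_right, Function.update_self]
  · intro h
    have := congrArg Fin.val h
    simp at this
    omega

/-- Polarization of `consForm_update_self` at `x + y`. -/
theorem consForm_update_swap {k : ℕ} (x y : V →ₗ[R] R) (ℓ : Fin k → V →ₗ[R] R) (i : Fin k) :
    consForm k y (detForm k (Function.update ℓ i x)) =
      -consForm k x (detForm k (Function.update ℓ i y)) := by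
  have h := consForm_update_self (x + y) ℓ i
  rw [AlternatingMap.map_update_add, map_add, map_add, LinearMap.add_apply, LinearMap.add_apply,
    consForm_update_self, consForm_update_self, zero_add, add_zero] at h
  rwa [eq_neg_iff_add_eq_zero]

end AltWedge

/-! ### Algebra of the exterior derivative in a coordinate frame -/

section Derivation

variable {R V : Type*} [CommRing R] [Algebra ℝ R] [AddCommGroup V] [Module R V]
  {δ : Derivation ℝ R (V →ₗ[R] R)} {ι : Type*} [Fintype ι] {x : ι → R} {b : ι → V}

theorem derivation_expand (h : ∀ z, ∑ i, δ (x i) z • b i = z) (g : R) :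
    δ g = ∑ i, δ g (b i) • δ (x i) := by
  ext z
  conv_lhs => rw [← h z]
  simp [mul_comm]

theorem derivation_detForm_eq_zero {k : ℕ} (ℓ : Fin k → V →ₗ[R] R) (v : Fin k → V)
    (h : ∀ i j, δ (ℓ i (v j)) = 0) : δ (detForm k ℓ v) = 0 := by
  rw [detForm_apply, map_sum]
  refine Finset.sum_eq_zero fun σ _ => ?_
  rw [Units.smul_def, map_zsmul]
  suffices δ (∏ i, ℓ i (v (σ i))) = 0 by rw [this, smul_zero]
  refine Finset.prod_induction _ (fun y => δ y = 0) (fun y z hy hz => ?_) ?_ fun i _ => h _ _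
  · rw [δ.leibniz, hy, hz, smul_zero, smul_zero, add_zero]
  · exact δ.map_one_eq_zero

variable (δ x b) in
/-- The exterior derivative in a frame, up to the factor `k!`. -/
def frameDeriv (k : ℕ) : (V [⋀^Fin k]→ₗ[R] R) →+ (V [⋀^Fin (1 + k)]→ₗ[R] R) where
  toFun α := ∑ r : Fin k → ι, consForm k (δ (α (b ∘ r))) (detForm k fun i => δ (x (r i)))
  map_zero' := by simp
  map_add' α β := by simp [Finset.sum_add_distrib]

theorem frameDeriv_apply {k : ℕ} (α : V [⋀^Fin k]→ₗ[R] R) :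
    frameDeriv δ x b k α =
      ∑ r : Fin k → ι, consForm k (δ (α (b ∘ r))) (detForm k fun i => δ (x (r i))) := rfl

/-- The coefficients of `dx_r` in the frame have zero differential by `hc`, so the derivation only
sees `g`; expanding `dx_r` in the frame produces the factor `k!`. -/
theorem frameDeriv_coord (h : ∀ z, ∑ i, δ (x i) z • b i = z)
    (hc : ∀ i j, δ (δ (x i) (b j)) = 0) {k : ℕ} (g : R) (r : Fin k → ι) :
    frameDeriv δ x b k (g • detForm k fun i => δ (x (r i))) =
      (k.factorial : R) • consForm k (δ g) (detForm k fun i => δ (x (r i))) := by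
  have h1 := detForm_expand h (detForm k fun i => δ (x (r i)))
  rw [← map_smul (consForm k (δ g)), h1, map_sum, frameDeriv_apply]
  refine Finset.sum_congr rfl fun r' _ => ?_
  rw [AlternatingMap.smul_apply, smul_eq_mul, δ.leibniz,
    derivation_detForm_eq_zero _ (b ∘ r') fun _ _ => hc _ _, smul_zero, zero_add, map_smul,
    map_smul, LinearMap.smul_apply]
  rfl

/-- This is `d(dg) = 0` with `dg = ∑ ∂_j g dx_j` placed in slot `p` of a product. The second
derivatives are symmetric in the two indices and the product is antisymmetric in them, so the sum
equals its own negative; `2` is invertible over `ℝ`. -/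
theorem sum_consForm_eq_zero (h : ∀ z, ∑ i, δ (x i) z • b i = z)
    (hs : ∀ g i j, δ (δ g (b i)) (b j) = δ (δ g (b j)) (b i)) {k : ℕ} (g : R)
    (ℓ : Fin k → V →ₗ[R] R) (p : Fin k) :
    ∑ j, consForm k (δ (δ g (b j))) (detForm k (Function.update ℓ p (δ (x j)))) = 0 := by
  have h1 : ∀ j, consForm k (δ (δ g (b j))) (detForm k (Function.update ℓ p (δ (x j)))) =
      ∑ i, δ (δ g (b j)) (b i) • consForm k (δ (x i)) (detForm k (Function.update ℓ p (δ (x j)))) := by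
    intro j
    conv_lhs => rw [derivation_expand h (δ g (b j)), map_sum, LinearMap.sum_apply]
    simp only [map_smul, LinearMap.smul_apply]
  simp only [h1]
  set T := ∑ j, ∑ i, δ (δ g (b j)) (b i) •
    consForm k (δ (x i)) (detForm k (Function.update ℓ p (δ (x j)))) with hT
  have h2 : T = -T := by
    conv_lhs => rw [hT, Finset.sum_comm]
    rw [hT, ← Finset.sum_neg_distrib]
    refine Finset.sum_congr rfl fun i _ => ?_
    rw [← Finset.sum_neg_distrib]
    refine Finset.sum_congr rfl fun j _ => ?_
    rw [consForm_update_swap, smul_neg, hs]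
  have h3 : (2 : ℝ) • T = 0 := by rw [two_smul]; nth_rewrite 1 [h2]; exact neg_add_cancel T
  have h4 : (2 : ℝ)⁻¹ • (2 : ℝ) • T = 0 := by rw [h3, smul_zero]
  rwa [inv_smul_smul₀ two_ne_zero] at h4

/-- The functions `φ i` need not be coordinates. Each differential `dφ_p` is replaced by `∑ ∂_j φ_p
dx_j`, which moves `∂_j φ_p` into the coefficient; the extra terms `g d(∂_j φ_p) ∧ …` cancel by
`sum_consForm_eq_zero`. -/
theorem frameDeriv_smul_detForm (h : ∀ z, ∑ i, δ (x i) z • b i = z)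
    (hc : ∀ i j, δ (δ (x i) (b j)) = 0)
    (hs : ∀ g i j, δ (δ g (b i)) (b j) = δ (δ g (b j)) (b i)) {k : ℕ} (g : R) (φ : Fin k → R) :
    frameDeriv δ x b k (g • detForm k fun i => δ (φ i)) =
      (k.factorial : R) • consForm k (δ g) (detForm k fun i => δ (φ i)) := by
  -- Induction on a set `s` of slots outside of which all functions are already coordinates.
  suffices H : ∀ (s : Finset (Fin k)) (g : R) (φ : Fin k → R), (∀ i ∉ s, ∃ j, φ i = x j) →
      frameDeriv δ x b k (g • detForm k fun i => δ (φ i)) =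
        (k.factorial : R) • consForm k (δ g) (detForm k fun i => δ (φ i)) from
    H Finset.univ g φ fun i hi => absurd (Finset.mem_univ i) hi
  intro s
  induction s using Finset.induction with
  | empty =>
    intro g φ hφ
    choose r hr using fun i => hφ i (Finset.notMem_empty i)
    obtain rfl : φ = fun i => x (r i) := funext hr
    exact frameDeriv_coord h hc g r
  | insert p s hp ih =>
    intro g φ hφ
    have hu : ∀ j, (fun i => δ (Function.update φ p (x j) i)) =
        Function.update (fun i => δ (φ i)) p (δ (x j)) := by
      intro j
      funext i
      by_cases hi : i = p
      · subst hi; simp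
      · simp [Function.update_of_ne hi]
    have h1 : (detForm k fun i => δ (φ i)) =
        ∑ j, δ (φ p) (b j) • detForm k fun i => δ (Function.update φ p (x j) i) := by
      simp only [hu]
      conv_lhs => rw [← Function.update_eq_self p fun i => δ (φ i), derivation_expand h (φ p),
        AlternatingMap.map_update_sum]
      exact Finset.sum_congr rfl fun j _ => AlternatingMap.map_update_smul _ _ _ _ _
    have h2 : ∀ j, frameDeriv δ x b k
        ((g * δ (φ p) (b j)) • detForm k fun i => δ (Function.update φ p (x j) i)) =
        (k.factorial : R) • (δ (φ p) (b j) • consForm k (δ g)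
            (detForm k fun i => δ (Function.update φ p (x j) i)) +
          g • consForm k (δ (δ (φ p) (b j)))
            (detForm k (Function.update (fun i => δ (φ i)) p (δ (x j))))) := by
      intro j
      rw [ih, δ.leibniz, map_add, map_smul, map_smul, hu]
      · exact congrArg _ (add_comm _ _)
      · intro i hi
        by_cases hip : i = p
        · exact ⟨j, by subst hip; simp⟩
        · rw [Function.update_of_ne hip]
          exact hφ i (by simp [hip, hi])
    conv_lhs => rw [h1, Finset.smul_sum, map_sum]
    simp only [smul_smul, h2]
    rw [← Finset.smul_sum, Finset.sum_add_distrib, ← Finset.smul_sum (r := g),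
      sum_consForm_eq_zero h hs, smul_zero, add_zero, h1, map_sum]
    simp only [map_smul]

/-- `frameDeriv` is additive and depends only on the form, while `frameDeriv_smul_detForm` computes
it from any presentation. Hence the derivative of a vanishing sum vanishes, after division by `k!`.
-/
theorem sum_consForm_congr_zero (h : ∀ z, ∑ i, δ (x i) z • b i = z)
    (hc : ∀ i j, δ (δ (x i) (b j)) = 0)
    (hs : ∀ g i j, δ (δ g (b i)) (b j) = δ (δ g (b j)) (b i)) {k : ℕ} {κ : Type*} (s : Finset κ)
    (g : κ → R) (φ : κ → Fin k → R) (h0 : ∑ t ∈ s, g t • detForm k (fun i => δ (φ t i)) = 0) :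
    ∑ t ∈ s, consForm k (δ (g t)) (detForm k fun i => δ (φ t i)) = 0 := by
  have h1 := congrArg (frameDeriv δ x b k) h0
  rw [map_zero, map_sum] at h1
  simp only [frameDeriv_smul_detForm h hc hs] at h1
  rw [← Finset.smul_sum] at h1
  set T := ∑ t ∈ s, consForm k (δ (g t)) (detForm k fun i => δ (φ t i))
  have h2 : (k.factorial : ℝ) • T = 0 := by
    rw [← h1, Nat.cast_smul_eq_nsmul, Nat.cast_smul_eq_nsmul]
  have h3 : (k.factorial : ℝ)⁻¹ • (k.factorial : ℝ) • T = 0 := by rw [h2, smul_zero]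
  rwa [inv_smul_smul₀ (Nat.cast_ne_zero.2 k.factorial_ne_zero)] at h3

end Derivation

/-! ### Differentials read in a chart -/

section Chart

variable {E : Type u} [NormedAddCommGroup E] [NormedSpace ℝ E] {H : Type*} [TopologicalSpace H]
  {I : ModelWithCorners ℝ E H} {X : Type*} [TopologicalSpace X] [ChartedSpace H X]
  {F : Type*} [NormedAddCommGroup F] [NormedSpace ℝ F]

theorem hasMFDerivAt_extend {e : OpenPartialHomeomorph X H}
    (he : e ∈ IsManifold.maximalAtlas I ∞ X) {x : X} (hx : x ∈ e.source) :
    HasMFDerivAt I 𝓘(ℝ, E) (e.extend I) x (mfderiv I 𝓘(ℝ, E) (e.extend I) x) :=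
  (((OpenPartialHomeomorph.contMDiffOn_extend he).contMDiffAt
    (e.open_source.mem_nhds hx)).mdifferentiableAt (by simp)).hasMFDerivAt

theorem extend_mem_target (I : ModelWithCorners ℝ E H) {e : OpenPartialHomeomorph X H} {x : X}
    (hx : x ∈ e.source) :
    e.extend I x ∈ (e.extend I).target :=
  (e.extend I).map_source (by rwa [e.extend_source])

/-- Chain rule for `g = (g ∘ e⁻¹) ∘ e` near `x`. The derivative within the target of the chart also
makes sense at boundary points. -/
theorem mfderiv_eq_fderivWithin_chart {e : OpenPartialHomeomorph X H}
    (he : e ∈ IsManifold.maximalAtlas I ∞ X) {x : X} (hx : x ∈ e.source) {g : X → F}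
    (hg : DifferentiableWithinAt ℝ (g ∘ (e.extend I).symm) (e.extend I).target (e.extend I x))
    (v : TangentSpace I x) :
    mfderiv I 𝓘(ℝ, F) g x v = fderivWithin ℝ (g ∘ (e.extend I).symm) (e.extend I).target
      (e.extend I x) (mfderiv I 𝓘(ℝ, E) (e.extend I) x v) := by
  have h1 := HasMFDerivWithinAt.comp (f := e.extend I) (s := e.source) (u := (e.extend I).target) x
    hg.hasFDerivWithinAt.hasMFDerivWithinAt
    (hasMFDerivAt_extend he hx).hasMFDerivWithinAt fun z hz => extend_mem_target I hz
  have h2 := h1.hasMFDerivAt (e.open_source.mem_nhds hx)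
  have h3 : g =ᶠ[𝓝 x] (g ∘ (e.extend I).symm) ∘ e.extend I := by
    filter_upwards [e.open_source.mem_nhds hx] with y hy
    simp only [Function.comp_apply]
    rw [e.extend_left_inv hy]
  rw [(h2.congr_of_eventuallyEq h3).mfderiv]
  rfl

/-- The inverse chart composed with the chart is the identity near `x`, so the differential of the
chart has a left inverse. -/
theorem mfderiv_extend_injective {e : OpenPartialHomeomorph X H} [IsManifold I ∞ X]
    (he : e ∈ IsManifold.maximalAtlas I ∞ X) {x : X} (hx : x ∈ e.source) {v : TangentSpace I x}
    (hv : mfderiv I 𝓘(ℝ, E) (e.extend I) x v = 0) : v = 0 := by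
  have hd : MDifferentiableWithinAt 𝓘(ℝ, E) I (e.extend I).symm (e.extend I).target
      (e.extend I x) := by
    rw [e.extend_target']
    refine ((contMDiffOn_extend_symm he) _ ?_).mdifferentiableWithinAt (by simp)
    rw [← e.extend_target']
    exact extend_mem_target I hx
  have h1 := HasMFDerivWithinAt.comp (f := e.extend I) (s := e.source) (u := (e.extend I).target) x
    hd.hasMFDerivWithinAt
    (hasMFDerivAt_extend he hx).hasMFDerivWithinAt fun z hz => extend_mem_target I hz
  have h2 := h1.hasMFDerivAt (e.open_source.mem_nhds hx)
  have h3 : id =ᶠ[𝓝 x] (e.extend I).symm ∘ e.extend I := by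
    filter_upwards [e.open_source.mem_nhds hx] with y hy
    simp only [Function.comp_apply]
    rw [e.extend_left_inv hy, id]
  have h4 := (h2.congr_of_eventuallyEq h3).mfderiv
  rw [mfderiv_id] at h4
  have h5 := congrArg (fun L => L v) h4
  exact h5.trans ((congrArg _ hv).trans (map_zero
    (mfderivWithin 𝓘(ℝ, E) I (e.extend I).symm (e.extend I).target (e.extend I x))))

end Chart

/-! ### Generic linear combinations without zeros -/

section Generic

variable {E F : Type*} [NormedAddCommGroup E] [NormedSpace ℝ E] [FiniteDimensional ℝ E]
  [NormedAddCommGroup F] [NormedSpace ℝ F] [FiniteDimensional ℝ F]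

/-- Convexity makes a `C¹` map locally Lipschitz up to the boundary, and locally Lipschitz maps do
not raise Hausdorff dimension. -/
theorem GoodSet.dimH_image_le {s t : Set E} (hs : GoodSet s) {f : E → F} (hf : ContDiffOn ℝ 1 f s)
    (ht : t ⊆ s) : dimH (f '' t) ≤ dimH t := by
  obtain ⟨u, C, hu, hC, -, rfl⟩ := hs
  refine dimH_image_le_of_locally_lipschitzOn fun x hx => ?_
  have h1 : ContDiffWithinAt ℝ 1 f C x :=
    (hf x (ht hx)).mono_of_mem_nhdsWithin
      (inter_mem (mem_nhdsWithin_of_mem_nhds (hu.mem_nhds (ht hx).1)) self_mem_nhdsWithin)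
  obtain ⟨K, U, hU, hK⟩ := h1.exists_lipschitzOnWith hC
  exact ⟨K, U, nhdsWithin_mono _ (fun y hy => (ht hy).2) hU, hK⟩

variable {κ Z : Type*} {J : Finset κ} {w : κ → Z → ℝ} {C : Set Z}

/-- The complement is the projection of a closed set along the compact set `C`, hence closed. -/
theorem isOpen_sum_smul_ne_zero [TopologicalSpace Z] (hC : IsCompact C)
    (hw : ∀ j ∈ J, ContinuousOn (w j) C) :
    IsOpen {c : κ → F | ∀ z ∈ C, ∑ j ∈ J, w j z • c j ≠ 0} := by
  have := isCompact_iff_compactSpace.1 hC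
  have h1 : {c : κ → F | ∀ z ∈ C, ∑ j ∈ J, w j z • c j ≠ 0}ᶜ =
      Prod.fst '' {p : (κ → F) × C | ∑ j ∈ J, w j p.2 • p.1 j = 0} := by
    ext c
    simp
  rw [← isClosed_compl_iff, h1]
  refine isClosedMap_fst_of_compactSpace _ (isClosed_eq ?_ continuous_const)
  refine continuous_finsetSum _ fun j hj => Continuous.smul ?_ ?_
  · exact (continuousOn_iff_continuous_domRestrict.1 (hw j hj)).comp continuous_snd
  · exact (continuous_apply j).comp continuous_fst

/-- Since `w j₀ = 1` on `C`, the combination vanishes at `z` exactly when `c j₀` equals `-∑ w j z •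
c j` over the other indices. These values form a `C¹` image of a set of dimension less than that of
`F`, so an arbitrarily small change of `c j₀` alone avoids them. -/
theorem dense_sum_smul_ne_zero {Z : Type*} [NormedAddCommGroup Z] [NormedSpace ℝ Z]
    [FiniteDimensional ℝ Z] {w : κ → Z → ℝ} {C s : Set Z}
    (hZ : Module.finrank ℝ Z < Module.finrank ℝ F) (hs : GoodSet s) (hCs : C ⊆ s)
    (hw : ∀ j ∈ J, ContDiffOn ℝ 1 (w j) s) {j₀ : κ} (hj₀ : j₀ ∈ J) (h1 : ∀ z ∈ C, w j₀ z = 1) :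
    Dense {c : κ → F | ∀ z ∈ C, ∑ j ∈ J, w j z • c j ≠ 0} := by
  classical
  intro c
  let ψ : Z → F := fun z => -∑ j ∈ J.erase j₀, w j z • c j
  have hψ : ContDiffOn ℝ 1 ψ s :=
    (ContDiffOn.sum fun j hj => (hw j (Finset.mem_of_mem_erase hj)).smul contDiffOn_const).neg
  have hD : Dense (ψ '' C)ᶜ := by
    refine dense_compl_of_dimH_lt_finrank ?_
    calc dimH (ψ '' C) ≤ dimH C := hs.dimH_image_le hψ hCs
      _ ≤ dimH (univ : Set Z) := dimH_mono (subset_univ _)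
      _ = Module.finrank ℝ Z := Real.dimH_univ_eq_finrank Z
      _ < _ := by exact_mod_cast hZ
  have hT : Continuous fun v : F => Function.update c j₀ v := continuous_const.update j₀ continuous_id
  have h2 := hT.continuousAt.continuousWithinAt.mem_closure_image (hD (c j₀))
  rw [Function.update_eq_self] at h2
  refine closure_mono ?_ h2
  rintro _ ⟨v, hv, rfl⟩ z hz h3
  refine hv ⟨z, hz, ?_⟩
  beta_reduce at h3
  rw [← Finset.add_sum_erase _ _ hj₀, Function.update_self, h1 z hz, one_smul] at h3
  rw [← eq_neg_iff_add_eq_zero] at h3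
  rw [h3]
  refine congrArg Neg.neg (Finset.sum_congr rfl fun j hj => ?_)
  rw [Function.update_of_ne (Finset.ne_of_mem_erase hj)]

end Generic

/-! ### Finitely many functions whose differentials separate tangent vectors -/

section Immersion

variable {E : Type u} [NormedAddCommGroup E] [NormedSpace ℝ E] [FiniteDimensional ℝ E]
  {H : Type*} [TopologicalSpace H]
  {I : ModelWithCorners ℝ E H} {X : Type*} [TopologicalSpace X] [ChartedSpace H X]
  [IsManifold I ∞ X]

theorem eventually_compl_finite_eq_zero {κ : Type*} {g : κ → X → ℝ}
    (hg : LocallyFinite fun j => Function.support (g j)) {K : Set X} {J : Set κ}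
    (hJ : ∀ j ∉ J, closure (Function.support (g j)) ∩ K = ∅) {x : X} (hx : x ∈ K) :
    ∀ᶠ y in 𝓝 x, ∀ j ∉ J, g j y = 0 := by
  have h1 : IsClosed (⋃ j : (Jᶜ : Set κ), closure (Function.support (g j))) :=
    (hg.closure.comp_injective Subtype.val_injective).isClosed_iUnion fun _ => isClosed_closure
  have h2 : x ∉ ⋃ j : (Jᶜ : Set κ), closure (Function.support (g j)) := by
    rw [mem_iUnion]
    rintro ⟨⟨j, hj⟩, hxj⟩
    exact (hJ j hj).le ⟨hxj, hx⟩
  filter_upwards [h1.isOpen_compl.mem_nhds h2] with y hy j hj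
  by_contra h
  exact hy (mem_iUnion.2 ⟨⟨j, hj⟩, subset_closure h⟩)

theorem hasMFDerivAt_sum {κ : Type*} (J : Finset κ) {f : κ → X → ℝ} {x : X}
    {f' : κ → TangentSpace I x →L[ℝ] ℝ} (h : ∀ j ∈ J, HasMFDerivAt I 𝓘(ℝ, ℝ) (f j) x (f' j)) :
    HasMFDerivAt I 𝓘(ℝ, ℝ) (∑ j ∈ J, f j) x (∑ j ∈ J, f' j) := by
  classical
  induction J using Finset.induction with
  | empty => exact hasMFDerivAt_const (0 : ℝ) x
  | insert j J hj ih =>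
    have h1 : ∑ i ∈ insert j J, f' i = f' j + ∑ i ∈ J, f' i := Finset.sum_insert hj
    rw [Finset.sum_insert hj]
    exact ((h j (Finset.mem_insert_self _ _)).add
      (ih fun i hi => h i (Finset.mem_insert_of_mem hi))).congr_mfderiv h1.symm

/-- The coefficient vectors `c` for which `∑ j, g j • c j` has, at the points of `K`, a differential
that is non-zero on the vectors whose coordinates in a chart are in `B`, form an open dense set. -/
theorem exists_open_dense_coefficients {F : Type*} [NormedAddCommGroup F] [NormedSpace ℝ F]
    [FiniteDimensional ℝ F] (hF : Module.finrank ℝ (E × E) < Module.finrank ℝ F) {κ : Type*}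
    {g : κ → X → ℝ} (hg : LocallyFinite fun j => Function.support (g j))
    (hgs : ∀ j, ContMDiff I 𝓘(ℝ, ℝ) ∞ (g j)) {e : OpenPartialHomeomorph X H}
    (he : e ∈ IsManifold.maximalAtlas I ∞ X) {K : Set X} (hK : IsCompact K) (hKe : K ⊆ e.source)
    {ℓ : E →L[ℝ] ℝ} {j₀ : κ} (hj₀ : ∀ x ∈ K, g j₀ =ᶠ[𝓝 x] ℓ ∘ e.extend I) {B : Set E}
    (hB : IsCompact B) (hB1 : ∀ ξ ∈ B, ℓ ξ = 1) :
    ∃ O : Set (κ → F), IsOpen O ∧ Dense O ∧ ∀ c ∈ O, ∀ x ∈ K, ∀ v : TangentSpace I x,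
      mfderiv I 𝓘(ℝ, E) (e.extend I) x v ∈ B →
      ∃ J : Finset κ, (∀ᶠ y in 𝓝 x, ∀ j ∉ J, g j y = 0) ∧
        ∑ j ∈ J, (show ℝ from mfderiv I 𝓘(ℝ, ℝ) (g j) x v) • c j ≠ 0 := by
  classical
  set s := (e.extend I).target
  have hs : GoodSet s := goodSet_target I e
  have hfin := hg.closure.finite_nonempty_inter_compact hK
  -- By compactness only finitely many supports meet `K`; `j₀` is added because it must belong to
  -- `J` even when `K` is empty.
  let J : Finset κ := insert j₀ hfin.toFinset
  have hJ : ∀ j ∉ (J : Set κ), closure (Function.support (g j)) ∩ K = ∅ := by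
    intro j hj
    by_contra h
    exact hj (Finset.mem_coe.2 (Finset.mem_insert_of_mem (hfin.mem_toFinset.2
      (nonempty_iff_ne_empty.2 h))))
  let w : κ → E × E → ℝ := fun j p => fderivWithin ℝ (g j ∘ (e.extend I).symm) s p.1 p.2
  have hcd : ∀ j, ContDiffOn ℝ ∞ (g j ∘ (e.extend I).symm) s := fun j => contDiffOn_chart (hgs j) he
  have hw : ∀ j, ContDiffOn ℝ 1 (w j) (s ×ˢ univ) := fun j =>
    contDiffOn_fderivWithin_apply (hcd j) hs.uniqueDiffOn (by norm_cast)
  let C : Set (E × E) := (e.extend I '' K) ×ˢ B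
  have hCs : C ⊆ s ×ˢ univ := by
    rintro ⟨y, ξ⟩ ⟨⟨x, hx, rfl⟩, -⟩
    exact ⟨extend_mem_target I (hKe hx), mem_univ _⟩
  have hC : IsCompact C := by
    refine (hK.image_of_continuousOn ?_).prod hB
    exact (OpenPartialHomeomorph.contMDiffOn_extend he).continuousOn.mono hKe
  have hmf : ∀ j, ∀ x ∈ K, ∀ v : TangentSpace I x, mfderiv I 𝓘(ℝ, ℝ) (g j) x v =
      w j (e.extend I x, mfderiv I 𝓘(ℝ, E) (e.extend I) x v) := by
    intro j x hx v
    exact mfderiv_eq_fderivWithin_chart he (hKe hx) ((hcd j).differentiableOn (by simp) _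
      (extend_mem_target I (hKe hx))) v
  -- Near `K` the function `g j₀` is the linear functional `ℓ` read in the chart, so its derivative
  -- is `ℓ`, which is `1` on `B`.
  have h1 : ∀ z ∈ C, w j₀ z = 1 := by
    rintro ⟨y, ξ⟩ ⟨⟨x, hx, rfl⟩, hξ⟩
    have hx' := extend_mem_target I (hKe hx)
    have h2 : g j₀ ∘ (e.extend I).symm =ᶠ[𝓝[s] (e.extend I x)] ℓ := by
      have h3 : Tendsto (e.extend I).symm (𝓝[s] (e.extend I x)) (𝓝 x) := by
        have h4 : ContinuousOn (e.extend I).symm s := by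
          have := (contMDiffOn_extend_symm he).continuousOn
          rwa [← e.extend_target'] at this
        have := (h4 _ hx').tendsto
        rwa [e.extend_left_inv (hKe hx)] at this
      filter_upwards [h3.eventually (hj₀ x hx), self_mem_nhdsWithin] with y hy hys
      rw [Function.comp_apply, hy, Function.comp_apply, (e.extend I).right_inv hys]
    change fderivWithin ℝ (g j₀ ∘ (e.extend I).symm) s (e.extend I x) ξ = 1
    rw [h2.fderivWithin_eq (h2.self_of_nhdsWithin hx'),
      ℓ.hasFDerivWithinAt.fderivWithin (hs.uniqueDiffOn _ hx')]
    exact hB1 ξ hξ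
  refine ⟨{c | ∀ z ∈ C, ∑ j ∈ J, w j z • c j ≠ 0},
    isOpen_sum_smul_ne_zero hC fun j _ => (hw j).continuousOn.mono hCs,
    dense_sum_smul_ne_zero hF hs.prod hCs (fun j _ => hw j) (Finset.mem_insert_self _ _) h1, ?_⟩
  intro c hc x hx v hv
  refine ⟨J, eventually_compl_finite_eq_zero hg hJ hx, ?_⟩
  simp only [hmf _ x hx]
  exact hc _ ⟨mem_image_of_mem _ hx, hv⟩

variable (I X) in
-- The functions are the components of `∑_j g_j c_j`, where the `g_j` are cut-off chart coordinates
-- and the `c_j` are generic vectors in `ℝ^(2d+1)`. A nonzero tangent vector in the kernel is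
-- described by `2d` parameters, one fewer than the number of equations. The nonzero vectors are
-- covered, up to scaling, by countably many compact pieces, so Baire's theorem gives coefficients
-- that work for all of them at once.
theorem exists_immersion [T2Space X] [SecondCountableTopology X] :
    ∃ (N : ℕ) (φ : Fin N → C^∞⟮I, X; ℝ⟯), ∀ (x : X) (v : TangentSpace I x),
      (∀ a, mfderiv I 𝓘(ℝ, ℝ) (φ a) x v = 0) → v = 0 := by
  classical
  have : LocallyCompactSpace X := Manifold.locallyCompact_of_finiteDimensional I
  obtain ⟨ι, fs, -⟩ := SmoothBumpCovering.exists_isSubordinate I (isClosed_univ (X := X))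
    (U := fun _ => univ) fun _ _ => univ_mem
  -- Countability is needed both for the Baire property of the space of coefficient families and for
  -- the number of conditions imposed on it.
  have hι : Countable ι := by
    refine countable_univ_iff.1 (fs.locallyFinite'.countable_univ fun i => ?_)
    exact ⟨fs.c i, by simp⟩
  set d := Module.finrank ℝ E
  let b : Module.Basis (Fin d) ℝ E := Module.finBasis ℝ E
  let ℓ : Fin d → E →L[ℝ] ℝ := fun k => (b.coord k).toContinuousLinearMap
  let e : ι → OpenPartialHomeomorph X H := fun i => chartAt H (fs.c i)
  have he : ∀ i, e i ∈ IsManifold.maximalAtlas I ∞ X := fun i =>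
    IsManifold.chart_mem_maximalAtlas _
  let g : ι × Fin d → X → ℝ := fun j x => fs.toFun j.1 x • ℓ j.2 ((e j.1).extend I x)
  have hgs : ∀ j, ContMDiff I 𝓘(ℝ, ℝ) ∞ (g j) := fun j =>
    (fs.toFun j.1).contMDiff_smul ((ℓ j.2).contMDiff.comp_contMDiffOn
      (OpenPartialHomeomorph.contMDiffOn_extend (he j.1)))
  have hg : LocallyFinite fun j => Function.support (g j) := by
    intro x
    obtain ⟨t, ht, hfin⟩ := fs.locallyFinite' x
    refine ⟨t, ht, (hfin.prod (finite_univ (α := Fin d))).subset ?_⟩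
    rintro ⟨i, k⟩ ⟨y, hy, hyt⟩
    exact ⟨⟨y, left_ne_zero_of_smul hy, hyt⟩, mem_univ _⟩
  let N := 2 * d + 1
  let F := Fin N → ℝ
  have hF : Module.finrank ℝ (E × E) < Module.finrank ℝ F := by
    rw [Module.finrank_prod, Module.finrank_fin_fun]
    omega
  -- On these open sets, which cover the manifold, `g (i, k)` is the uncut `k`-th coordinate of the
  -- chart. They are exhausted below by compact sets.
  let A : ι → Set X := fun i => {x | fs.toFun i =ᶠ[𝓝 x] 1}
  have hAo : ∀ i, IsOpen (A i) := fun i => isOpen_setOfPred_eventually_nhds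
  have hAK : ∀ i, ∃ K : ℕ → Set X, (∀ m, IsCompact (K m)) ∧ ⋃ m, K m = A i := by
    intro i
    have := (hAo i).locallyCompactSpace
    exact isSigmaCompact_iff_sigmaCompactSpace.2 inferInstance
  choose K hK hKA using hAK
  have hKA' : ∀ i m, K i m ⊆ A i := fun i m => hKA i ▸ subset_iUnion (K i) m
  have hAe : ∀ i, A i ⊆ (e i).source := by
    intro i x hx
    have h1 : fs.toFun i x = 1 := hx.self_of_nhds
    by_contra h
    rw [image_eq_zero_of_notMem_tsupport fun h' =>
      h ((fs.toFun i).tsupport_subset_chartAt_source h')] at h1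
    exact zero_ne_one h1
  -- A nonzero coordinate vector has some nonzero component `k`; dividing by it puts the vector into
  -- `B k m` for `m` large.
  let B : Fin d → ℕ → Set E := fun k m => Metric.closedBall 0 m ∩ {ξ | ℓ k ξ = 1}
  have hB : ∀ k m, IsCompact (B k m) := fun k m =>
    (isCompact_closedBall _ _).inter_right (isClosed_eq (ℓ k).continuous continuous_const)
  have hO : ∀ p : (ι × ℕ) × Fin d × ℕ, _ := fun p =>
    exists_open_dense_coefficients (F := F) hF hg hgs (he p.1.1) (hK p.1.1 p.1.2)
      ((hKA' p.1.1 p.1.2).trans (hAe p.1.1)) (ℓ := ℓ p.2.1) (j₀ := (p.1.1, p.2.1))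
      (fun x hx => by
        filter_upwards [hKA' p.1.1 p.1.2 hx] with y hy
        simp [g, hy])
      (hB p.2.1 p.2.2) fun ξ hξ => hξ.2
  choose O hOo hOd hO using hO
  -- Baire: a countable intersection of dense open sets of coefficients is nonempty.
  obtain ⟨c, hc⟩ := (dense_iInter_of_isOpen hOo hOd).nonempty
  rw [mem_iInter] at hc
  refine ⟨N, fun a => ⟨fun x => ∑ᶠ j, c j a * g j x, contMDiff_finsum (fun j =>
    contMDiff_const.mul (hgs j)) (hg.subset fun j x hx => right_ne_zero_of_mul hx)⟩, ?_⟩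
  intro x v hv
  by_contra hv0
  obtain ⟨i, hi⟩ := fs.eventuallyEq_one' x (mem_univ x)
  have hxA : x ∈ A i := hi
  obtain ⟨m, hm⟩ := mem_iUnion.1 ((hKA i).symm ▸ hxA)
  set ξ : E := mfderiv I 𝓘(ℝ, E) ((e i).extend I) x v with hξ
  have hξ0 : ξ ≠ 0 := fun h => hv0 (mfderiv_extend_injective (he i) (hAe i hxA) h)
  obtain ⟨k, hk⟩ : ∃ k, ℓ k ξ ≠ 0 := by
    by_contra! h
    exact hξ0 (b.ext_elem_iff.2 fun k => (h k).trans (map_zero (b.coord k)).symm)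
  obtain ⟨m', hm'⟩ := exists_nat_ge ‖(ℓ k ξ)⁻¹ • ξ‖
  obtain ⟨J, hJ, hJ0⟩ := hO ((i, m), (k, m')) c (hc _) x hm ((ℓ k ξ)⁻¹ • v) (by
    rw [map_smul, ← hξ]
    exact ⟨mem_closedBall_zero_iff.2 hm', (map_smul (ℓ k) _ _).trans (inv_mul_cancel₀ hk)⟩)
  refine hJ0 (funext fun a => ?_)
  -- Near `x` the locally finite sum is a sum over the single finite set `J` and can be
  -- differentiated term by term.
  have h1 : (fun x => ∑ᶠ j, c j a * g j x) =ᶠ[𝓝 x] fun x => ∑ j ∈ J, c j a * g j x := by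
    filter_upwards [hJ] with y hy
    refine finsum_eq_sum_of_support_subset _ fun j hj => ?_
    by_contra h
    exact hj (by simp [hy j h])
  let D : ι × Fin d → TangentSpace I x →L[ℝ] ℝ := fun j => mfderiv I 𝓘(ℝ, ℝ) (g j) x
  have h2 : HasMFDerivAt I 𝓘(ℝ, ℝ) (∑ j ∈ J, c j a • g j) x (∑ j ∈ J, c j a • D j) := by
    refine hasMFDerivAt_sum J (f := fun j => c j a • g j) (f' := fun j => c j a • D j) fun j _ => ?_
    exact (((hgs j).mdifferentiableAt (by simp)).hasMFDerivAt).const_smul (c j a)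
  have h4 : (∑ j ∈ J, c j a • g j) = fun x => ∑ j ∈ J, c j a * g j x := by
    funext y
    simp
  rw [h4] at h2
  have h3 := hv a
  change mfderiv I 𝓘(ℝ, ℝ) (fun x => ∑ᶠ j, c j a * g j x) x v = 0 at h3
  rw [(h2.congr_of_eventuallyEq h1).mfderiv] at h3
  have h5 : ∑ j ∈ J, c j a * D j v = 0 := by
    refine Eq.trans ?_ h3
    exact (_root_.sum_apply J (fun j => c j a • D j) v).symm
  have h6 : ∀ j, D j ((ℓ k ξ)⁻¹ • v) = (ℓ k ξ)⁻¹ * D j v := fun j => map_smul (D j) _ v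
  rw [Finset.sum_apply]
  calc ∑ j ∈ J, (D j ((ℓ k ξ)⁻¹ • v)) * c j a = (ℓ k ξ)⁻¹ * ∑ j ∈ J, c j a * D j v := by
        rw [Finset.mul_sum]
        refine Finset.sum_congr rfl fun j _ => ?_
        rw [h6]
        ring
    _ = 0 := by rw [h5, mul_zero]

end Immersion

/-! ### Global dual frames from gradients -/

section Frame

variable {E : Type u} [NormedAddCommGroup E] [NormedSpace ℝ E]
  {H : Type*} [TopologicalSpace H]
  {I : ModelWithCorners ℝ E H} {X : Type*} [TopologicalSpace X] [ChartedSpace H X]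
  [IsManifold I ∞ X]

theorem diff_apply (g : C^∞⟮I, X; ℝ⟯) (Z : VField I X) (x : X) :
    diff g Z x = mfderiv I 𝓘(ℝ, ℝ) g x (Z x) := rfl

theorem VField.sum_apply {κ : Type*} (s : Finset κ) (W : κ → VField I X) (x : X) :
    (∑ j ∈ s, W j) x = ∑ j ∈ s, W j x :=
  map_sum (⟨⟨fun V : VField I X => V x, rfl⟩, fun _ _ => rfl⟩ : VField I X →+ TangentSpace I x) W s

variable [FiniteDimensional ℝ E] [T2Space X]

theorem mem_triv_of_bump {q x : X} (hx : bump I q x = 1) : x ∈ (triv I q).baseSet := by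
  by_contra h
  rw [bump_zero q h] at hx
  exact zero_ne_one hx

theorem eq_sum_frameField {q x : X} (hx : bump I q x = 1) (v : TangentSpace I x) :
    ∃ y : Fin (Module.finrank ℝ E) → ℝ,
      v = ∑ j, y j • frameField I q (Module.finBasis ℝ E j) x := by
  set b := Module.finBasis ℝ E
  have hy := mem_triv_of_bump hx
  refine ⟨fun j => b.repr (triv I q ⟨x, v⟩).2 j, ?_⟩
  simp only [frameField_apply, hx, one_smul]
  have h1 := (triv I q).symm_apply_apply_mk hy v
  rw [← (triv I q).symmₗ_apply (R := ℝ) hy, ← b.sum_repr (triv I q ⟨x, v⟩).2, map_sum] at h1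
  refine h1.symm.trans (Finset.sum_congr rfl fun j _ => ?_)
  rw [map_smul, (triv I q).symmₗ_apply (R := ℝ) hy]

theorem sum_frameField_eq_zero {q x : X} (hx : bump I q x = 1) {y : E}
    (h : ∑ j, (Module.finBasis ℝ E).repr y j • frameField I q (Module.finBasis ℝ E j) x = 0) :
    y = 0 := by
  set b := Module.finBasis ℝ E
  have hy := mem_triv_of_bump hx
  simp only [frameField_apply, hx, one_smul] at h
  have h1 : (triv I q).symmₗ ℝ x y = 0 := by
    rw [← h]
    conv_lhs => rw [← b.sum_repr y, map_sum]
    refine Finset.sum_congr rfl fun j _ => ?_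
    rw [map_smul, (triv I q).symmₗ_apply (R := ℝ) hy]
  have h2 := (triv I q).linearMapAt_symmₗ (R := ℝ) hy y
  rw [← h2, h1, map_zero]

variable {ι : Type*} [Fintype ι] {φ : ι → C^∞⟮I, X; ℝ⟯}

/-- The field `u` is the gradient of `φ a` for the metric `∑ dφ_c²`, which is positive definite
because the differentials separate vectors. In a local frame it is found by inverting the Gram
matrix, and inversion of operators is smooth. -/
theorem exists_local_gram_inverse
    (h : ∀ (x : X) (v : TangentSpace I x), (∀ a, mfderiv I 𝓘(ℝ, ℝ) (φ a) x v = 0) → v = 0)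
    (a : ι) (q : X) : ∃ u : ∀ x : X, TangentSpace I x,
      ContMDiffAt I (I.prod 𝓘(ℝ, E)) ∞ (fun x => Bundle.TotalSpace.mk' E x (u x)) q ∧
      ∀ᶠ x in 𝓝 q, ∀ w : TangentSpace I x, ∑ c, (show ℝ from mfderiv I 𝓘(ℝ, ℝ) (φ c) x (u x)) *
        (show ℝ from mfderiv I 𝓘(ℝ, ℝ) (φ c) x w) = mfderiv I 𝓘(ℝ, ℝ) (φ a) x w := by
  set b := Module.finBasis ℝ E with hb
  let W : Fin (Module.finrank ℝ E) → VField I X := fun j => frameField I q (b j)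
  let g : ι → Fin (Module.finrank ℝ E) → C^∞⟮I, X; ℝ⟯ := fun c j => diff (φ c) (W j)
  let K : Fin (Module.finrank ℝ E) → Fin (Module.finrank ℝ E) → E →L[ℝ] E := fun j l =>
    (b.coord j).toContinuousLinearMap.smulRight (b l)
  let M : X → E →L[ℝ] E := fun x => ∑ c, ∑ j, ∑ l, (g c j x * g c l x) • K j l
  -- `ContinuousLinearMap.inverse` is zero at non-invertible operators; only points near `q`, where
  -- `M x` is invertible, matter.
  let y : X → E := fun x => (M x).inverse (∑ l, g a l x • b l)
  have hM : ContMDiff I 𝓘(ℝ, E →L[ℝ] E) ∞ M :=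
    contMDiff_finsetSum fun c _ => contMDiff_finsetSum fun j _ => contMDiff_finsetSum fun l _ =>
      ((g c j).contMDiff.mul (g c l).contMDiff).smul contMDiff_const
  have hD : ∀ x c (v : Fin (Module.finrank ℝ E) → ℝ),
      (mfderiv I 𝓘(ℝ, ℝ) (φ c) x (∑ j, v j • W j x) : ℝ) = ∑ j, v j * g c j x := by
    intro x c v
    refine (map_sum (mfderiv I 𝓘(ℝ, ℝ) (φ c) x) _ _).trans (Finset.sum_congr rfl fun j _ => ?_)
    exact map_smul (mfderiv I 𝓘(ℝ, ℝ) (φ c) x) _ _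
  have hMv : ∀ x v l, b.repr (M x v) l = ∑ c, (∑ j, b.repr v j * g c j x) * g c l x := by
    intro x v l
    simp only [M, K, _root_.sum_apply, map_sum, Finsupp.finsetSum_apply]
    refine Finset.sum_congr rfl fun c _ => ?_
    rw [Finset.sum_mul]
    refine Finset.sum_congr rfl fun j _ => ?_
    simp [Finsupp.single_apply]
    ring
  have hinj : ∀ x, bump I q x = 1 → ∀ v, M x v = 0 → v = 0 := by
    intro x hx v hv
    -- The quadratic form of the Gram operator `M x` at `v` is a sum of squares of values of the
    -- `dφ_c`.
    have h1 : ∑ c, (∑ j, b.repr v j * g c j x) ^ 2 = 0 := by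
      have h2 : ∀ l, b.repr v l * b.repr (M x v) l = 0 := by simp [hv]
      have h3 : ∑ l, b.repr v l * b.repr (M x v) l = 0 := Finset.sum_eq_zero fun l _ => h2 l
      simp only [hMv, Finset.mul_sum] at h3
      rw [Finset.sum_comm] at h3
      rw [← h3]
      refine Finset.sum_congr rfl fun c _ => ?_
      rw [sq, Finset.mul_sum]
      refine Finset.sum_congr rfl fun l _ => ?_
      rw [Finset.sum_mul, Finset.sum_mul, Finset.mul_sum]
      refine Finset.sum_congr rfl fun j _ => ?_
      ring
    have h4 : ∀ c, ∑ j, b.repr v j * g c j x = 0 := fun c => by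
      have := (Finset.sum_eq_zero_iff_of_nonneg fun c _ => sq_nonneg _).1 h1 c (Finset.mem_univ c)
      exact pow_eq_zero_iff two_ne_zero |>.1 this
    exact sum_frameField_eq_zero hx (h x _ fun c => (hD x c _).trans (h4 c))
  have heq : ∀ x, bump I q x = 1 → ∃ e : E ≃L[ℝ] E, (e : E →L[ℝ] E) = M x := by
    intro x hx
    refine ⟨(LinearEquiv.ofInjectiveEndo (M x : E →ₗ[ℝ] E) ?_).toContinuousLinearEquiv, ?_⟩
    · exact (injective_iff_map_eq_zero (M x : E →ₗ[ℝ] E)).2 (hinj x hx)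
    · ext v
      rfl
  have hy : ContMDiffAt I 𝓘(ℝ, E) ∞ y q := by
    obtain ⟨e, he⟩ := heq q (bump_self q)
    have h1 : ContDiffAt ℝ ∞ ContinuousLinearMap.inverse (M q) := he ▸ contDiffAt_map_inverse e
    have h2 : ContMDiffAt I 𝓘(ℝ, E) ∞ (fun x => ∑ l, g a l x • b l) q :=
      (contMDiff_finsetSum fun l _ => (g a l).contMDiff.smul contMDiff_const) q
    exact (h1.contMDiffAt.comp q (hM q)).clm_apply h2
  refine ⟨fun x => ∑ j, b.repr (y x) j • W j x, ?_, ?_⟩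
  · refine ContMDiffAt.sum_section fun j _ => ?_
    refine ContMDiffAt.smul_section (f := fun x => b.repr (y x) j) ?_ ((W j).contMDiff q)
    have h3 : ContMDiff 𝓘(ℝ, E) 𝓘(ℝ, ℝ) ∞ (LinearMap.toContinuousLinearMap (b.coord j)) :=
      ContinuousLinearMap.contMDiff _
    exact ContMDiffAt.comp q h3.contMDiffAt hy
  · filter_upwards [bump_near (J := I) q] with x hx w
    obtain ⟨z, rfl⟩ := eq_sum_frameField hx w
    have h1 : M x (y x) = ∑ l, g a l x • b l := by
      obtain ⟨e, he⟩ := heq x hx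
      simp only [y]
      rw [← he, ContinuousLinearMap.inverse_equiv]
      exact e.apply_symm_apply _
    have h2 : ∀ l, ∑ c, (∑ j, b.repr (y x) j * g c j x) * g c l x = g a l x := by
      intro l
      rw [← hMv, h1]
      simp [Finsupp.single_apply]
    have h3 : ∀ c, (mfderiv I 𝓘(ℝ, ℝ) (φ c) x (∑ j, z j • W j x) : ℝ) = ∑ j, z j * g c j x :=
      fun c => hD x c z
    have h4 : ∀ c, (mfderiv I 𝓘(ℝ, ℝ) (φ c) x (∑ j, b.repr (y x) j • W j x) : ℝ) =
      ∑ j, b.repr (y x) j * g c j x := fun c => hD x c _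
    calc _ = ∑ c, (∑ j, b.repr (y x) j * g c j x) * ∑ j, z j * g c j x :=
          Finset.sum_congr rfl fun c _ => congrArg₂ (· * ·) (h4 c) (h3 c)
      _ = ∑ j, z j * ∑ c, (∑ j, b.repr (y x) j * g c j x) * g c j x := by
          simp only [Finset.mul_sum]
          rw [Finset.sum_comm]
          refine Finset.sum_congr rfl fun j _ => Finset.sum_congr rfl fun c _ => ?_
          ring
      _ = ∑ j, z j * g a j x := by simp only [h2]
      _ = (show ℝ from mfderiv I 𝓘(ℝ, ℝ) (φ a) x (∑ j, z j • W j x)) := (h3 a).symm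

/-- Let `Y a` be the gradient of `φ a`. Pairing `∑ dφ_a(Z) Y_a` with `w` in the metric gives `∑
dφ_a(Z) dφ_a(w)`, which is the pairing of `Z` with `w`; nondegeneracy gives the expansion. -/
theorem exists_dual_frame
    (h : ∀ (x : X) (v : TangentSpace I x), (∀ a, mfderiv I 𝓘(ℝ, ℝ) (φ a) x v = 0) → v = 0) :
    ∃ Y : ι → VField I X, ∀ Z, ∑ a, diff (φ a) Z • Y a = Z := by
  choose u hu hu' using exists_local_gram_inverse h
  have huniq : ∀ x (v v' : TangentSpace I x), (∀ w : TangentSpace I x,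
      ∑ c, (show ℝ from mfderiv I 𝓘(ℝ, ℝ) (φ c) x v) *
        (show ℝ from mfderiv I 𝓘(ℝ, ℝ) (φ c) x w) =
      ∑ c, (show ℝ from mfderiv I 𝓘(ℝ, ℝ) (φ c) x v') *
        (show ℝ from mfderiv I 𝓘(ℝ, ℝ) (φ c) x w)) → v = v' := by
    intro x v v' hv
    have h1 : ∀ c, (mfderiv I 𝓘(ℝ, ℝ) (φ c) x (v - v') : ℝ) =
      (show ℝ from mfderiv I 𝓘(ℝ, ℝ) (φ c) x v) - (show ℝ from mfderiv I 𝓘(ℝ, ℝ) (φ c) x v') :=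
      fun c => map_sub (mfderiv I 𝓘(ℝ, ℝ) (φ c) x) v v'
    have h2 : ∑ c, (show ℝ from mfderiv I 𝓘(ℝ, ℝ) (φ c) x (v - v')) ^ 2 = 0 := by
      have h3 := sub_eq_zero.2 (hv (v - v'))
      rw [← Finset.sum_sub_distrib] at h3
      rw [← h3]
      refine Finset.sum_congr rfl fun c _ => ?_
      rw [sq, ← sub_mul]
      exact congrArg (· * _) (h1 c)
    refine sub_eq_zero.1 (h x _ fun c => ?_)
    have := (Finset.sum_eq_zero_iff_of_nonneg fun c _ => sq_nonneg _).1 h2 c (Finset.mem_univ c)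
    exact pow_eq_zero_iff two_ne_zero |>.1 this
  have hself : ∀ a x (w : TangentSpace I x),
      ∑ c, (show ℝ from mfderiv I 𝓘(ℝ, ℝ) (φ c) x (u a x x)) *
        (show ℝ from mfderiv I 𝓘(ℝ, ℝ) (φ c) x w) = mfderiv I 𝓘(ℝ, ℝ) (φ a) x w :=
    fun a x => (hu' a x).self_of_nhds
  -- The gradient at `x` is read from the local solution around `x` itself. By uniqueness it agrees
  -- near `q` with the smooth local solution around `q`.
  refine ⟨fun a => ⟨fun x => u a x x, fun q => (hu a q).congr_of_eventuallyEq ?_⟩, fun Z => ?_⟩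
  · filter_upwards [hu' a q] with x hx
    exact congrArg (Bundle.TotalSpace.mk' E x)
      (huniq x _ _ fun w => (hself a x w).trans (hx w).symm)
  · refine ContMDiffSection.ext fun x => ?_
    rw [VField.sum_apply]
    refine huniq x _ _ fun w => ?_
    have h1 : ∀ c, (mfderiv I 𝓘(ℝ, ℝ) (φ c) x
        (∑ a, (diff (φ a) Z x) • u a x x) : ℝ) =
        ∑ a, diff (φ a) Z x * (show ℝ from mfderiv I 𝓘(ℝ, ℝ) (φ c) x (u a x x)) := by
      intro c
      refine (map_sum (mfderiv I 𝓘(ℝ, ℝ) (φ c) x) _ _).trans (Finset.sum_congr rfl fun j _ => ?_)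
      exact map_smul (mfderiv I 𝓘(ℝ, ℝ) (φ c) x) _ _
    calc _ = ∑ c, (∑ a, diff (φ a) Z x * (show ℝ from mfderiv I 𝓘(ℝ, ℝ) (φ c) x (u a x x))) *
          (show ℝ from mfderiv I 𝓘(ℝ, ℝ) (φ c) x w) :=
          Finset.sum_congr rfl fun c _ => congrArg (· * _) (h1 c)
      _ = ∑ a, diff (φ a) Z x * ∑ c, (show ℝ from mfderiv I 𝓘(ℝ, ℝ) (φ c) x (u a x x)) *
          (show ℝ from mfderiv I 𝓘(ℝ, ℝ) (φ c) x w) := by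
          simp only [Finset.mul_sum]
          rw [Finset.sum_comm]
          exact Finset.sum_congr rfl fun c _ =>
            (Finset.sum_mul _ _ _).trans (Finset.sum_congr rfl fun a _ => mul_assoc _ _ _)
      _ = ∑ a, diff (φ a) Z x * (show ℝ from mfderiv I 𝓘(ℝ, ℝ) (φ a) x w) :=
          Finset.sum_congr rfl fun a _ => congrArg (_ * ·) (hself a x w)
      _ = _ := rfl

/-- Functions and vector fields with `Z = ∑ a, d(fn a)(Z) • vec a` for all vector fields `Z`. -/
structure DualFrame (I : ModelWithCorners ℝ E H) (X : Type*) [TopologicalSpace X]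
    [ChartedSpace H X] [IsManifold I ∞ X] (ι : Type) [Fintype ι] where
  fn : ι → C^∞⟮I, X; ℝ⟯
  vec : ι → VField I X
  expand : ∀ Z, ∑ a, diff (fn a) Z • vec a = Z

variable (I X) in
theorem exists_dualFrame [SecondCountableTopology X] : ∃ N, Nonempty (DualFrame I X (Fin N)) := by
  obtain ⟨N, φ, h⟩ := exists_immersion I X
  obtain ⟨Y, hY⟩ := exists_dual_frame h
  exact ⟨N, ⟨⟨φ, Y, hY⟩⟩⟩

end Frame

/-! ### Derivatives of vector-valued maps, tested by functionals -/

section Lie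

variable {E : Type u} [NormedAddCommGroup E] [NormedSpace ℝ E] [FiniteDimensional ℝ E]
  {H : Type*} [TopologicalSpace H]
  {I : ModelWithCorners ℝ E H} {X : Type*} [TopologicalSpace X] [ChartedSpace H X]
  [IsManifold I ∞ X]
  {G : Type*} [AddCommGroup G] [Module ℝ G] [TopologicalSpace G] [T2Space G]
  [IsTopologicalAddGroup G] [ContinuousSMul ℝ G] [LocallyConvexSpace ℝ G]

variable (I X) in
/-- The differential `g ↦ dg` as a derivation. -/
def diffDerivation : Derivation ℝ C^∞⟮I, X; ℝ⟯ (VField I X →ₗ[C^∞⟮I, X; ℝ⟯] C^∞⟮I, X; ℝ⟯) :=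
  have hd : ∀ (g : C^∞⟮I, X; ℝ⟯) x, HasMFDerivAt I 𝓘(ℝ, ℝ) g x (mfderiv I 𝓘(ℝ, ℝ) g x) :=
    fun g _ => (g.contMDiff.mdifferentiableAt (by simp)).hasMFDerivAt
  Derivation.mk'
    { toFun := diff
      map_add' := fun g h => by
        ext Z x
        exact congrArg (fun L : TangentSpace I x →L[ℝ] ℝ => L (Z x))
          ((hd g x).add (hd h x)).mfderiv
      map_smul' := fun c g => by
        ext Z x
        exact congrArg (fun L : TangentSpace I x →L[ℝ] ℝ => L (Z x))
          ((hd g x).const_smul c).mfderiv }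
    fun g h => by
      ext Z x
      exact congrArg (fun L : TangentSpace I x →L[ℝ] ℝ => L (Z x))
          ((hd g x).mul (hd h x)).mfderiv

theorem diffDerivation_apply (g : C^∞⟮I, X; ℝ⟯) : diffDerivation I X g = diff g := rfl

namespace SmoothFun

/-- The real function `ψ ∘ f`. -/
def dual (ψ : G →L[ℝ] ℝ) : SmoothFun I X G →ₗ[C^∞⟮I, X; ℝ⟯] C^∞⟮I, X; ℝ⟯ :=
  toReal ∘ₗ push ψ

theorem dual_apply (ψ : G →L[ℝ] ℝ) (f : SmoothFun I X G) (x : X) : dual ψ f x = ψ (f x) := rfl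

theorem dual_real_smul (ψ : G →L[ℝ] ℝ) (c : ℝ) (f : SmoothFun I X G) :
    dual ψ (c • f) = c • dual ψ f := by
  ext x
  exact map_smul ψ c (f x)

/-- Hahn-Banach in a Hausdorff locally convex space. -/
theorem eq_of_dual {g g' : G} (h : ∀ ψ : G →L[ℝ] ℝ, ψ g = ψ g') : g = g' := by
  by_contra hne
  obtain ⟨ψ, hψ⟩ := geometric_hahn_banach_point_point hne
  exact hψ.ne (h ψ)

theorem ext_dual {f g : SmoothFun I X G} (h : ∀ ψ : G →L[ℝ] ℝ, dual ψ f = dual ψ g) : f = g :=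
  Subtype.ext <| funext fun x => eq_of_dual fun ψ => congrArg (fun k : C^∞⟮I, X; ℝ⟯ => k x) (h ψ)

/-- At interior points both sides are the directional derivative of the same real function. Both are
continuous up to the boundary, so they agree there too. -/
theorem dual_dir {e : OpenPartialHomeomorph X H} (he : e ∈ IsManifold.maximalAtlas I ∞ X)
    (f : SmoothFun I X G) {df : E × E → G}
    (hd : ∀ y ∈ interior (e.extend I).target, ∀ v,
      HasDirDeriv (f ∘ (e.extend I).symm) y v (df (y, v)))
    (hc : ContinuousOn df ((e.extend I).target ×ˢ (univ : Set E))) (ψ : G →L[ℝ] ℝ) {x : X}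
    (hx : x ∈ e.source) (v : TangentSpace I x) :
    ψ (df (e.extend I x, mfderiv I 𝓘(ℝ, E) (e.extend I) x v)) = mfderiv I 𝓘(ℝ, ℝ) (dual ψ f) x v := by
  set s := (e.extend I).target
  have hs : GoodSet s := goodSet_target I e
  set h : E → ℝ := dual ψ f ∘ (e.extend I).symm with hh
  have hcd : ContDiffOn ℝ ∞ h s := contDiffOn_chart (dual ψ f).contMDiff he
  rw [mfderiv_eq_fderivWithin_chart he hx
    (hcd.differentiableOn (by simp) _ (extend_mem_target I hx))]
  refine dir_unique (f := h) hs (df := fun p => ψ (df p))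
    (df' := fun p => fderivWithin ℝ h s p.1 p.2) (fun y hy w => ?_) (fun y hy w => ?_)
    (ψ.continuous.comp_continuousOn hc)
    (contDiffOn_fderivWithin_apply (m := ∞) hcd hs.uniqueDiffOn (by simp)).continuousOn
    (show (_, _) ∈ s ×ˢ univ from ⟨extend_mem_target I hx, mem_univ _⟩)
  · refine ((ψ.continuous.tendsto _).comp (hd y hy w)).congr fun t => ?_
    simp only [Function.comp_apply, map_smul, map_sub]
    rfl
  · have hny : s ∈ 𝓝 y := mem_interior_iff_mem_nhds.1 hy
    have hd' : DifferentiableAt ℝ h y := (hcd.differentiableOn (by simp)).differentiableAt hny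
    rw [fderivWithin_of_mem_nhds hny]
    have := hd'.hasFDerivAt.hasLineDerivAt w
    rw [HasLineDerivAt, hasDerivAt_iff_tendsto_slope_zero] at this
    simpa [HasDirDeriv] using this

theorem contMDiffOn_mfderiv_extend {e : OpenPartialHomeomorph X H}
    (he : e ∈ IsManifold.maximalAtlas I ∞ X) (Z : VField I X) :
    ContMDiffOn I 𝓘(ℝ, E) ∞ (fun x => (mfderiv I 𝓘(ℝ, E) (e.extend I) x (Z x) : E)) e.source := by
  have h1 : ContMDiffOn I.tangent 𝓘(ℝ, E).tangent ∞
      (tangentMapWithin I 𝓘(ℝ, E) (e.extend I) e.source) (Bundle.TotalSpace.proj ⁻¹' e.source) :=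
    (OpenPartialHomeomorph.contMDiffOn_extend he).contMDiffOn_tangentMapWithin (by simp)
      e.open_source.uniqueMDiffOn
  have h2 := (contMDiff_snd_tangentBundle_modelSpace E 𝓘(ℝ, E)).comp_contMDiffOn
    (h1.comp (Z.contMDiff.contMDiffOn (s := e.source)) fun x hx => hx)
  refine h2.congr fun x hx => ?_
  rw [← mfderivWithin_of_isOpen e.open_source hx]
  rfl

/-- At `x` the value is the Bastiani derivative of `f` in the preferred chart, in the direction of
`Z x`. By `dual_dir` every functional sends it to an expression free of charts, so any chart
computes the same value; in a fixed chart it is the composition of a Bastiani smooth map with a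
smooth one. -/
theorem exists_lie (Z : VField I X) (f : SmoothFun I X G) :
    ∃ g : SmoothFun I X G, ∀ ψ : G →L[ℝ] ℝ, dual ψ g = diff (dual ψ f) Z := by
  have hex : ∀ e ∈ IsManifold.maximalAtlas I ∞ X, ∃ df : E × E → G,
      (∀ y ∈ interior (e.extend I).target, ∀ v,
        HasDirDeriv (f ∘ (e.extend I).symm) y v (df (y, v))) ∧
      BastianiSmooth ((e.extend I).target ×ˢ (univ : Set E)) df := fun e he =>
    BastianiSmooth.exists_dir (goodSet_target I e) (f.2 e he)
  choose! d hd hds using hex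
  have hch : ∀ x : X, chartAt H x ∈ IsManifold.maximalAtlas I ∞ X := fun x =>
    IsManifold.chart_mem_maximalAtlas x
  let g : X → G := fun x => d (chartAt H x)
    ((chartAt H x).extend I x, mfderiv I 𝓘(ℝ, E) ((chartAt H x).extend I) x (Z x))
  have hψ : ∀ e ∈ IsManifold.maximalAtlas I ∞ X, ∀ x ∈ e.source, ∀ ψ : G →L[ℝ] ℝ,
      ψ (d e (e.extend I x, mfderiv I 𝓘(ℝ, E) (e.extend I) x (Z x))) = diff (dual ψ f) Z x :=
    fun e he x hx ψ => dual_dir he f (hd e he) (hds e he 0) ψ hx (Z x)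
  have hg : ∀ e ∈ IsManifold.maximalAtlas I ∞ X, ∀ x ∈ e.source,
      g x = d e (e.extend I x, mfderiv I 𝓘(ℝ, E) (e.extend I) x (Z x)) := fun e he x hx =>
    eq_of_dual fun ψ => (hψ _ (hch x) x (mem_chart_source H x) ψ).trans (hψ e he x hx ψ).symm
  refine ⟨⟨g, fun e he k => ?_⟩, fun ψ => ?_⟩
  · have hs := goodSet_target I e
    let ζ : X → E := fun x => mfderiv I 𝓘(ℝ, E) (e.extend I) x (Z x)
    have hζ' : ContMDiffOn I 𝓘(ℝ, E) ∞ ζ e.source := contMDiffOn_mfderiv_extend he Z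
    have hζ : ContDiffOn ℝ ∞ (ζ ∘ (e.extend I).symm) (e.extend I).target := by
      rw [← contMDiffOn_iff_contDiffOn]
      refine hζ'.comp (t := e.source) ?_ fun y hy => ?_
      · rw [e.extend_target']
        exact contMDiffOn_extend_symm he
      · have := (e.extend I).map_target hy
        rwa [e.extend_source] at this
    refine (BastianiC.comp hs.prod (hds e he k) hs (contDiffOn_id.prodMk hζ) fun y hy =>
      ⟨hy, mem_univ _⟩).mono subset_rfl fun y hy => ?_
    have hy' := (e.extend I).map_target hy
    rw [e.extend_source] at hy'
    simp only [Function.comp_apply]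
    rw [hg e he _ hy', (e.extend I).right_inv hy]
    rfl
  · ext x
    exact hψ _ (hch x) x (mem_chart_source H x) ψ

/-- The derivative of a `G`-valued smooth map along a vector field. -/
def lie (Z : VField I X) : SmoothFun I X G →ₗ[ℝ] SmoothFun I X G where
  toFun f := (exists_lie Z f).choose
  map_add' f g := ext_dual fun ψ => by
    rw [map_add, (exists_lie Z _).choose_spec, (exists_lie Z _).choose_spec,
      (exists_lie Z _).choose_spec, map_add, ← diffDerivation_apply, map_add]
    rfl
  map_smul' c f := ext_dual fun ψ => by
    rw [RingHom.id_apply, dual_real_smul, (exists_lie Z _).choose_spec,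
      (exists_lie Z _).choose_spec, dual_real_smul, ← diffDerivation_apply, Derivation.map_smul]
    rfl

theorem dual_lie (ψ : G →L[ℝ] ℝ) (Z : VField I X) (f : SmoothFun I X G) :
    dual ψ (lie Z f) = diff (dual ψ f) Z :=
  (exists_lie Z f).choose_spec ψ

theorem lie_smul (Z : VField I X) (a : C^∞⟮I, X; ℝ⟯) (f : SmoothFun I X G) :
    lie Z (a • f) = a • lie Z f + diff a Z • f := by
  refine ext_dual fun ψ => ?_
  rw [dual_lie, map_smul, map_add, map_smul, map_smul, dual_lie, smul_eq_mul,
    ← diffDerivation_apply, Derivation.leibniz, smul_eq_mul, smul_eq_mul, mul_comm (diff a Z)]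
  rfl

end SmoothFun

end Lie

/-! ### Coordinate vector fields -/

section ChartFrame

variable {n : ℕ} {H : Type*} [TopologicalSpace H]
  {I : ModelWithCorners ℝ (EuclideanSpace ℝ (Fin n)) H}
  {X : Type*} [TopologicalSpace X] [ChartedSpace H X] [IsManifold I ∞ X] [T2Space X]
  {G : Type*} [AddCommGroup G] [Module ℝ G] [TopologicalSpace G] [T2Space G]
  [IsTopologicalAddGroup G] [ContinuousSMul ℝ G] [LocallyConvexSpace ℝ G]

namespace GlobalChart

variable (c : GlobalChart I X)

theorem mem_source (x : X) : x ∈ c.chart.source := c.source_eq ▸ mem_univ x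

theorem mfderiv_coord (i : Fin n) (x : X) (v : TangentSpace I x) :
    mfderiv I 𝓘(ℝ, ℝ) (c.coord i) x v =
      (show EuclideanSpace ℝ (Fin n) from
        mfderiv I 𝓘(ℝ, EuclideanSpace ℝ (Fin n)) (c.chart.extend I) x v) i := by
  have h1 := hasMFDerivAt_extend c.mem (c.mem_source x)
  have h2 := ((EuclideanSpace.proj i : EuclideanSpace ℝ (Fin n) →L[ℝ] ℝ).hasMFDerivAt
    (x := c.chart.extend I x)).comp x h1
  exact congrArg (fun L : TangentSpace I x →L[ℝ] ℝ => L v) h2.mfderiv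

/-- The coordinates separate tangent vectors, so they have a dual frame. As there are only `n` of
them, the differential of the chart is bijective and the dual frame must consist of the coordinate
vector fields. -/
theorem exists_frame : ∃ b : Fin n → VField I X,
    (∀ Z, ∑ a, diff (c.coord a) Z • b a = Z) ∧
    ∀ j x, (mfderiv I 𝓘(ℝ, EuclideanSpace ℝ (Fin n)) (c.chart.extend I) x (b j x) :
      EuclideanSpace ℝ (Fin n)) = EuclideanSpace.single j 1 := by
  have hinj : ∀ (x : X) (v : TangentSpace I x),
      (∀ a, mfderiv I 𝓘(ℝ, ℝ) (c.coord a) x v = 0) → v = 0 := by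
    intro x v hv
    refine mfderiv_extend_injective c.mem (c.mem_source x) (PiLp.ext fun i => ?_)
    exact (c.mfderiv_coord i x v).symm.trans (hv i)
  obtain ⟨b, hb⟩ := exists_dual_frame hinj
  refine ⟨b, hb, fun j x => ?_⟩
  let L : EuclideanSpace ℝ (Fin n) →ₗ[ℝ] EuclideanSpace ℝ (Fin n) :=
    (mfderiv I 𝓘(ℝ, EuclideanSpace ℝ (Fin n)) (c.chart.extend I) x).toLinearMap
  have hL : Function.Injective L := (injective_iff_map_eq_zero L).2 fun v hv =>
    mfderiv_extend_injective c.mem (c.mem_source x) hv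
  obtain ⟨v, hv⟩ : ∃ v : TangentSpace I x, L v = EuclideanSpace.single j 1 :=
    (LinearMap.injective_iff_surjective.1 hL) (EuclideanSpace.single j 1)
  have h1 : ∀ i, mfderiv I 𝓘(ℝ, ℝ) (c.coord i) x v = (Pi.single j (1 : ℝ) : Fin n → ℝ) i := by
    intro i
    refine (c.mfderiv_coord i x v).trans ?_
    refine (congrArg (fun w : EuclideanSpace ℝ (Fin n) => w i) hv).trans ?_
    simp [Pi.single_apply]
  -- Extending `v` to a vector field and expanding it at `x` leaves only the `j`-th term, since the
  -- coordinate differentials take the values `δ_{aj}` on `v`.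
  have h2 : v = b j x := by
    have h3 := congrArg (fun W : VField I X => W x) (hb (extendVec I x v))
    beta_reduce at h3
    rw [VField.sum_apply, extendVec_self] at h3
    refine h3.symm.trans ?_
    have h4 : ∀ a, diff (c.coord a) (extendVec I x v) x = (Pi.single j (1 : ℝ) : Fin n → ℝ) a := by
      intro a
      rw [diff_apply, extendVec_self]
      exact h1 a
    rw [Finset.sum_eq_single j]
    · rw [VField.smul_apply, h4, Pi.single_eq_same, one_smul]
    · intro a _ ha
      rw [VField.smul_apply, h4, Pi.single_eq_of_ne ha, zero_smul]
    · simp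
  rw [← h2]
  exact hv

/-- The coordinate vector fields. -/
def vec : Fin n → VField I X := c.exists_frame.choose

theorem expand (Z : VField I X) : ∑ a, diff (c.coord a) Z • c.vec a = Z :=
  c.exists_frame.choose_spec.1 Z

theorem mfderiv_vec (j : Fin n) (x : X) :
    (mfderiv I 𝓘(ℝ, EuclideanSpace ℝ (Fin n)) (c.chart.extend I) x (c.vec j x) :
      EuclideanSpace ℝ (Fin n)) = EuclideanSpace.single j 1 :=
  c.exists_frame.choose_spec.2 j x

/-- The coordinates and the coordinate vector fields. -/
def frame : DualFrame I X (Fin n) := ⟨c.coord, c.vec, c.expand⟩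

theorem partialDeriv_eq_lie (j : Fin n) (f : SmoothFun I X G) :
    c.partialDeriv (EuclideanSpace.single j 1) f = SmoothFun.lie (c.vec j) f := by
  refine SmoothFun.ext_dual fun ψ => ?_
  rw [SmoothFun.dual_lie]
  ext x
  rw [diff_apply, SmoothFun.dual_apply]
  have := SmoothFun.dual_dir c.mem f (c.dirDeriv_spec f).1 ((c.dirDeriv_spec f).2 0) ψ
    (c.mem_source x) (c.vec j x)
  rw [← this, c.mfderiv_vec]
  rfl

theorem diff_diff_coord (i j : Fin n) : diff (diff (c.coord i) (c.vec j)) = 0 := by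
  have h : diff (c.coord i) (c.vec j) =
      (Pi.single j (1 : ℝ) : Fin n → ℝ) i • (1 : C^∞⟮I, X; ℝ⟯) := by
    ext x
    rw [diff_apply]
    refine (c.mfderiv_coord i x _).trans ?_
    rw [c.mfderiv_vec]
    change _ = _ * (1 : ℝ)
    simp [Pi.single_apply]
  rw [h, ← diffDerivation_apply, Derivation.map_smul, Derivation.map_one_eq_zero, smul_zero]

/-- In the chart this is the symmetry of the second derivative within the target. It holds at
boundary points as well because the target lies in the closure of its interior. -/
theorem diff_comm (g : C^∞⟮I, X; ℝ⟯) (i j : Fin n) :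
    diff (diff g (c.vec i)) (c.vec j) = diff (diff g (c.vec j)) (c.vec i) := by
  set s := (c.chart.extend I).target
  have hs : GoodSet s := goodSet_target I c.chart
  let e : Fin n → EuclideanSpace ℝ (Fin n) := fun i => EuclideanSpace.single i 1
  have hcd : ∀ g : C^∞⟮I, X; ℝ⟯, ContDiffOn ℝ ∞ (g ∘ (c.chart.extend I).symm) s := fun g =>
    contDiffOn_chart g.contMDiff c.mem
  have h1 : ∀ (g : C^∞⟮I, X; ℝ⟯) i x, diff g (c.vec i) x =
      fderivWithin ℝ (g ∘ (c.chart.extend I).symm) s (c.chart.extend I x) (e i) := by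
    intro g i x
    rw [diff_apply, mfderiv_eq_fderivWithin_chart c.mem (c.mem_source x)
      ((hcd g).differentiableOn (by simp) _ (c.map_mem x)), c.mfderiv_vec]
  have h2 : ∀ i j x, diff (diff g (c.vec i)) (c.vec j) x = fderivWithin ℝ
      (fderivWithin ℝ (g ∘ (c.chart.extend I).symm) s) s (c.chart.extend I x) (e j) (e i) := by
    intro i j x
    have hx := c.map_mem x
    have h3 : EqOn (diff g (c.vec i) ∘ (c.chart.extend I).symm)
        (fun y => fderivWithin ℝ (g ∘ (c.chart.extend I).symm) s y (e i)) s := by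
      intro y hy
      simp only [Function.comp_apply, h1]
      rw [(c.chart.extend I).right_inv hy]
    have h4 : DifferentiableWithinAt ℝ (fderivWithin ℝ (g ∘ (c.chart.extend I).symm) s) s
        (c.chart.extend I x) :=
      ((hcd g).fderivWithin (m := ∞) hs.uniqueDiffOn (by simp)).differentiableOn (by simp) _ hx
    rw [h1, fderivWithin_congr h3 (h3 hx)]
    have h5 := (h4.hasFDerivWithinAt.clm_apply (hasFDerivWithinAt_const (e i) _ s)).fderivWithin
      (hs.uniqueDiffOn _ hx)
    rw [h5]
    simp
  ext x
  rw [h2, h2]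
  have hx := c.map_mem x
  refine ContDiffWithinAt.isSymmSndFDerivWithinAt (n := ∞) ((hcd g) _ hx) ?_ hs.uniqueDiffOn
    (hs.subset_closure hx) hx _ _
  simp only [minSmoothness_of_isRCLikeNormedField]
  exact WithTop.coe_le_coe.2 (le_top : (2 : ℕ∞) ≤ ⊤)

end GlobalChart

end ChartFrame

/-! ### Products of differentials and their pullbacks -/

section DiffForm

variable {E : Type u} [NormedAddCommGroup E] [NormedSpace ℝ E] {H : Type*} [TopologicalSpace H]
  {I : ModelWithCorners ℝ E H} {X : Type*} [TopologicalSpace X] [ChartedSpace H X]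
  [IsManifold I ∞ X]
  {E' : Type u} [NormedAddCommGroup E'] [NormedSpace ℝ E'] {H' : Type*} [TopologicalSpace H']
  {J : ModelWithCorners ℝ E' H'} {Y : Type*} [TopologicalSpace Y] [ChartedSpace H' Y]
  [IsManifold J ∞ Y]

/-- The form `dφ₁ ∧ … ∧ dφ_k`. -/
def diffForm {k : ℕ} (φ : Fin k → C^∞⟮I, X; ℝ⟯) : Form I X k := detForm k fun i => diff (φ i)

theorem consForm_diffForm {k : ℕ} (g : C^∞⟮I, X; ℝ⟯) (φ : Fin k → C^∞⟮I, X; ℝ⟯) :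
    consForm k (diff g) (diffForm φ) = diffForm (Fin.append (fun _ : Fin 1 => g) φ) := by
  refine (consForm_detForm _ _).trans (congrArg (detForm (1 + k)) ?_)
  funext i
  refine Fin.addCases (fun i => ?_) (fun i => ?_) i <;> simp

theorem wedge_diffForm {k l : ℕ} (φ : Fin k → C^∞⟮I, X; ℝ⟯) (φ' : Fin l → C^∞⟮I, X; ℝ⟯) :
    Form.wedge k l (diffForm φ) (diffForm φ') = diffForm (Fin.append φ φ') := by
  refine (altWedge_detForm _ _).trans (congrArg (detForm (k + l)) ?_)
  funext i
  refine Fin.addCases (fun i => ?_) (fun i => ?_) i <;> simp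

theorem diffForm_apply {k : ℕ} (φ : Fin k → C^∞⟮I, X; ℝ⟯) (Z : Fin k → VField I X) (x : X) :
    diffForm φ Z x = ∑ σ : Equiv.Perm (Fin k),
      Equiv.Perm.sign σ • ∏ i, diff (φ i) (Z (σ i)) x := by
  let ev : C^∞⟮I, X; ℝ⟯ →+* ℝ :=
    ⟨⟨⟨fun g => g x, rfl⟩, fun _ _ => rfl⟩, rfl, fun _ _ => rfl⟩
  change ev (detForm k _ Z) = _
  rw [detForm_apply, map_sum]
  refine Finset.sum_congr rfl fun σ _ => ?_
  rw [Units.smul_def, map_zsmul, map_prod]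
  rfl

variable [FiniteDimensional ℝ E'] [T2Space Y]

theorem diff_comp (F : C^∞⟮I, X; J, Y⟯) (g : C^∞⟮J, Y; ℝ⟯) (Z : VField I X) (x : X) :
    diff (g.comp F) Z x = mfderiv J 𝓘(ℝ, ℝ) g (F x) (mfderiv I J F x (Z x)) := by
  have h := mfderiv_comp x (g.contMDiff.mdifferentiableAt (by simp))
    (F.contMDiff.mdifferentiableAt (by simp))
  exact congrArg (fun L : TangentSpace I x →L[ℝ] ℝ => L (Z x)) h

theorem Form.pull_diffForm (F : C^∞⟮I, X; J, Y⟯) {k : ℕ} (φ : Fin k → C^∞⟮J, Y; ℝ⟯) :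
    Form.pull F k (diffForm φ) = diffForm fun i => (φ i).comp F := by
  ext Z x
  refine (diffForm_apply φ _ (F x)).trans (Eq.trans ?_ (diffForm_apply _ Z x).symm)
  refine Finset.sum_congr rfl fun σ _ => congrArg _ (Finset.prod_congr rfl fun i _ => ?_)
  rw [diff_comp, diff_apply, extendVec_self]

end DiffForm

/-! ### Restriction to chart domains -/

section Locality

variable {n : ℕ} {H : Type*} [TopologicalSpace H]
  {I : ModelWithCorners ℝ (EuclideanSpace ℝ (Fin n)) H}
  {X : Type*} [TopologicalSpace X] [ChartedSpace H X] [IsManifold I ∞ X]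

variable (I) in
theorem exists_mem_globalChart (p : X) :
    ∃ V : TopologicalSpace.Opens X, p ∈ V ∧ Nonempty (GlobalChart I V) := by
  let V : TopologicalSpace.Opens X := ⟨(chartAt H p).source, (chartAt H p).open_source⟩
  have hp : p ∈ V := mem_chart_source H p
  refine ⟨V, hp, ⟨⟨chartAt H (⟨p, hp⟩ : V), IsManifold.chart_mem_maximalAtlas _, ?_⟩⟩⟩
  refine (OpenPartialHomeomorph.subtypeRestr_source _ _).trans ?_
  exact eq_univ_of_forall fun x => x.2

/-- The map `r` is a local section of the inclusion, smooth near `p`, and the chain rule gives a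
right inverse of the differential. -/
theorem mfderiv_incl_surjective (V : TopologicalSpace.Opens X) (p : V) :
    Function.Surjective (mfderiv I I (incl I V) p) := by
  classical
  let r : X → V := fun x => if h : x ∈ V then ⟨x, h⟩ else p
  have hr : (Subtype.val ∘ r) =ᶠ[𝓝 (p : X)] id := by
    filter_upwards [V.isOpen.mem_nhds p.2] with x hx
    have hx : x ∈ V := hx
    simp [r, hx]
  have hrp : r p = p := by simp [r]
  have h1 : ContMDiffAt I I ∞ r (p : X) := by
    rw [← ContMDiffAt.subtypeVal_comp_iff]
    exact contMDiffAt_id.congr_of_eventuallyEq hr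
  have h2 := h1.mdifferentiableAt (by simp)
  have h3 : MDifferentiableAt I I (incl I V) (r p) :=
    (incl I V).contMDiff.mdifferentiableAt (by simp)
  have h4 := mfderiv_comp (p : X) h3 h2
  have h5 : mfderiv I I ((incl I V) ∘ r) (p : X) = ContinuousLinearMap.id ℝ _ :=
    (Filter.EventuallyEq.mfderiv_eq hr).trans (mfderiv_id)
  have h6 : Function.Surjective (mfderiv I I (incl I V) (r p)) := fun v =>
    ⟨mfderiv I I r (p : X) v,
      (congrArg (fun L : EuclideanSpace ℝ (Fin n) →L[ℝ] EuclideanSpace ℝ (Fin n) => L v)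
        (h4.symm.trans h5))⟩
  rwa [hrp] at h6

variable [T2Space X]

/-- The value of a form at a point depends only on the vectors there, and all of them come from the
tangent space of the chart domain. -/
theorem Form.ext_local {k : ℕ} {α β : Form I X k}
    (h : ∀ V : TopologicalSpace.Opens X, Nonempty (GlobalChart I V) →
      Form.pull (incl I V) k α = Form.pull (incl I V) k β) : α = β := by
  ext W p
  obtain ⟨V, hp, hV⟩ := exists_mem_globalChart I p
  choose v hv using fun i => mfderiv_incl_surjective (I := I) V ⟨p, hp⟩ (W i p)
  have key : ∀ α : Form I X k,
      Form.pull (incl I V) k α (fun i => extendVec I ⟨p, hp⟩ (v i)) ⟨p, hp⟩ = α W p := by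
    intro α
    refine Eq.trans ?_ (Form.atPt_apply α W p)
    change α.atPt p _ = α.atPt p _
    congr 1
    funext i
    rw [extendVec_self]
    exact hv i
  rw [← key α, ← key β, h V hV]

/-- This is what makes the exterior derivative independent of presentations: the relation is
restricted to each chart domain, where the coordinate frame satisfies the hypotheses of
`sum_consForm_congr_zero`. -/
theorem sum_diffForm_congr_zero {k : ℕ} {κ : Type*} (s : Finset κ) (g : κ → C^∞⟮I, X; ℝ⟯)
    (φ : κ → Fin k → C^∞⟮I, X; ℝ⟯) (h0 : ∑ t ∈ s, g t • diffForm (φ t) = 0) :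
    ∑ t ∈ s, diffForm (Fin.append (fun _ : Fin 1 => g t) (φ t)) = 0 := by
  refine Form.ext_local fun V ⟨c⟩ => ?_
  have h1 := congrArg (Form.pull (incl I V) k) h0
  rw [map_zero, map_sum] at h1
  simp only [Form.pull_smul, Form.pull_diffForm] at h1
  have h2 := sum_consForm_congr_zero (δ := diffDerivation I V) (x := c.coord) (b := c.vec)
    c.expand c.diff_diff_coord c.diff_comm s (fun t => (g t).comp (incl I V))
    (fun t i => (φ t i).comp (incl I V)) h1
  rw [map_zero, map_sum]
  refine Eq.trans (Finset.sum_congr rfl fun t _ => ?_) h2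
  rw [Form.pull_diffForm]
  refine Eq.trans (congrArg diffForm ?_) (consForm_diffForm _ _).symm
  funext i
  refine Fin.addCases (fun i => ?_) (fun i => ?_) i <;> simp

end Locality

/-! ### Coefficients and the exterior derivative in a frame -/

section Dual

variable {E : Type u} [NormedAddCommGroup E] [NormedSpace ℝ E] [FiniteDimensional ℝ E]
  {H : Type*} [TopologicalSpace H]
  {I : ModelWithCorners ℝ E H} {X : Type*} [TopologicalSpace X] [ChartedSpace H X]
  [IsManifold I ∞ X]
  {G : Type*} [AddCommGroup G] [Module ℝ G] [TopologicalSpace G] [T2Space G]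
  [IsTopologicalAddGroup G] [ContinuousSMul ℝ G] [LocallyConvexSpace ℝ G]

/-- The scalar form `ψ ∘ f • α` for `f ⊗ α`. -/
def TForm.dual (ψ : G →L[ℝ] ℝ) (k : ℕ) : TForm I X G k →ₗ[C^∞⟮I, X; ℝ⟯] Form I X k :=
  TForm.toScalar k ∘ₗ TForm.push ψ k

theorem TForm.dual_tmul (ψ : G →L[ℝ] ℝ) {k : ℕ} (f : SmoothFun I X G) (α : Form I X k) :
    TForm.dual ψ k (f ⊗ₜ α) = SmoothFun.dual ψ f • α := rfl

theorem SmoothFun.dual_tensorEval (ψ : G →L[ℝ] ℝ) {k : ℕ} (Z : Fin k → VField I X)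
    (θ : TForm I X G k) :
    SmoothFun.dual ψ (tensorEval Z θ) = TForm.dual ψ k θ Z := by
  induction θ using TensorProduct.induction_on with
  | zero => rw [map_zero, map_zero, map_zero]; rfl
  | add x y hx hy => rw [map_add, map_add, map_add, hx, hy]; rfl
  | tmul f α =>
    rw [tensorEval_tmul, TForm.dual_tmul, map_smul, AlternatingMap.smul_apply, smul_eq_mul,
      smul_eq_mul, mul_comm]

namespace DualFrame

variable {ι : Type} [Fintype ι] (e : DualFrame I X ι)

/-- The coefficients of a form in a frame. -/
def coeff {k : ℕ} (r : Fin k → ι) : TForm I X G k →+ SmoothFun I X G where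
  toFun θ := (k.factorial : ℝ)⁻¹ • tensorEval (e.vec ∘ r) θ
  map_zero' := by rw [map_zero, smul_zero]
  map_add' θ η := by rw [map_add, smul_add]

/-- `tensor_expand` divided by `k!`, which is invertible because the ring of functions is a real
algebra. -/
theorem sum_coeff {k : ℕ} (θ : TForm I X G k) :
    ∑ r : Fin k → ι, e.coeff r θ ⊗ₜ diffForm (fun i => e.fn (r i)) = θ := by
  set c : C^∞⟮I, X; ℝ⟯ := algebraMap ℝ C^∞⟮I, X; ℝ⟯ (k.factorial : ℝ)⁻¹ with hc
  have h1 : c • (k.factorial : C^∞⟮I, X; ℝ⟯) • θ = θ := by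
    rw [smul_smul, hc, ← map_natCast (algebraMap ℝ C^∞⟮I, X; ℝ⟯), ← map_mul,
      inv_mul_cancel₀ (Nat.cast_ne_zero.2 k.factorial_ne_zero), map_one, one_smul]
  have h2 := congrArg (fun θ : TForm I X G k => c • θ) (tensor_expand e.expand θ)
  refine Eq.trans ?_ (h2.symm.trans h1)
  rw [Finset.smul_sum]
  refine Finset.sum_congr rfl fun r _ => ?_
  rw [TensorProduct.smul_tmul', hc, algebraMap_smul]
  rfl

theorem tform_induction {k : ℕ} {p : TForm I X G k → Prop} (h0 : p 0)
    (hadd : ∀ θ η, p θ → p η → p (θ + η))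
    (h : ∀ (f : SmoothFun I X G) (r : Fin k → ι), p (f ⊗ₜ diffForm fun i => e.fn (r i)))
    (θ : TForm I X G k) : p θ := by
  rw [← e.sum_coeff θ]
  exact Finset.sum_induction _ p hadd h0 fun r _ => h _ r

/-- A form is recovered from its coefficients, which are `G`-valued maps and hence determined by
functionals. A functional of a coefficient is a value of the associated scalar form. -/
theorem ext_dual (e : DualFrame I X ι) {k : ℕ} {θ η : TForm I X G k}
    (h : ∀ ψ : G →L[ℝ] ℝ, TForm.dual ψ k θ = TForm.dual ψ k η) : θ = η := by
  rw [← e.sum_coeff θ, ← e.sum_coeff η]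
  refine Finset.sum_congr rfl fun r _ => congrArg (· ⊗ₜ _) ?_
  refine congrArg (fun f : SmoothFun I X G => (k.factorial : ℝ)⁻¹ • f)
    (SmoothFun.ext_dual fun ψ => ?_)
  rw [SmoothFun.dual_tensorEval, SmoothFun.dual_tensorEval, h]

/-- The expansion `dg = ∑ dg(Y_a) dφ_a`, multiplied by a product of differentials. -/
theorem sum_smul_diffForm {k : ℕ} (g : C^∞⟮I, X; ℝ⟯) (φ : Fin k → C^∞⟮I, X; ℝ⟯) :
    ∑ a, diff g (e.vec a) • diffForm (Fin.append (fun _ : Fin 1 => e.fn a) φ) =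
      diffForm (Fin.append (fun _ : Fin 1 => g) φ) := by
  have h := derivation_expand (δ := diffDerivation I X) e.expand g
  simp only [diffDerivation_apply] at h
  rw [← consForm_diffForm]
  conv_rhs => rw [h, map_sum, LinearMap.sum_apply]
  refine Finset.sum_congr rfl fun a _ => ?_
  rw [map_smul, LinearMap.smul_apply, consForm_diffForm]

/-- The exterior derivative in a frame. -/
def extDeriv (k : ℕ) : TForm I X G k →+ TForm I X G (1 + k) where
  toFun θ := ∑ r : Fin k → ι, ∑ a, SmoothFun.lie (e.vec a) (e.coeff r θ) ⊗ₜ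
    diffForm (Fin.append (fun _ : Fin 1 => e.fn a) fun i => e.fn (r i))
  map_zero' := by simp
  map_add' θ η := by simp [TensorProduct.add_tmul, Finset.sum_add_distrib]

theorem dual_extDeriv (ψ : G →L[ℝ] ℝ) {k : ℕ} (θ : TForm I X G k) :
    TForm.dual ψ (1 + k) (e.extDeriv k θ) = ∑ r : Fin k → ι,
      diffForm (Fin.append (fun _ : Fin 1 => SmoothFun.dual ψ (e.coeff r θ))
        fun i => e.fn (r i)) := by
  change TForm.dual ψ (1 + k) (∑ r : Fin k → ι, ∑ a, _) = _
  rw [map_sum]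
  refine Finset.sum_congr rfl fun r _ => ?_
  rw [map_sum, ← e.sum_smul_diffForm]
  refine Finset.sum_congr rfl fun a _ => ?_
  rw [TForm.dual_tmul, SmoothFun.dual_lie]

end DualFrame

end Dual

/-! ### Independence of the frame, square zero, naturality -/

section ExtDeriv

variable {n : ℕ} {H : Type*} [TopologicalSpace H]
  {I : ModelWithCorners ℝ (EuclideanSpace ℝ (Fin n)) H}
  {X : Type*} [TopologicalSpace X] [ChartedSpace H X] [IsManifold I ∞ X] [T2Space X]
  {G : Type*} [AddCommGroup G] [Module ℝ G] [TopologicalSpace G] [T2Space G]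
  [IsTopologicalAddGroup G] [ContinuousSMul ℝ G] [LocallyConvexSpace ℝ G]

theorem sum_diffForm_congr {k : ℕ} {κ : Type*} (s : Finset κ) (g : κ → C^∞⟮I, X; ℝ⟯)
    (φ : κ → Fin k → C^∞⟮I, X; ℝ⟯) {g' : C^∞⟮I, X; ℝ⟯} {φ' : Fin k → C^∞⟮I, X; ℝ⟯}
    (h : ∑ t ∈ s, g t • diffForm (φ t) = g' • diffForm φ') :
    ∑ t ∈ s, diffForm (Fin.append (fun _ : Fin 1 => g t) (φ t)) =
      diffForm (Fin.append (fun _ : Fin 1 => g') φ') := by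
  -- The right-hand side is moved to the left as one additional term with coefficient `-g'`.
  have h1 := sum_diffForm_congr_zero (Finset.insertNone s) (fun t => t.elim (-g') g)
    (fun t => t.elim φ' φ) (by
      rw [Finset.sum_insertNone]
      simp only [Option.elim, h]
      exact (congrArg (· + g' • diffForm φ') (neg_smul g' (diffForm φ'))).trans
        (neg_add_cancel _))
  rw [Finset.sum_insertNone] at h1
  simp only [Option.elim] at h1
  have h2 : diffForm (Fin.append (fun _ : Fin 1 => -g') φ') =
      -diffForm (Fin.append (fun _ : Fin 1 => g') φ') := by
    rw [← consForm_diffForm, ← consForm_diffForm, ← diffDerivation_apply, ← diffDerivation_apply,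
      map_neg, map_neg, LinearMap.neg_apply]
  rw [h2, neg_add_eq_zero] at h1
  exact h1.symm

namespace DualFrame

variable {ι : Type} [Fintype ι] (e : DualFrame I X ι)

/-- The derivative in the frame corresponds to the presentation of the scalar form by the `e.fn`; by
`sum_diffForm_congr` the presentation `g dφ` has the same derivative. The right-hand side no longer
mentions the frame. -/
theorem dual_extDeriv_eq (ψ : G →L[ℝ] ℝ) {k : ℕ} {θ : TForm I X G k} {g : C^∞⟮I, X; ℝ⟯}
    {φ : Fin k → C^∞⟮I, X; ℝ⟯} (h : TForm.dual ψ k θ = g • diffForm φ) :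
    TForm.dual ψ (1 + k) (e.extDeriv k θ) = diffForm (Fin.append (fun _ : Fin 1 => g) φ) := by
  rw [dual_extDeriv]
  refine sum_diffForm_congr _ _ _ ?_
  rw [← h]
  conv_rhs => rw [← e.sum_coeff θ, map_sum]
  rfl

/-- Both sides have the same image `d(ψ ∘ f) ∧ dφ` under every functional `ψ`. With `e'` a
coordinate frame this becomes the formula in the chart. -/
theorem extDeriv_tmul {ι' : Type} [Fintype ι'] (e' : DualFrame I X ι') {k : ℕ}
    (f : SmoothFun I X G) (φ : Fin k → C^∞⟮I, X; ℝ⟯) :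
    e.extDeriv k (f ⊗ₜ diffForm φ) = ∑ a, SmoothFun.lie (e'.vec a) f ⊗ₜ
      diffForm (Fin.append (fun _ : Fin 1 => e'.fn a) φ) := by
  refine e.ext_dual fun ψ => ?_
  rw [e.dual_extDeriv_eq ψ (TForm.dual_tmul ψ f _), map_sum, ← e'.sum_smul_diffForm]
  refine Finset.sum_congr rfl fun a _ => ?_
  rw [TForm.dual_tmul, SmoothFun.dual_lie]

theorem extDeriv_extDeriv {k : ℕ} (θ : TForm I X G k) :
    e.extDeriv (1 + k) (e.extDeriv k θ) = 0 := by
  refine e.tform_induction (p := fun θ => e.extDeriv (1 + k) (e.extDeriv k θ) = 0) ?_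
    (fun θ η h h' => ?_) (fun f r => e.ext_dual fun ψ => ?_) θ
  · rw [map_zero, map_zero]
  · rw [map_add, map_add, h, h', add_zero]
  -- The scalar form of the first derivative is a product of differentials with coefficient `1`, so
  -- differentiating again puts `d1 = 0` in front.
  · rw [e.dual_extDeriv_eq ψ (g := 1) ((e.dual_extDeriv_eq ψ (TForm.dual_tmul ψ f _)).trans
      (one_smul _ _).symm), ← consForm_diffForm, ← diffDerivation_apply,
      Derivation.map_one_eq_zero, map_zero, map_zero]
    rfl

end DualFrame

variable {m : ℕ} {H' : Type*} [TopologicalSpace H']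
  {J : ModelWithCorners ℝ (EuclideanSpace ℝ (Fin m)) H'}
  {Y : Type*} [TopologicalSpace Y] [ChartedSpace H' Y] [IsManifold J ∞ Y] [T2Space Y]

theorem TForm.dual_pull (ψ : G →L[ℝ] ℝ) (F : C^∞⟮I, X; J, Y⟯) {k : ℕ} (θ : TForm J Y G k) :
    TForm.dual ψ k (TForm.pull F k θ) = Form.pull F k (TForm.dual ψ k θ) := by
  induction θ using TensorProduct.induction_on with
  | zero => rw [map_zero, map_zero, map_zero, map_zero]
  | add x y hx hy => rw [map_add, map_add, map_add, map_add, hx, hy]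
  | tmul f α =>
    rw [TForm.dual_tmul, Form.pull_smul]
    rfl

theorem TForm.ext_local {ι : Type} [Fintype ι] (e : DualFrame I X ι) {k : ℕ} {θ η : TForm I X G k}
    (h : ∀ V : TopologicalSpace.Opens X, Nonempty (GlobalChart I V) →
      TForm.pull (incl I V) k θ = TForm.pull (incl I V) k η) : θ = η := by
  refine e.ext_dual fun ψ => Form.ext_local fun V hV => ?_
  rw [← TForm.dual_pull, ← TForm.dual_pull, h V hV]

/-- Under a functional, both sides become `d(ψ ∘ f ∘ F)` times the differentials of the functions
composed with `F`. The frames on the two manifolds need not be related. -/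
theorem TForm.pull_extDeriv {ι ι' : Type} [Fintype ι] [Fintype ι'] (e : DualFrame I X ι)
    (e' : DualFrame J Y ι') (F : C^∞⟮I, X; J, Y⟯) {k : ℕ} (θ : TForm J Y G k) :
    e.extDeriv k (TForm.pull F k θ) = TForm.pull F (1 + k) (e'.extDeriv k θ) := by
  refine e'.tform_induction (p := fun θ => e.extDeriv k (TForm.pull F k θ) =
    TForm.pull F (1 + k) (e'.extDeriv k θ)) ?_
    (fun θ η h h' => ?_) (fun f r => e.ext_dual fun ψ => ?_) θ
  · simp only [map_zero]
  · simp only [map_add, h, h']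
  · have h1 : TForm.dual ψ k (TForm.pull F k (f ⊗ₜ diffForm fun i => e'.fn (r i))) =
        (SmoothFun.dual ψ f).comp F • diffForm fun i => (e'.fn (r i)).comp F := by
      rw [TForm.dual_pull, TForm.dual_tmul, Form.pull_smul, Form.pull_diffForm]
    rw [TForm.dual_pull, e.dual_extDeriv_eq ψ h1,
      e'.dual_extDeriv_eq ψ (TForm.dual_tmul ψ f _), Form.pull_diffForm]
    congr 1
    funext i
    refine Fin.addCases (fun i => ?_) (fun i => ?_) i <;> simp

end ExtDeriv

/-! ### The exterior derivative on forms of all degrees -/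

section Global

variable {n : ℕ} {H : Type*} [TopologicalSpace H]
  {I : ModelWithCorners ℝ (EuclideanSpace ℝ (Fin n)) H}
  {X : Type*} [TopologicalSpace X] [ChartedSpace H X] [IsManifold I ∞ X] [T2Space X]
  {G : Type*} [AddCommGroup G] [Module ℝ G] [TopologicalSpace G] [T2Space G]
  [IsTopologicalAddGroup G] [ContinuousSMul ℝ G] [LocallyConvexSpace ℝ G]
  {m : ℕ} {H' : Type*} [TopologicalSpace H']
  {J : ModelWithCorners ℝ (EuclideanSpace ℝ (Fin m)) H'}
  {Y : Type*} [TopologicalSpace Y] [ChartedSpace H' Y] [IsManifold J ∞ Y] [T2Space Y]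

theorem GForms.pull_of (F : C^∞⟮I, X; J, Y⟯) {k : ℕ} (θ : TForm J Y G k) :
    GForms.pull F (DirectSum.of (TForm J Y G) k θ) =
      DirectSum.of (TForm I X G) k (TForm.pull F k θ) :=
  DirectSum.map_of (fun k => TForm.pull F k) k θ

theorem GForms.wedge_of {k l : ℕ} (α : Form I X k) (θ : TForm I X G l) :
    GForms.wedge (DirectSum.of (Form I X) k α) (DirectSum.of (TForm I X G) l θ) =
      DirectSum.of (TForm I X G) (k + l) (TForm.wedge k l α θ) := by
  have h1 := DirectSum.toModule_lof C^∞⟮I, X; ℝ⟯ (M := Form I X)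
    (φ := fun k => LinearMap.flip <| DirectSum.toModule C^∞⟮I, X; ℝ⟯ ℕ _ fun l =>
    ((TForm.wedge k l).compr₂ (DirectSum.lof _ ℕ (TForm I X G) (k + l))).flip) k α
  refine (congrArg (fun L : GForms I X G →ₗ[C^∞⟮I, X; ℝ⟯] GForms I X G =>
    L (DirectSum.of (TForm I X G) l θ)) h1).trans ?_
  exact congrArg (fun L : Form I X k →ₗ[C^∞⟮I, X; ℝ⟯] GForms I X G => L α)
    (DirectSum.toModule_lof C^∞⟮I, X; ℝ⟯ (M := TForm I X G) (φ := fun l =>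
    ((TForm.wedge k l).compr₂ (DirectSum.lof _ ℕ (TForm I X G) (k + l))).flip) l θ)

theorem GForms.ext_local {ι : Type} [Fintype ι] (e : DualFrame I X ι) {θ η : GForms I X G}
    (h : ∀ V : TopologicalSpace.Opens X, Nonempty (GlobalChart I V) →
      GForms.pull (incl I V) θ = GForms.pull (incl I V) η) : θ = η := by
  refine DFinsupp.ext fun k => TForm.ext_local e fun V hV => ?_
  have := congrArg (fun ζ : GForms I V G => ζ k) (h V hV)
  exact this

theorem TForm.dual_const_tmul {k : ℕ} (α : Form I X k) :
    TForm.dual (ContinuousLinearMap.id ℝ ℝ) k (SmoothFun.const I X (1 : ℝ) ⊗ₜ α) = α := by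
  have h : SmoothFun.dual (ContinuousLinearMap.id ℝ ℝ) (SmoothFun.const I X (1 : ℝ)) = 1 := rfl
  rw [TForm.dual_tmul, h, one_smul]

namespace DualFrame

variable {ι : Type} [Fintype ι] (e : DualFrame I X ι)

theorem gforms_induction {p : GForms I X G → Prop} (h0 : p 0)
    (hadd : ∀ θ η, p θ → p η → p (θ + η))
    (h : ∀ (k : ℕ) (f : SmoothFun I X G) (r : Fin k → ι),
      p (DirectSum.of (TForm I X G) k (f ⊗ₜ diffForm fun i => e.fn (r i))))
    (θ : GForms I X G) : p θ := by
  induction θ using DirectSum.induction_on with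
  | zero => exact h0
  | of k θ =>
    refine e.tform_induction (p := fun θ => p (DirectSum.of (TForm I X G) k θ)) ?_
      (fun θ η h h' => ?_) (h k) θ
    · rw [map_zero]; exact h0
    · rw [map_add]; exact hadd _ _ h h'
  | add θ η h h' => exact hadd _ _ h h'

/-- Scalar forms are the images of real-valued tensors under the identity functional, so the
induction principle for tensors applies. -/
theorem form_induction {k : ℕ} {p : Form I X k → Prop} (h0 : p 0)
    (hadd : ∀ α β, p α → p β → p (α + β))
    (h : ∀ (g : C^∞⟮I, X; ℝ⟯) (r : Fin k → ι), p (g • diffForm fun i => e.fn (r i)))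
    (α : Form I X k) : p α := by
  have h1 : TForm.dual (ContinuousLinearMap.id ℝ ℝ) k
      ((SmoothFun.const I X (1 : ℝ)) ⊗ₜ α) = α := TForm.dual_const_tmul α
  rw [← h1]
  refine e.tform_induction (p := fun θ =>
    p (TForm.dual (ContinuousLinearMap.id ℝ ℝ) k θ)) ?_ (fun θ η h h' => ?_) (fun f r => h _ r) _
  · rw [map_zero]; exact h0
  · rw [map_add]; exact hadd _ _ h h'

theorem extDeriv_smul {k : ℕ} (c : ℝ) (θ : TForm I X G k) :
    e.extDeriv k (c • θ) = c • e.extDeriv k θ := by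
  refine e.tform_induction (p := fun θ => e.extDeriv k (c • θ) = c • e.extDeriv k θ) ?_
    (fun θ η h h' => ?_) (fun f r => ?_) θ
  · rw [smul_zero, map_zero, smul_zero]
  · rw [smul_add, map_add, map_add, smul_add, h, h']
  · rw [TensorProduct.smul_tmul', e.extDeriv_tmul e, e.extDeriv_tmul e, Finset.smul_sum]
    exact Finset.sum_congr rfl fun a _ => by rw [map_smul, TensorProduct.smul_tmul']

/-- The exterior derivative on forms of all degrees, in a frame. -/
def extD : GForms I X G →+ GForms I X G :=
  DirectSum.toAddMonoid fun k => (DirectSum.of (TForm I X G) (1 + k)).comp (e.extDeriv k)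

theorem extD_of {k : ℕ} (θ : TForm I X G k) :
    e.extD (DirectSum.of (TForm I X G) k θ) =
      DirectSum.of (TForm I X G) (1 + k) (e.extDeriv k θ) :=
  DirectSum.toAddMonoid_of _ _ _

theorem extD_smul (c : ℝ) (θ : GForms I X G) : e.extD (c • θ) = c • e.extD θ := by
  have hs : ∀ k (θ : TForm I X G k),
      DirectSum.of (TForm I X G) k (c • θ) = c • DirectSum.of (TForm I X G) k θ := fun k θ =>
    map_smul (DirectSum.lof ℝ ℕ (TForm I X G) k) c θ
  induction θ using DirectSum.induction_on with
  | zero => rw [smul_zero, map_zero, smul_zero]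
  | of k θ => rw [← hs, extD_of, extD_of, extDeriv_smul, hs]
  | add θ η h h' => rw [smul_add, map_add, map_add, smul_add, h, h']

theorem extD_extD (θ : GForms I X G) : e.extD (e.extD θ) = 0 := by
  induction θ using DirectSum.induction_on with
  | zero => rw [map_zero, map_zero]
  | of k θ => rw [extD_of, extD_of, extDeriv_extDeriv, map_zero]
  | add θ η h h' => rw [map_add, map_add, h, h', add_zero]

theorem pull_extD {ι' : Type} [Fintype ι'] (e' : DualFrame J Y ι') (F : C^∞⟮I, X; J, Y⟯)
    (θ : GForms J Y G) : e.extD (GForms.pull F θ) = GForms.pull F (e'.extD θ) := by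
  induction θ using DirectSum.induction_on with
  | zero => simp only [map_zero]
  | of k θ => rw [GForms.pull_of, extD_of, extD_of, GForms.pull_of, TForm.pull_extDeriv e e']
  | add θ η h h' => simp only [map_add, h, h']

/-- The scalar exterior derivative in a frame. -/
def scalarD (k : ℕ) (α : Form I X k) : Form I X (1 + k) :=
  TForm.toScalar (1 + k) (e.extDeriv k (TForm.ofScalar k α))

theorem scalarD_smul_diffForm {k : ℕ} (g : C^∞⟮I, X; ℝ⟯) (φ : Fin k → C^∞⟮I, X; ℝ⟯) :
    e.scalarD k (g • diffForm φ) = diffForm (Fin.append (fun _ : Fin 1 => g) φ) := by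
  -- For real coefficients the identification with scalar forms is the test by the identity
  -- functional, so `dual_extDeriv_eq` applies.
  have h1 : ∀ {k : ℕ} (θ : TForm I X ℝ k),
      TForm.toScalar k θ = TForm.dual (ContinuousLinearMap.id ℝ ℝ) k θ := fun {k} θ => by
    change _ = TForm.toScalar k (LinearMap.rTensor _ _ θ)
    rw [show SmoothFun.push (I := I) (X := X) (ContinuousLinearMap.id ℝ ℝ) = LinearMap.id from rfl,
      LinearMap.rTensor_id]
    rfl
  rw [scalarD, h1]
  exact e.dual_extDeriv_eq _ (TForm.dual_const_tmul (g • diffForm φ))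

theorem scalarD_add {k : ℕ} (α β : Form I X k) :
    e.scalarD k (α + β) = e.scalarD k α + e.scalarD k β := by
  simp only [scalarD, map_add]

theorem diffForm_append {k l : ℕ} (φ : Fin k → C^∞⟮I, X; ℝ⟯) (φ' : Fin l → C^∞⟮I, X; ℝ⟯) :
    diffForm (Fin.append φ φ') =
      detForm (k + l) (Fin.append (fun i => diff (φ i)) fun i => diff (φ' i)) :=
  (wedge_diffForm φ φ').symm.trans (altWedge_detForm _ _)

theorem fin_append_diff {k l : ℕ} (φ : Fin k → C^∞⟮I, X; ℝ⟯) (φ' : Fin l → C^∞⟮I, X; ℝ⟯) :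
    (fun i => diff (Fin.append φ φ' i)) =
      Fin.append (fun i => diff (φ i)) fun i => diff (φ' i) := by
  funext i
  refine Fin.addCases (fun i => ?_) (fun i => ?_) i <;> simp

end DualFrame

end Global

/-! ### The Leibniz rule -/

section Global

variable {n : ℕ} {H : Type*} [TopologicalSpace H]
  {I : ModelWithCorners ℝ (EuclideanSpace ℝ (Fin n)) H}
  {X : Type*} [TopologicalSpace X] [ChartedSpace H X] [IsManifold I ∞ X] [T2Space X]
  {G : Type*} [AddCommGroup G] [Module ℝ G] [TopologicalSpace G] [T2Space G]
  [IsTopologicalAddGroup G] [ContinuousSMul ℝ G] [LocallyConvexSpace ℝ G]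
  {m : ℕ} {H' : Type*} [TopologicalSpace H']
  {J : ModelWithCorners ℝ (EuclideanSpace ℝ (Fin m)) H'}
  {Y : Type*} [TopologicalSpace Y] [ChartedSpace H' Y] [IsManifold J ∞ Y] [T2Space Y]

/-- Multiplication by an integer. -/
def GForms.zsmulHom (z : ℤ) : GForms I X G →+ GForms I X G :=
  DistribSMul.toAddMonoidHom (GForms I X G) z

theorem GForms.zsmul_eq (z : ℤ) (θ : GForms I X G) : z • θ = GForms.zsmulHom z θ := rfl

/-- Both sides are additive in `z`, so `z = 1` suffices. -/
theorem GForms.zsmulHom_of (z : ℤ) {k : ℕ} (θ : TForm I X G k) :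
    GForms.zsmulHom z (DirectSum.of (TForm I X G) k θ) =
      DirectSum.of (TForm I X G) k ((z : C^∞⟮I, X; ℝ⟯) • θ) := by
  let f : ℤ →+ GForms I X G :=
    ⟨⟨fun z => GForms.zsmulHom z (DirectSum.of (TForm I X G) k θ), zero_smul ℤ (DirectSum.of (TForm I X G) k θ)⟩,
      fun z w => add_smul z w (DirectSum.of (TForm I X G) k θ)⟩
  let g : ℤ →+ GForms I X G :=
    ⟨⟨fun z => DirectSum.of (TForm I X G) k ((z : C^∞⟮I, X; ℝ⟯) • θ), by simp⟩,
      fun z w => by simp [add_smul]⟩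
  have h : f = g := by
    refine AddMonoidHom.ext_int ?_
    change GForms.zsmulHom 1 (DirectSum.of (TForm I X G) k θ) =
      DirectSum.of (TForm I X G) k (((1 : ℤ) : C^∞⟮I, X; ℝ⟯) • θ)
    rw [Int.cast_one, one_smul]
    exact one_smul ℤ _
  exact congrArg (fun f : ℤ →+ GForms I X G => f z) h

namespace DualFrame

variable {ι : Type} [Fintype ι] (e : DualFrame I X ι)

theorem of_diffForm_append_assoc {k l : ℕ} (f : SmoothFun I X G) (g : Fin 1 → C^∞⟮I, X; ℝ⟯)
    (φ : Fin k → C^∞⟮I, X; ℝ⟯) (φ' : Fin l → C^∞⟮I, X; ℝ⟯) :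
    DirectSum.of (TForm I X G) (1 + (k + l))
        (f ⊗ₜ diffForm (Fin.append g (Fin.append φ φ'))) =
      DirectSum.of (TForm I X G) (1 + k + l)
        (f ⊗ₜ diffForm (Fin.append (Fin.append g φ) φ')) := by
  rw [diffForm_append, diffForm_append, fin_append_diff, fin_append_diff]
  exact of_detForm_append_assoc f _ _ _

theorem of_diffForm_append_comm {k l : ℕ} (f : SmoothFun I X G) (g : Fin 1 → C^∞⟮I, X; ℝ⟯)
    (φ : Fin k → C^∞⟮I, X; ℝ⟯) (φ' : Fin l → C^∞⟮I, X; ℝ⟯) :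
    DirectSum.of (TForm I X G) (k + (1 + l))
        (f ⊗ₜ diffForm (Fin.append φ (Fin.append g φ'))) =
      DirectSum.of (TForm I X G) (1 + (k + l))
        (((-1 : C^∞⟮I, X; ℝ⟯) ^ k • f) ⊗ₜ diffForm (Fin.append g (Fin.append φ φ'))) := by
  rw [diffForm_append, diffForm_append, fin_append_diff, fin_append_diff]
  exact of_detForm_append_comm f _ _ _

theorem wedge_diffForm_tmul {k l : ℕ} (g : C^∞⟮I, X; ℝ⟯) (φ : Fin k → C^∞⟮I, X; ℝ⟯)
    (f : SmoothFun I X G) (φ' : Fin l → C^∞⟮I, X; ℝ⟯) :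
    GForms.wedge (DirectSum.of (Form I X) k (g • diffForm φ))
        (DirectSum.of (TForm I X G) l (f ⊗ₜ diffForm φ')) =
      DirectSum.of (TForm I X G) (k + l) ((g • f) ⊗ₜ diffForm (Fin.append φ φ')) := by
  rw [GForms.wedge_of]
  congr 1
  rw [map_smul, LinearMap.smul_apply, ← TensorProduct.smul_tmul', ← wedge_diffForm]
  rfl

theorem extD_diffForm {k : ℕ} (f : SmoothFun I X G) (φ : Fin k → C^∞⟮I, X; ℝ⟯) :
    e.extD (DirectSum.of (TForm I X G) k (f ⊗ₜ diffForm φ)) =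
      ∑ a, DirectSum.of (TForm I X G) (1 + k) (SmoothFun.lie (e.vec a) f ⊗ₜ
        diffForm (Fin.append (fun _ : Fin 1 => e.fn a) φ)) := by
  rw [extD_of, e.extDeriv_tmul e, map_sum]

/-- The term `dg ∧ dφ ∧ (f ⊗ dφ')` is expanded by `dg = ∑ dg(Y_a) dφ_a`, to match the shape of the
frame derivative. -/
theorem wedge_diffForm_append {k l : ℕ} (g : C^∞⟮I, X; ℝ⟯) (φ : Fin k → C^∞⟮I, X; ℝ⟯)
    (f : SmoothFun I X G) (φ' : Fin l → C^∞⟮I, X; ℝ⟯) :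
    GForms.wedge (DirectSum.of (Form I X) (1 + k)
        (diffForm (Fin.append (fun _ : Fin 1 => g) φ)))
          (DirectSum.of (TForm I X G) l (f ⊗ₜ diffForm φ')) =
      ∑ a, DirectSum.of (TForm I X G) (1 + (k + l)) ((diff g (e.vec a) • f) ⊗ₜ
        diffForm (Fin.append (fun _ : Fin 1 => e.fn a) (Fin.append φ φ'))) := by
  have h := wedge_diffForm_tmul 1 (Fin.append (fun _ : Fin 1 => g) φ) f φ'
  rw [one_smul, one_smul] at h
  rw [h, ← of_diffForm_append_assoc, ← e.sum_smul_diffForm, TensorProduct.tmul_sum, map_sum]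
  refine Finset.sum_congr rfl fun a _ => ?_
  rw [TensorProduct.smul_tmul]

/-- Moving the new differential in front of the `k` differentials of `φ` produces `(-1) ^ k`, which
cancels the sign of the Leibniz rule. -/
theorem zsmulHom_wedge_extD {k l : ℕ} (g : C^∞⟮I, X; ℝ⟯) (φ : Fin k → C^∞⟮I, X; ℝ⟯)
    (f : SmoothFun I X G) (φ' : Fin l → C^∞⟮I, X; ℝ⟯) :
    GForms.zsmulHom ((-1) ^ k) (GForms.wedge (DirectSum.of (Form I X) k (g • diffForm φ))
        (e.extD (DirectSum.of (TForm I X G) l (f ⊗ₜ diffForm φ')))) =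
      ∑ a, DirectSum.of (TForm I X G) (1 + (k + l)) ((g • SmoothFun.lie (e.vec a) f) ⊗ₜ
        diffForm (Fin.append (fun _ : Fin 1 => e.fn a) (Fin.append φ φ'))) := by
  rw [extD_diffForm, map_sum, map_sum]
  refine Finset.sum_congr rfl fun a _ => ?_
  rw [wedge_diffForm_tmul, of_diffForm_append_comm, GForms.zsmulHom_of,
    TensorProduct.smul_tmul', smul_smul, Int.cast_pow, Int.cast_neg, Int.cast_one, ← mul_pow,
    neg_one_mul, neg_neg, one_pow, one_smul]

/-- With both terms in the same shape, what remains is the product rule for `g • f` along each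
`e.vec a`. -/
theorem extD_wedge_tmul {k l : ℕ} (g : C^∞⟮I, X; ℝ⟯) (φ : Fin k → C^∞⟮I, X; ℝ⟯)
    (f : SmoothFun I X G) (φ' : Fin l → C^∞⟮I, X; ℝ⟯) :
    e.extD (GForms.wedge (DirectSum.of (Form I X) k (g • diffForm φ))
        (DirectSum.of (TForm I X G) l (f ⊗ₜ diffForm φ'))) =
      GForms.wedge (DirectSum.of (Form I X) (1 + k) (e.scalarD k (g • diffForm φ)))
        (DirectSum.of (TForm I X G) l (f ⊗ₜ diffForm φ')) +
      GForms.zsmulHom ((-1) ^ k) (GForms.wedge (DirectSum.of (Form I X) k (g • diffForm φ))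
        (e.extD (DirectSum.of (TForm I X G) l (f ⊗ₜ diffForm φ')))) := by
  rw [zsmulHom_wedge_extD, scalarD_smul_diffForm, e.wedge_diffForm_append, wedge_diffForm_tmul,
    extD_diffForm, ← Finset.sum_add_distrib]
  refine Finset.sum_congr rfl fun a _ => ?_
  rw [SmoothFun.lie_smul, TensorProduct.add_tmul, map_add, add_comm]

/-- All terms are additive in `α` and in `η`, so products of differentials of frame functions
suffice. -/
theorem extD_wedge {k : ℕ} (α : Form I X k) (η : GForms I X G) :
    e.extD (GForms.wedge (DirectSum.of (Form I X) k α) η) =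
      GForms.wedge (DirectSum.of (Form I X) (1 + k) (e.scalarD k α)) η +
        (-1 : ℤ) ^ k • GForms.wedge (DirectSum.of (Form I X) k α) (e.extD η) := by
  rw [GForms.zsmul_eq]
  induction η using e.gforms_induction with
  | h0 =>
    simp only [map_zero]
    exact (zero_add _).symm
  | hadd θ η h h' =>
    simp only [map_add]
    rw [h, h']
    exact add_add_add_comm _ _ _ _
  | h l f r' =>
    induction α using e.form_induction with
    | h0 =>
      have h : e.scalarD k 0 = 0 := by simp only [scalarD, map_zero]
      simp only [h, map_zero, LinearMap.zero_apply]
      exact (zero_add _).symm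
    | hadd α β h h' =>
      simp only [scalarD_add, map_add, LinearMap.add_apply]
      rw [h, h']
      exact add_add_add_comm _ _ _ _
    | h g r => exact e.extD_wedge_tmul _ _ _ _

end DualFrame

end Global

/-! ### The chart formula and its uniqueness -/

section Final

variable {n : ℕ} {H : Type*} [TopologicalSpace H]
  {I : ModelWithCorners ℝ (EuclideanSpace ℝ (Fin n)) H}
  {X : Type*} [TopologicalSpace X] [ChartedSpace H X] [IsManifold I ∞ X] [T2Space X]
  {G : Type*} [AddCommGroup G] [Module ℝ G] [TopologicalSpace G] [T2Space G]
  [IsTopologicalAddGroup G] [ContinuousSMul ℝ G] [LocallyConvexSpace ℝ G]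

theorem diffForm_one (g : C^∞⟮I, X; ℝ⟯) (Z : Fin 1 → VField I X) :
    diffForm (fun _ => g) Z = diff g (Z 0) := by
  refine (detForm_apply _ _).trans ?_
  simp

theorem diffForm_zero (φ : Fin 0 → C^∞⟮I, X; ℝ⟯) :
    diffForm φ = AlternatingMap.constOfIsEmpty C^∞⟮I, X; ℝ⟯ (VField I X) (Fin 0) 1 := by
  refine AlternatingMap.ext fun Z => (detForm_apply _ _).trans ?_
  simp

namespace GlobalChart

variable (c : GlobalChart I X)

theorem dx_eq (j : Fin n) : c.dx j = diffForm fun _ => c.coord j :=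
  AlternatingMap.ext fun Z => (diffForm_one _ Z).symm

theorem dxs_eq (S : Finset (Fin n)) :
    c.dxs S = diffForm fun a => c.coord (S.orderEmbOfFin rfl a) := rfl

/-- `extDeriv_tmul` allows computing with the coordinate frame, whose derivations are the partial
derivatives. -/
theorem extD_form {ι : Type} [Fintype ι] (e : DualFrame I X ι)
    (f : Finset (Fin n) → SmoothFun I X G) : e.extD (c.form f) = c.dForm f := by
  rw [form, map_sum, dForm]
  refine Finset.sum_congr rfl fun S _ => ?_
  rw [dxs_eq, e.extD_of, e.extDeriv_tmul c.frame, map_sum]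
  refine Finset.sum_congr rfl fun j _ => ?_
  rw [partialDeriv_eq_lie, dx_eq, wedge_diffForm]
  rfl

theorem form_add (f f' : Finset (Fin n) → SmoothFun I X G) :
    c.form (f + f') = c.form f + c.form f' := by
  simp only [form, Pi.add_apply, TensorProduct.add_tmul, map_add]
  exact Finset.sum_add_distrib

theorem form_zero : c.form (0 : Finset (Fin n) → SmoothFun I X G) = 0 := by
  simp only [form, Pi.zero_apply, TensorProduct.zero_tmul, map_zero]
  exact Finset.sum_const_zero

theorem form_single (S : Finset (Fin n)) (f : SmoothFun I X G) :
    c.form (Pi.single S f) = DirectSum.of (TForm I X G) S.card (f ⊗ₜ c.dxs S) := by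
  rw [form, Finset.sum_eq_single S]
  · rw [Pi.single_eq_same]
  · intro T _ hT
    rw [Pi.single_eq_of_ne hT, TensorProduct.zero_tmul, map_zero]
  · simp

/-- In the coordinate frame every form is a sum of terms `f ⊗ dx_{r 1} ∧ … ∧ dx_{r k}`. Such a
product vanishes if an index repeats; otherwise sorting the indices changes it only by a sign. -/
theorem form_surjective : Function.Surjective (c.form (G := G)) := by
  intro θ
  refine c.frame.gforms_induction (p := fun θ => ∃ f, c.form f = θ) ⟨0, c.form_zero⟩ ?_ ?_ θ
  · rintro _ _ ⟨f, rfl⟩ ⟨f', rfl⟩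
    exact ⟨f + f', c.form_add f f'⟩
  intro k f r
  by_cases hr : Function.Injective r
  · set S := Finset.univ.image r with hS
    have hk : S.card = k := by
      rw [hS, Finset.card_image_of_injective _ hr, Finset.card_univ, Fintype.card_fin]
    have hmem : ∀ i, r i ∈ S := fun i => Finset.mem_image_of_mem r (Finset.mem_univ i)
    -- The rank of `r i` within the image of `r`; it gives the permutation that sorts the indices.
    let s : Fin k → Fin k := fun i => (S.orderIsoOfFin hk).symm ⟨r i, hmem i⟩
    have hs : Function.Injective s := fun i j hij =>
      hr (congrArg Subtype.val ((S.orderIsoOfFin hk).symm.injective hij))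
    let σ : Equiv.Perm (Fin k) := Equiv.ofBijective s (Finite.injective_iff_bijective.1 hs)
    have hrσ : ∀ i, r i = S.orderEmbOfFin hk (σ i) := by
      intro i
      change r i = ((S.orderIsoOfFin hk) ((S.orderIsoOfFin hk).symm ⟨r i, hmem i⟩) : Fin n)
      rw [OrderIso.apply_symm_apply]
    have h1 : diffForm (fun i => c.frame.fn (r i)) = Equiv.Perm.sign σ •
        diffForm fun i => c.coord (S.orderEmbOfFin hk i) := by
      refine Eq.trans ?_ (AlternatingMap.map_perm (detForm k)
        (fun i => diff (c.coord (S.orderEmbOfFin hk i))) σ)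
      refine congrArg (detForm k) (funext fun i => ?_)
      exact congrArg (fun a => diff (c.coord a)) (hrσ i)
    refine ⟨Pi.single S ((((Equiv.Perm.sign σ : ℤˣ) : ℤ) : C^∞⟮I, X; ℝ⟯) • f), ?_⟩
    rw [form_single, h1, Units.smul_def, ← Int.cast_smul_eq_zsmul C^∞⟮I, X; ℝ⟯,
      ← TensorProduct.smul_tmul, dxs_eq]
    -- Only the identification of the degree `k` with `S.card` remains. Forgetting how `S` and the
    -- coefficient arose lets `k` be substituted.
    generalize hg : (((Equiv.Perm.sign σ : ℤˣ) : ℤ) : C^∞⟮I, X; ℝ⟯) • f = g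
    clear hg h1 hrσ σ hs s
    clear_value S
    subst hk
    rfl
  · have h0 : diffForm (fun i => c.frame.fn (r i)) = 0 := by
      rw [Function.not_injective_iff] at hr
      obtain ⟨i, j, hij, hne⟩ := hr
      exact AlternatingMap.map_eq_zero_of_eq _ _
        (congrArg (fun a => diff (c.frame.fn a)) hij) hne
    exact ⟨0, by rw [c.form_zero, h0, TensorProduct.tmul_zero, map_zero]⟩

end GlobalChart

/-- The frame derivative commutes with restriction and depends only on the form, so whichever
coefficients represent the restriction of `θ`, their `dForm` is the restriction of the frame
derivative. Locality of forms gives uniqueness, and `form_surjective` gives existence. -/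
theorem isExtDeriv_iff {ι : Type} [Fintype ι] (e : DualFrame I X ι) (θ η : GForms I X G) :
    IsExtDeriv θ η ↔ η = e.extD θ := by
  constructor
  · intro h
    refine GForms.ext_local e fun V ⟨c⟩ => ?_
    obtain ⟨f, hf, hf'⟩ := h V c
    rw [← c.frame.pull_extD e, hf, hf', c.extD_form]
  · rintro rfl V c
    obtain ⟨f, hf⟩ := c.form_surjective (GForms.pull (incl I V) θ)
    exact ⟨f, hf.symm, by rw [← c.frame.pull_extD e, ← hf, c.extD_form]⟩

theorem extD_eq {ι : Type} [Fintype ι] (e : DualFrame I X ι) (θ : GForms I X G) :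
    extD θ = e.extD θ :=
  (isExtDeriv_iff e θ _).1 (Classical.epsilon_spec
    (⟨_, (isExtDeriv_iff e θ _).2 rfl⟩ : ∃ η, IsExtDeriv θ η))

theorem scalarD_of {ι : Type} [Fintype ι] (e : DualFrame I X ι) {k : ℕ} (α : Form I X k) :
    scalarD (DirectSum.of (Form I X) k α) = DirectSum.of (Form I X) (1 + k) (e.scalarD k α) := by
  have h1 : GForms.ofScalar (DirectSum.of (Form I X) k α) =
      DirectSum.of (TForm I X ℝ) k (TForm.ofScalar k α) :=
    DirectSum.lmap_lof (fun k => TForm.ofScalar k) k α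
  rw [scalarD, extD_eq e, h1, e.extD_of]
  exact DirectSum.lmap_lof (fun k => TForm.toScalar k) (1 + k) _

/-- A function is a form of degree zero, that is, `f` times the empty product of differentials;
`dual_extDeriv_eq` puts `d(χ ∘ f)` in front of it. -/
theorem toScalar_push_extD_ofFun {ι : Type} [Fintype ι] (e : DualFrame I X ι) (χ : G →L[ℝ] ℝ)
    (f : SmoothFun I X G) :
    GForms.toScalar (GForms.push χ (extD (GForms.ofFun f))) =
      DirectSum.of (Form I X) 1 (diffForm fun _ => SmoothFun.dual χ f) := by
  let φ : Fin 0 → C^∞⟮I, X; ℝ⟯ := Fin.elim0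
  have h1 : GForms.ofFun f = DirectSum.of (TForm I X G) 0 (f ⊗ₜ diffForm φ) := by
    rw [diffForm_zero]
    rfl
  have h2 := e.dual_extDeriv_eq χ (TForm.dual_tmul χ f (diffForm φ))
  rw [extD_eq e, h1, e.extD_of]
  have h3 : ∀ θ : TForm I X G 1, GForms.toScalar (GForms.push χ (DirectSum.of (TForm I X G) 1 θ)) =
      DirectSum.of (Form I X) 1 (TForm.dual χ 1 θ) := by
    intro θ
    have h4 : GForms.push χ (DirectSum.of (TForm I X G) 1 θ) =
      DirectSum.of (TForm I X ℝ) 1 (TForm.push χ 1 θ) :=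
      DirectSum.lmap_lof (fun k => TForm.push χ k) 1 θ
    rw [h4]
    exact DirectSum.lmap_lof (fun k => TForm.toScalar k) 1 _
  refine (h3 _).trans (congrArg _ (h2.trans (congrArg diffForm ?_)))
  funext i
  exact Fin.append_left (fun _ : Fin 1 => SmoothFun.dual χ f) φ i

end Final

end GForm

end

theorem mainTheorem4 {𝕜 : Type*} [RCLike 𝕜]
    {G : Type*} [AddCommGroup G] [Module ℝ G] [Module 𝕜 G] [IsScalarTower ℝ 𝕜 G]
    [TopologicalSpace G] [T2Space G] [IsTopologicalAddGroup G] [ContinuousSMul ℝ G]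
    [ContinuousSMul 𝕜 G] [LocallyConvexSpace ℝ G]
    {n : ℕ} {H : Type*} [TopologicalSpace H]
    (I : ModelWithCorners ℝ (EuclideanSpace ℝ (Fin n)) H)
    {M : Type*} [TopologicalSpace M] [T2Space M] [SecondCountableTopology M]
    [ChartedSpace H M] [IsManifold I ∞ M] (U : TopologicalSpace.Opens M)
    {m : ℕ} {H' : Type*} [TopologicalSpace H']
    (J : ModelWithCorners ℝ (EuclideanSpace ℝ (Fin m)) H')
    {N : Type*} [TopologicalSpace N] [T2Space N] [SecondCountableTopology N]
    [ChartedSpace H' N] [IsManifold J ∞ N] (U' : TopologicalSpace.Opens N) :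
    -- existence and uniqueness of the exterior derivative
    (∀ θ η : GForm.GForms I U G, GForm.IsExtDeriv θ η ↔ η = GForm.extD θ) ∧
    -- linearity
    IsLinearMap ℝ (GForm.extD : GForm.GForms I U G → GForm.GForms I U G) ∧
    -- Leibniz rule
    (∀ (k : ℕ) (α : GForm.Form I U k) (η : GForm.GForms I U G),
      GForm.extD (GForm.GForms.wedge (DirectSum.of (GForm.Form I U) k α) η) =
        GForm.GForms.wedge (GForm.scalarD (DirectSum.of (GForm.Form I U) k α)) η +
          (-1 : ℤ) ^ k • GForm.GForms.wedge (DirectSum.of (GForm.Form I U) k α) (GForm.extD η)) ∧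
    -- the square of the exterior derivative vanishes
    (∀ θ : GForm.GForms I U G, GForm.extD (GForm.extD θ) = 0) ∧
    -- for a function `f` and a functional `ψ`, the form `(Re ψ)_× (df)` is the `1`-form
    -- `X ↦ X (Re ψ ∘ f)`
    (∀ (ψ : G →L[𝕜] 𝕜) (f : GForm.SmoothFun I U G), ∃ β : GForm.Form I U 1,
      GForm.GForms.toScalar (GForm.GForms.push
        ((RCLike.reCLM : 𝕜 →L[ℝ] ℝ).comp (ψ.restrictScalars ℝ))
        (GForm.extD (GForm.GForms.ofFun f))) = DirectSum.of (GForm.Form I U) 1 β ∧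
      ∀ X : GForm.VField I U, β (fun _ => X) = GForm.diff (GForm.SmoothFun.toReal
        (GForm.SmoothFun.push ((RCLike.reCLM : 𝕜 →L[ℝ] ℝ).comp (ψ.restrictScalars ℝ)) f)) X) ∧
    -- naturality
    (∀ (F : C^∞⟮I, U; J, U'⟯) (θ : GForm.GForms J U' G),
      GForm.extD (GForm.GForms.pull F θ) = GForm.GForms.pull F (GForm.extD θ)) := by
  -- The open subsets are themselves Hausdorff second countable manifolds. One frame on each
  -- suffices, since the chosen derivative equals the derivative in any frame.
  obtain ⟨_, ⟨e⟩⟩ := GForm.exists_dualFrame I U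
  obtain ⟨_, ⟨e'⟩⟩ := GForm.exists_dualFrame J U'
  refine ⟨fun θ η => ?_, ⟨fun θ η => ?_, fun a θ => ?_⟩, fun k α η => ?_, fun θ => ?_,
    fun ψ f => ?_, fun F θ => ?_⟩
  · rw [GForm.extD_eq e, GForm.isExtDeriv_iff e]
  · rw [GForm.extD_eq e, GForm.extD_eq e, GForm.extD_eq e, map_add]
  · rw [GForm.extD_eq e, GForm.extD_eq e, e.extD_smul]
  · rw [GForm.extD_eq e, GForm.extD_eq e, GForm.scalarD_of e, e.extD_wedge]
  · rw [GForm.extD_eq e, GForm.extD_eq e, e.extD_extD]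
  · exact ⟨_, GForm.toScalar_push_extD_ofFun e _ f, fun X => GForm.diffForm_one _ _⟩
  · rw [GForm.extD_eq e, GForm.extD_eq e', e.pull_extD e']
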